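/- **Conventions.** $\|f\|_{C^k}=\sum_{j\le k}\sup|D^jf|$. A *billiard table* is a bounded strictly convex planar domain $\Omega$ whose boundary is parametrized by a regular $C^2$ closed curve $\gamma:\mathbb R/L\mathbb Z\to\mathbb R^2$, run through once. Its lifted billiard map $F(s,r)=(s',r')$ acts on $\mathbb R\times(-1,1)$: $s$ is the lifted boundary parameter, $r=-\cos\theta$ with $\theta$ the angle between the velocity and $\dot\gamma(s)$, and the lift satisfies $s<s'<s+L$. An orbit is $(p,q)$-periodic if it is $q$-periodic and winds $p$ times around the table in one period. A *caustic* is a closed $C^1$ curve in $\Omega$ (possibly with cusps; its tangent line varies continuously and makes a nonzero number of half turns along the curve, as it does for every regular convex curve) such that a billiard orbit with one segment tangent to it has all segments tangent to it. It is *$(p,q)$-rationally integrable* ($1\le p\le q/2$) if all its tangential orbits are $(p,q)$-periodic; a $4$-caustic is a $(1,4)$-rationally integrable one. A *$q$-loop orbit* is a billiard orbit segment of $q$ chords that returns to its starting point after winding exactly once (in the direction of $\gamma$) around the table; no reflection law is imposed at the starting point. **(a) $4$-loops.** For all $\kappa_0,\sigma,C>0$ there is $\varepsilon_2>0$, depending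 only on $\kappa_0,\sigma,C$, with the following property. Let $\gamma_0:\mathbb R/L\mathbb Z\to\mathbb R^2$ be a $C^4$ boundary parametrization of a billiard table with curvature $>\kappa_0$, $|\dot\gamma_0|\ge\sigma$ and $\|\gamma_0\|_{C^4}<C$, and let $$\mathcal V=\{\gamma\in C^4(\mathbb R/L\mathbb Z,\mathbb R^2):\ \|\gamma-\gamma_0\|_{C^2}<\varepsilon_2,\ \|\gamma\|_{C^4}<C\}.$$ Then every $\gamma\in\mathcal V$ parametrizes the boundary of a (strictly convex) billiard table. If the table of at least one $\gamma_\varepsilon\in\mathcal V$ admits a $4$-caustic, then for every $\gamma\in\mathcal V$ and every boundary point of its table there is exactly one $4$-loop orbit starting at that point. **(b) Twist maps.** Let $q\ge1$ and $M,B,\rho>0$. There are $\varepsilon_3,c>0$, depending only on $q,M,B,\rho$, such that the following holds for every $p\in\mathbb Z$. Let $H\in C^3(\mathbb R^2)$ satisfy $H(x+1,x'+1)=H(x,x')$, $|\partial_{ij}H|<M$, $\partial_{12}H<-\rho$ and $\|D^3H\|\le B$, and let $F(x,r)=(x',r')\iff r=-\partial_1H(x,x'),\ r'=\partial_2H(x,x')$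 be the lifted twist map it generates. Suppose that the induced map of $(\mathbb R/\mathbb Z)\times\mathbb R$ has an invariant closed curve, not homotopic to a point, on which $F^q(x,r)=(x+p,r)$. If $F_1$ is a lifted twist map with $C^2$ generating function $H_1$ (satisfying the same conditions, with some constants $M_1,\rho_1>0$ of its own and without the $C^3$ bound) and $\|H_1-H\|_{C^2}<\varepsilon_3$, then for every $x\in\mathbb R$ the equation $\pi_1F_1^q(x,r)=x+p$ has a unique solution $r=\bar r(x)$, the derivative $\partial_r\pi_1F_1^q(x,\bar r(x))$ exists, and $|\partial_r\pi_1F_1^q(x,\bar r(x))|>c$. **(c) Billiards.** Let $q\in\mathbb N$ and $C,\kappa_0>0$. There are $\varepsilon_4,c>0$, depending only on $q,C,\kappa_0$, such that the following holds for all $p$ with $1\le p\le q/2$. Let $\gamma:\mathbb R/L\mathbb Z\to\mathbb R^2$ be the $C^3$ arclength parametrization of the boundary of a billiard table, with curvature $>\kappa_0$, $L<C$ and $\|\gamma\|_{C^3}<C$, and suppose that this billiard admits a $(p,q)$-rationally integrable caustic. Let $\gamma_1:\mathbb R/L\mathbb Z\to\mathbb R^2$ be a regular $C^2$ parametrization of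 the boundary of a billiard table with $\|\gamma_1-\gamma\|_{C^2}<\varepsilon_4$, and let $F_1$ be its lifted billiard map. Then for every $s\in\mathbb R$ the equation $\pi_1F_1^q(s,r)=s+pL$ has a unique solution $r=\bar r(s)\in(-1,1)$, the derivative $\partial_r\pi_1F_1^q(s,\bar r(s))$ exists, and $$|\partial_r\pi_1F_1^q(s,\bar r(s))|>c,\qquad |\bar r(s)-1|>c,\qquad |\bar r(s)+1|>c .$$ -/

import Mathlib

open scoped ENNReal

noncomputable section

namespace LoopOrbits

/-- The Euclidean plane. -/
abbrev Plane : Type := EuclideanSpace ℝ (Fin 2)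

/-- The `C^k` norm `∑_{j ≤ k} sup_x ‖D^j f(x)‖`, with value `∞` if some derivative of order at most
`k` is unbounded.  It is only used for functions that are also assumed to be of class `C^k`. -/
def cNorm {E G : Type*} [NormedAddCommGroup E] [NormedSpace ℝ E] [NormedAddCommGroup G]
    [NormedSpace ℝ G] (k : ℕ) (f : E → G) : ℝ≥0∞ :=
  ∑ j ∈ Finset.range (k + 1), ⨆ x : E, ‖iteratedFDeriv ℝ j f x‖ₑ

/-! ## Twist maps -/

/-- Partial derivative in the first variable. -/
def partial₁ (H : ℝ × ℝ → ℝ) (z : ℝ × ℝ) : ℝ := deriv (fun t => H (t, z.2)) z.1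

/-- Partial derivative in the second variable. -/
def partial₂ (H : ℝ × ℝ → ℝ) (z : ℝ × ℝ) : ℝ := deriv (fun t => H (z.1, t)) z.2

/-- `H` is a generating function of a twist map of the annulus, with bound `M` for its second
partial derivatives and twist constant `ρ`. -/
structure IsTwistGenerating (H : ℝ × ℝ → ℝ) (M ρ : ℝ) : Prop where
  contDiff : ContDiff ℝ 2 H
  periodic : ∀ x x' : ℝ, H (x + 1, x' + 1) = H (x, x')
  bound₁₁ : ∀ z, |partial₁ (partial₁ H) z| < M
  bound₁₂ : ∀ z, |partial₁ (partial₂ H) z| < M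
  bound₂₂ : ∀ z, |partial₂ (partial₂ H) z| < M
  rho_pos : 0 < ρ
  twist : ∀ z, partial₁ (partial₂ H) z < -ρ

/-- `F : ℝ × ℝ → ℝ × ℝ` is the (lifted) twist map generated by `H`:
`F (x, r) = (x', r')` iff `r = -∂₁H(x, x')` and `r' = ∂₂H(x, x')`. -/
def IsGeneratedBy (F : ℝ × ℝ → ℝ × ℝ) (H : ℝ × ℝ → ℝ) : Prop :=
  ∀ x r x' r' : ℝ, F (x, r) = (x', r') ↔ r = -partial₁ H (x, x') ∧ r' = partial₂ H (x, x')

/-- An essential invariant curve of the map of the annulus `(ℝ/ℤ) × ℝ` whose lift is `F`.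
The closed curve is given by its lift `c : ℝ → ℝ × ℝ`; going once around the closed curve
translates the lift by `(k, 0)`, and the curve is not homotopic to a point iff `k ≠ 0`.
The image of the curve in the annulus is mapped by the map onto itself. -/
structure IsEssentialInvariantCurve (F : ℝ × ℝ → ℝ × ℝ) (c : ℝ → ℝ × ℝ) : Prop where
  continuous : Continuous c
  essential : ∃ k : ℤ, k ≠ 0 ∧ ∀ t, c (t + 1) = c t + ((k : ℝ), 0)
  invariant : F '' {z | ∃ (t : ℝ) (m : ℤ), z = c t + ((m : ℝ), 0)} =
    {z | ∃ (t : ℝ) (m : ℤ), z = c t + ((m : ℝ), 0)}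

/-- The twist map with lift `F` admits a `(p, q)`-rationally integrable curve: an essential
invariant curve all of whose points are `(p, q)`-periodic. -/
def HasIntegrableCurve (F : ℝ × ℝ → ℝ × ℝ) (p : ℤ) (q : ℕ) : Prop :=
  ∃ c : ℝ → ℝ × ℝ, IsEssentialInvariantCurve F c ∧ ∀ t, F^[q] (c t) = c t + ((p : ℝ), 0)

/-! ## Billiards -/

/-- `Ω` is a bounded strictly convex domain, and the `L`-periodic map `γ` is a regular `C²`
parametrization of its boundary, which is run through once in each period. -/
structure IsTable (Ω : Set Plane) (γ : ℝ → Plane) (L : ℝ) : Prop where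
  isOpen : IsOpen Ω
  nonempty : Ω.Nonempty
  isBounded : Bornology.IsBounded Ω
  convex : Convex ℝ Ω
  strictConvex : StrictConvex ℝ (closure Ω)
  contDiff : ContDiff ℝ 2 γ
  regular : ∀ t, deriv γ t ≠ 0
  period_pos : 0 < L
  periodic : Function.Periodic γ L
  injOn : Set.InjOn γ (Set.Ico 0 L)
  range_eq : Set.range γ = frontier Ω

/-- The (unsigned) curvature of a regular plane curve, in any parametrization. -/
def curvature (γ : ℝ → Plane) (t : ℝ) : ℝ :=
  |deriv γ t 0 * deriv (deriv γ) t 1 - deriv γ t 1 * deriv (deriv γ) t 0| / ‖deriv γ t‖ ^ 3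

/-- The unit tangent vector. -/
def unitTangent (γ : ℝ → Plane) (t : ℝ) : Plane := ‖deriv γ t‖⁻¹ • deriv γ t

/-- The unit vector that points from `γ a` to `γ b`. -/
def chordDir (γ : ℝ → Plane) (a b : ℝ) : Plane := ‖γ b - γ a‖⁻¹ • (γ b - γ a)

/-- The cosine of the angle between the chord from `γ a` to `γ b` and the tangent at `γ a`. -/
def cosOut (γ : ℝ → Plane) (a b : ℝ) : ℝ := inner ℝ (unitTangent γ a) (chordDir γ a b)

/-- The cosine of the angle between the chord from `γ a` to `γ b` and the tangent at `γ b`. -/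
def cosIn (γ : ℝ → Plane) (a b : ℝ) : ℝ := inner ℝ (unitTangent γ b) (chordDir γ a b)

/-- `F` is the lifted billiard map of the table with boundary `γ`, in the coordinates `(s, r)`,
`s ∈ ℝ` the (lifted) parameter of the boundary point and `r = -cos θ ∈ (-1, 1)`, where `θ` is the
angle between the velocity and the tangent.  The lift is the one with `s < s' < s + L`.  (The values
of `F` outside `ℝ × (-1, 1)` are irrelevant.) -/
def IsLiftedBilliardMap (γ : ℝ → Plane) (L : ℝ) (F : ℝ × ℝ → ℝ × ℝ) : Prop :=
  ∀ s r s' r' : ℝ, r ∈ Set.Ioo (-1 : ℝ) 1 →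
    (F (s, r) = (s', r') ↔ s < s' ∧ s' < s + L ∧ r = -cosOut γ s s' ∧ r' = -cosIn γ s s')

/-- `s` is the sequence of lifted parameters of the bounce points of a billiard orbit: at each
bounce the angle of incidence equals the angle of reflection. -/
structure IsBilliardOrbit (γ : ℝ → Plane) (L : ℝ) (s : ℤ → ℝ) : Prop where
  lt : ∀ k, s k < s (k + 1)
  lt_add : ∀ k, s (k + 1) < s k + L
  reflection : ∀ k, cosIn γ (s k) (s (k + 1)) = cosOut γ (s (k + 1)) (s (k + 2))

/-- The `q`-periodic orbit `s` winds `p` times around the table in one period.  As bounce points are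
lifted with increments in `(0, L)`, an orbit that runs against the orientation of `γ` and
winds `p` times around the table advances by `q - p` periods in its lift. -/
def IsPeriodicOrbit (L : ℝ) (p q : ℕ) (s : ℤ → ℝ) : Prop :=
  (∀ k : ℤ, s (k + q) = s k + p * L) ∨ (∀ k : ℤ, s (k + q) = s k + ((q : ℝ) - p) * L)

/-- The unit vector with angle `a`. -/
def unitVec (a : ℝ) : Plane := !₂[Real.cos a, Real.sin a]

/-- `c` is a closed `C¹` curve, possibly with singular points, whose tangent line at `c t` is the
line with angle `α t`; the tangent line depends continuously on `t` and makes a nonzero number of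
half turns along the curve.  Every closed regular `C¹` curve that is simple (in particular
every convex one) is of this form, and so are closed curves with cusps such as evolutes of ovals. -/
structure IsClosedCurveWithTangents (c : ℝ → Plane) (α : ℝ → ℝ) : Prop where
  contDiff : ContDiff ℝ 1 c
  periodic : Function.Periodic c 1
  continuous_angle : Continuous α
  turning : ∃ k : ℤ, k ≠ 0 ∧ ∀ t, α (t + 1) = α t + k * Real.pi
  tangent : ∀ t, ∃ l : ℝ, deriv c t = l • unitVec (α t)

/-- The line through `γ a` and `γ b` is a tangent line of the curve `c` (with tangent angles `α`). -/
def IsTangentChord (γ : ℝ → Plane) (c : ℝ → Plane) (α : ℝ → ℝ) (a b : ℝ) : Prop :=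
  ∃ t : ℝ, (∃ l : ℝ, c t = γ a + l • (γ b - γ a)) ∧ ∃ m : ℝ, γ b - γ a = m • unitVec (α t)

/-- The curve `c` is a caustic of the billiard in `Ω`: it lies in `Ω`, and a billiard orbit that has
one segment tangent to `c` has all its segments tangent to `c`. -/
structure IsCaustic (Ω : Set Plane) (γ : ℝ → Plane) (L : ℝ) (c : ℝ → Plane) (α : ℝ → ℝ) :
    Prop where
  curve : IsClosedCurveWithTangents c α
  mem : ∀ t, c t ∈ Ω
  tangent : ∀ s : ℤ → ℝ, IsBilliardOrbit γ L s →
    (∃ k, IsTangentChord γ c α (s k) (s (k + 1))) → ∀ k, IsTangentChord γ c α (s k) (s (k + 1))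

/-- The billiard in `Ω` admits a `(p, q)`-rationally integrable caustic: a caustic all of whose
tangential orbits are `(p, q)`-periodic. -/
def AdmitsCaustic (Ω : Set Plane) (γ : ℝ → Plane) (L : ℝ) (p q : ℕ) : Prop :=
  ∃ (c : ℝ → Plane) (α : ℝ → ℝ), IsCaustic Ω γ L c α ∧
    ∀ s : ℤ → ℝ, IsBilliardOrbit γ L s →
      (∃ k, IsTangentChord γ c α (s k) (s (k + 1))) → IsPeriodicOrbit L p q s

/-- A `q`-loop orbit, given by the lifted parameters of its successive points: an orbit segment of
`q` chords that returns to its starting point after winding exactly once around the table. The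
reflection law is imposed at the `q - 1` intermediate points only. -/
structure IsLoopOrbit (γ : ℝ → Plane) (L : ℝ) (q : ℕ) (τ : Fin (q + 1) → ℝ) : Prop where
  lt : ∀ i : Fin q, τ i.castSucc < τ i.succ
  lt_add : ∀ i : Fin q, τ i.succ < τ i.castSucc + L
  reflection : ∀ (i : ℕ) (hi : i + 2 < q + 1),
    cosIn γ (τ ⟨i, by omega⟩) (τ ⟨i + 1, by omega⟩) =
      cosOut γ (τ ⟨i + 1, by omega⟩) (τ ⟨i + 2, hi⟩)
  closed : τ (Fin.last q) = τ 0 + L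

/-- The set of closed `C⁴` curves (of period `L`) that are `ε`-close to `γ₀` in `C²` and whose
`C⁴` norm is less than `C`. -/
def curveNhd (L : ℝ) (γ₀ : ℝ → Plane) (ε C : ℝ) : Set (ℝ → Plane) :=
  {γ | ContDiff ℝ 4 γ ∧ Function.Periodic γ L ∧
    cNorm 2 (fun t => γ t - γ₀ t) < ENNReal.ofReal ε ∧ cNorm 4 γ < ENNReal.ofReal C}

end LoopOrbits

end

/-! Orbits of a twist map and of a billiard are the sequences that satisfy the discrete
Euler-Lagrange equation h₂(x_{k-1}, x_k) + h₁(x_k, x_{k+1}) = 0, where h₁ and h₂ are the partial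
derivatives of a generating function; for a billiard this function is minus the length of the chord.
All three statements reduce to one theorem on such equations, `exists_unique_closed_orbit`, which
uses only the derivatives of the generating function and the twist condition h₁₂ < 0.

A rationally integrable curve yields a continuous family of periodic sequences with the same
displacement P. By the twist condition two such sequences that touch without crossing coincide
(`IsPeriodicSeq.eq_of_le_of_eq`). Hence the sequences are totally ordered, exactly one passes
through each point, and "next point" is an increasing homeomorphism φ of the line with φ^q = id + P
(`exists_graph_map`). The Euler-Lagrange equation makes φ bi-Lipschitz with constant 2M/ρ, where M
bounds the second derivatives and -ρ bounds h₁₂ from above.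

Existence, uniqueness and nondegeneracy for an ε-close equation are proved by shooting from x with
second point y. Far from the graph, |y - φ(x)| ≥ Kε: each step multiplies the deviation from the
graph by a positive factor bounded below, up to an error O(ε), so the deviation keeps its sign for q
steps. Monotonicity of φ then puts the last point strictly on one side of φ^q(x) = x + P, and the
segment does not close (`InvariantGraph.far`). Near the graph, |y - φ(x)| ≤ Kε: the segment shadows
the orbit of x under φ. The differences of this orbit and a neighbouring orbit on the graph are
positive and almost solve the linearized (Jacobi) equation along the segment. Comparison with them
(`jacobi_lower_bound`) shows that the derivative of the last point in y is at least some c > 0. So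
the last point is strictly increasing in y on this window, and the intermediate value theorem gives
exactly one closing y.

For billiards two further points are needed. First, the twist condition degenerates as chords
shrink. On curves with uniform bounds, 1 minus the cosine of a reflection angle is comparable with
the square of the parameter length of the chord, so consecutive chords are comparable by the
reflection law, and in a segment of q chords that closes up after 1 ≤ p < q turns all parameter gaps
lie in [δ, L - δ] (`exists_gap_bound`). There all second derivatives are under control
(`exists_jet_bounds`). Secondly, a caustic has to be turned into a family of orbits: from a point of
the caustic the boundary is seen under a strictly increasing angle, so the ends of the tangent chord
move continuously, and they tend to infinity in the lift because the tangent line turns a nonzero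
number of times (`IsOval.exists_tangent_family`). -/

noncomputable section
namespace LoopOrbits

open Filter Topology

/-! ## Generating functions and discrete Euler-Lagrange equations -/

/-- The first and second partial derivatives of a generating function. -/
structure GenJet where
  h1 : ℝ × ℝ → ℝ
  h2 : ℝ × ℝ → ℝ
  h11 : ℝ × ℝ → ℝ
  h12 : ℝ × ℝ → ℝ
  h22 : ℝ × ℝ → ℝ

/-- The pairs of points whose difference lies in `I`. -/
def gapSet (I : Set ℝ) : Set (ℝ × ℝ) := {z | z.2 - z.1 ∈ I}

/-- The linear form with coefficients `a` and `b`. -/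
def form (a b : ℝ) : ℝ × ℝ →L[ℝ] ℝ :=
  a • ContinuousLinearMap.fst ℝ ℝ ℝ + b • ContinuousLinearMap.snd ℝ ℝ ℝ

@[simp] lemma form_apply (a b : ℝ) (z : ℝ × ℝ) : form a b z = a * z.1 + b * z.2 := by
  simp [form]

lemma convex_gapSet {I : Set ℝ} (hI : Convex ℝ I) : Convex ℝ (gapSet I) :=
  hI.linear_preimage (LinearMap.snd ℝ ℝ ℝ - LinearMap.fst ℝ ℝ ℝ)

lemma gapSet_mono {I J : Set ℝ} (h : J ⊆ I) : gapSet J ⊆ gapSet I := fun _ hz => h hz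

/-- `G` is the jet of a generating function that satisfies the twist condition on the pairs with
difference in `I`. -/
structure GenJet.IsTwist (G : GenJet) (I : Set ℝ) : Prop where
  isOpen : IsOpen I
  convex : Convex ℝ I
  hasDeriv₁ : ∀ z ∈ gapSet I, HasFDerivAt G.h1 (form (G.h11 z) (G.h12 z)) z
  hasDeriv₂ : ∀ z ∈ gapSet I, HasFDerivAt G.h2 (form (G.h12 z) (G.h22 z)) z
  cont₁₁ : ∀ z ∈ gapSet I, ContinuousAt G.h11 z
  cont₁₂ : ∀ z ∈ gapSet I, ContinuousAt G.h12 z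
  cont₂₂ : ∀ z ∈ gapSet I, ContinuousAt G.h22 z
  neg : ∀ z ∈ gapSet I, G.h12 z < 0

/-- Bounds for the second derivatives. -/
structure GenJet.Bounded (G : GenJet) (J : Set ℝ) (M ρ : ℝ) : Prop where
  abs₁₁ : ∀ z ∈ gapSet J, |G.h11 z| ≤ M
  abs₁₂ : ∀ z ∈ gapSet J, |G.h12 z| ≤ M
  abs₂₂ : ∀ z ∈ gapSet J, |G.h22 z| ≤ M
  twist : ∀ z ∈ gapSet J, G.h12 z ≤ -ρ

/-- The second derivatives are Lipschitz continuous. -/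
structure GenJet.Lip (G : GenJet) (J : Set ℝ) (B : ℝ) : Prop where
  lip₁₁ : ∀ z ∈ gapSet J, ∀ w ∈ gapSet J, |G.h11 z - G.h11 w| ≤ B * ‖z - w‖
  lip₁₂ : ∀ z ∈ gapSet J, ∀ w ∈ gapSet J, |G.h12 z - G.h12 w| ≤ B * ‖z - w‖
  lip₂₂ : ∀ z ∈ gapSet J, ∀ w ∈ gapSet J, |G.h22 z - G.h22 w| ≤ B * ‖z - w‖

/-- Two jets are `ε`-close. -/
structure GenJet.Close (G G' : GenJet) (J : Set ℝ) (ε : ℝ) : Prop where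
  close₁ : ∀ z ∈ gapSet J, |G'.h1 z - G.h1 z| ≤ ε
  close₂ : ∀ z ∈ gapSet J, |G'.h2 z - G.h2 z| ≤ ε
  close₁₁ : ∀ z ∈ gapSet J, |G'.h11 z - G.h11 z| ≤ ε
  close₁₂ : ∀ z ∈ gapSet J, |G'.h12 z - G.h12 z| ≤ ε
  close₂₂ : ∀ z ∈ gapSet J, |G'.h22 z - G.h22 z| ≤ ε

lemma norm_sub_le_of_mem_segment {z w ξ : ℝ × ℝ} (h : ξ ∈ segment ℝ z w) :
    ‖ξ - z‖ ≤ ‖w - z‖ := by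
  obtain ⟨a, b, ha, hb, hab, rfl⟩ := h
  have : a • z + b • w - z = b • (w - z) := by
    have : a = 1 - b := by linarith
    subst this; module
  rw [this, norm_smul, Real.norm_of_nonneg hb]
  nlinarith [norm_nonneg (w - z)]

namespace GenJet.IsTwist

variable {G : GenJet} {I J : Set ℝ}

lemma mvt₁ (hG : G.IsTwist I) (hJ : Convex ℝ J) (hJI : J ⊆ I) {z w : ℝ × ℝ}
    (hz : z ∈ gapSet J) (hw : w ∈ gapSet J) : ∃ ξ ∈ gapSet J, ‖ξ - z‖ ≤ ‖w - z‖ ∧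
      G.h1 w - G.h1 z = G.h11 ξ * (w.1 - z.1) + G.h12 ξ * (w.2 - z.2) := by
  obtain ⟨ξ, hξ, h⟩ := domain_mvt (f := G.h1) (s := gapSet J)
    (f' := fun z => form (G.h11 z) (G.h12 z))
    (fun x hx => (hG.hasDeriv₁ x (gapSet_mono hJI hx)).hasFDerivWithinAt) (convex_gapSet hJ) hz hw
  exact ⟨ξ, (convex_gapSet hJ).segment_subset hz hw hξ, norm_sub_le_of_mem_segment hξ, by simpa using h⟩

lemma mvt₂ (hG : G.IsTwist I) (hJ : Convex ℝ J) (hJI : J ⊆ I) {z w : ℝ × ℝ}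
    (hz : z ∈ gapSet J) (hw : w ∈ gapSet J) : ∃ ξ ∈ gapSet J, ‖ξ - z‖ ≤ ‖w - z‖ ∧
      G.h2 w - G.h2 z = G.h12 ξ * (w.1 - z.1) + G.h22 ξ * (w.2 - z.2) := by
  obtain ⟨ξ, hξ, h⟩ := domain_mvt (f := G.h2) (s := gapSet J)
    (f' := fun z => form (G.h12 z) (G.h22 z))
    (fun x hx => (hG.hasDeriv₂ x (gapSet_mono hJI hx)).hasFDerivWithinAt) (convex_gapSet hJ) hz hw
  exact ⟨ξ, (convex_gapSet hJ).segment_subset hz hw hξ, norm_sub_le_of_mem_segment hξ, by simpa using h⟩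

lemma h1_lt (hG : G.IsTwist I) {x y y' : ℝ} (hy : y - x ∈ I) (hy' : y' - x ∈ I) (h : y < y') :
    G.h1 (x, y') < G.h1 (x, y) := by
  obtain ⟨ξ, hξ, -, e⟩ := hG.mvt₁ hG.convex subset_rfl (z := (x, y)) (w := (x, y')) hy hy'
  have := hG.neg ξ hξ
  simp only [sub_self, mul_zero, zero_add] at e
  nlinarith

lemma h2_lt (hG : G.IsTwist I) {x x' y : ℝ} (hx : y - x ∈ I) (hx' : y - x' ∈ I) (h : x < x') :
    G.h2 (x', y) < G.h2 (x, y) := by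
  obtain ⟨ξ, hξ, -, e⟩ := hG.mvt₂ hG.convex subset_rfl (z := (x, y)) (w := (x', y)) hx hx'
  have := hG.neg ξ hξ
  simp only [sub_self, mul_zero, add_zero] at e
  nlinarith

lemma h1_lt_iff (hG : G.IsTwist I) {x y y' : ℝ} (hy : y - x ∈ I) (hy' : y' - x ∈ I) :
    G.h1 (x, y') < G.h1 (x, y) ↔ y < y' := by
  refine ⟨fun h => ?_, hG.h1_lt hy hy'⟩
  by_contra hc
  rcases (not_lt.1 hc).lt_or_eq with h' | rfl
  · exact absurd (hG.h1_lt hy' hy h') (not_lt.2 h.le)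
  · exact lt_irrefl _ h

lemma h1_inj (hG : G.IsTwist I) {x y y' : ℝ} (hy : y - x ∈ I) (hy' : y' - x ∈ I)
    (h : G.h1 (x, y) = G.h1 (x, y')) : y = y' := by
  rcases lt_trichotomy y y' with h' | h' | h'
  · exact absurd h (hG.h1_lt hy hy' h').ne'
  · exact h'
  · exact absurd h (hG.h1_lt hy' hy h').ne

/-- A solution `Y` of `h₁(u, Y) = v` depends continuously on parameters. -/
lemma continuousAt_of_h1 (hG : G.IsTwist I) {T : Type*} [TopologicalSpace T] {u v Y : T → ℝ}
    {t₀ : T} (hu : ContinuousAt u t₀) (hv : ContinuousAt v t₀)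
    (hY : ∀ᶠ t in 𝓝 t₀, (u t, Y t) ∈ gapSet I ∧ G.h1 (u t, Y t) = v t) : ContinuousAt Y t₀ := by
  obtain ⟨h0, h0'⟩ := hY.self_of_nhds
  have key : ∀ y, y - u t₀ ∈ I → (∀ᶠ t in 𝓝 t₀, y - u t ∈ I) ∧
      ContinuousAt (fun t => G.h1 (u t, y)) t₀ := by
    intro y hy
    refine ⟨(continuousAt_const.sub hu).eventually (hG.isOpen.mem_nhds hy), ?_⟩
    have h1 : ContinuousAt G.h1 (u t₀, y) := (hG.hasDeriv₁ (u t₀, y) hy).continuousAt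
    exact ContinuousAt.comp (f := fun t => (u t, y)) h1 (hu.prodMk continuousAt_const)
  obtain ⟨r, hr, hball⟩ := Metric.isOpen_iff.1 hG.isOpen _ h0
  refine Metric.continuousAt_iff'.2 fun δ hδ => ?_
  -- Both trial values Y t₀ ± η stay in the domain. As h₁ strictly decreases in its second argument,
  -- its values there enclose v t₀ strictly; this persists for nearby t and traps Y t.
  set η := min (δ / 2) (r / 2) with hη
  have hη0 : 0 < η := by positivity
  have hηr : η < r := lt_of_le_of_lt (min_le_right _ _) (by linarith)
  have hηδ : η < δ := lt_of_le_of_lt (min_le_left _ _) (by linarith)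
  have m1 : Y t₀ + η - u t₀ ∈ I := hball (by
    rw [Metric.mem_ball, Real.dist_eq, show Y t₀ + η - u t₀ - (Y t₀ - u t₀) = η by ring,
      abs_of_pos hη0]; exact hηr)
  have m2 : Y t₀ - η - u t₀ ∈ I := hball (by
    rw [Metric.mem_ball, Real.dist_eq, show Y t₀ - η - u t₀ - (Y t₀ - u t₀) = -η by ring,
      abs_neg, abs_of_pos hη0]; exact hηr)
  obtain ⟨a1, c1⟩ := key _ m1
  obtain ⟨a2, c2⟩ := key _ m2
  have l1 : G.h1 (u t₀, Y t₀ + η) < v t₀ := h0' ▸ hG.h1_lt h0 m1 (by linarith)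
  have l2 : v t₀ < G.h1 (u t₀, Y t₀ - η) := h0' ▸ hG.h1_lt m2 h0 (by linarith)
  filter_upwards [a1, a2, c1.eventually_lt hv l1, hv.eventually_lt c2 l2, hY] with t b1 b2 b3 b4 b5
  rw [← b5.2] at b3 b4
  have b3' := (hG.h1_lt_iff b5.1 b1).1 b3
  have b4' := (hG.h1_lt_iff b2 b5.1).1 b4
  rw [Real.dist_eq, abs_lt]
  constructor <;> linarith

/-- A solution `Y` of `h₁(u, Y) = v` is differentiable in a parameter. -/
lemma hasDerivAt_of_h1 (hG : G.IsTwist I) {u v Y : ℝ → ℝ} {t₀ u' v' : ℝ}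
    (hu : HasDerivAt u u' t₀) (hv : HasDerivAt v v' t₀)
    (hY : ∀ᶠ t in 𝓝 t₀, (u t, Y t) ∈ gapSet I ∧ G.h1 (u t, Y t) = v t) :
    HasDerivAt Y ((v' - G.h11 (u t₀, Y t₀) * u') / G.h12 (u t₀, Y t₀)) t₀ := by
  have hYc := hG.continuousAt_of_h1 hu.continuousAt hv.continuousAt hY
  obtain ⟨h0, h0'⟩ := hY.self_of_nhds
  -- The mean value point ξ t turns h₁(u, Y) = v into a linear relation between difference
  -- quotients. Continuity of Y forces ξ t to the base point, so the relation can be solved for the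
  -- slope of Y in the limit.
  have ex : ∀ t, ∃ ξ : ℝ × ℝ, ((u t, Y t) ∈ gapSet I ∧ G.h1 (u t, Y t) = v t) →
      ξ ∈ gapSet I ∧ ‖ξ - (u t₀, Y t₀)‖ ≤ ‖(u t, Y t) - (u t₀, Y t₀)‖ ∧
      G.h1 (u t, Y t) - G.h1 (u t₀, Y t₀) =
        G.h11 ξ * (u t - u t₀) + G.h12 ξ * (Y t - Y t₀) := by
    intro t
    by_cases h : (u t, Y t) ∈ gapSet I ∧ G.h1 (u t, Y t) = v t
    · obtain ⟨ξ, hξ⟩ := hG.mvt₁ hG.convex subset_rfl h0 h.1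
      exact ⟨ξ, fun _ => hξ⟩
    · exact ⟨0, fun h' => absurd h' h⟩
  choose ξ hξ using ex
  have hξt : Tendsto ξ (𝓝 t₀) (𝓝 (u t₀, Y t₀)) := by
    rw [tendsto_iff_norm_sub_tendsto_zero]
    have : Tendsto (fun t => ‖(u t, Y t) - (u t₀, Y t₀)‖) (𝓝 t₀) (𝓝 0) := by
      rw [← tendsto_iff_norm_sub_tendsto_zero]
      exact hu.continuousAt.prodMk_nhds hYc
    exact squeeze_zero' (Eventually.of_forall fun _ => norm_nonneg _)
      (hY.mono fun t ht => (hξ t ht).2.1) this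
  have hne : G.h12 (u t₀, Y t₀) ≠ 0 := (hG.neg _ h0).ne
  have t1 := ((hG.cont₁₁ _ h0).tendsto.comp hξt).mono_left (nhdsWithin_le_nhds (s := {t₀}ᶜ))
  have t2 := ((hG.cont₁₂ _ h0).tendsto.comp hξt).mono_left (nhdsWithin_le_nhds (s := {t₀}ᶜ))
  rw [hasDerivAt_iff_tendsto_slope] at hu hv ⊢
  refine ((hv.sub (t1.mul hu)).div t2 hne).congr' ?_
  filter_upwards [nhdsWithin_le_nhds hY, self_mem_nhdsWithin] with t ht htne
  have e := (hξ t ht).2.2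
  have n1 : G.h12 (ξ t) ≠ 0 := (hG.neg _ (hξ t ht).1).ne
  have n2 : t - t₀ ≠ 0 := sub_ne_zero.2 htne
  rw [ht.2, h0'] at e
  simp only [slope_def_field, Function.comp, Pi.div_apply]
  rw [e]
  field_simp
  ring

end GenJet.IsTwist

/-! ## Invariant graphs -/

/-- `φ` is the dynamics on an invariant graph of the twist map; its gaps lie in `J` with
margin `η`. -/
structure InvariantGraph (G : GenJet) (J : Set ℝ) (η : ℝ) (φ : ℝ → ℝ) : Prop where
  strictMono : StrictMono φ
  surjective : Function.Surjective φ
  gap : ∀ x d, |d - (φ x - x)| ≤ η → d ∈ J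
  del : ∀ x, G.h2 (x, φ x) + G.h1 (φ x, φ (φ x)) = 0

/-- An interval is cut into steps of length η, and the local estimates are added. -/
lemma sub_le_mul_of_local {f : ℝ → ℝ} {η Λ : ℝ} (hη : 0 < η)
    (h : ∀ x x', x ≤ x' → x' ≤ x + η → f x' - f x ≤ Λ * (x' - x)) :
    ∀ x x', x ≤ x' → f x' - f x ≤ Λ * (x' - x) := by
  have key : ∀ n : ℕ, ∀ x x', x ≤ x' → x' ≤ x + n * η → f x' - f x ≤ Λ * (x' - x) := by
    intro n
    induction n with
    | zero => intro x x' h1 h2; exact h x x' h1 (by simp at h2; linarith)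
    | succ n ih =>
      intro x x' h1 h2
      by_cases h3 : x' ≤ x + η
      · exact h x x' h1 h3
      · have a := h x (x + η) (by linarith) le_rfl
        have b := ih (x + η) x' (by linarith) (by push_cast at h2; linarith)
        linarith
  intro x x' hx
  obtain ⟨n, hn⟩ := exists_nat_ge ((x' - x) / η)
  rw [div_le_iff₀ hη] at hn
  exact key n x x' hx (by linarith)

namespace InvariantGraph

variable {G : GenJet} {I J : Set ℝ} {η M ρ : ℝ} {φ : ℝ → ℝ}

lemma mem (hφ : InvariantGraph G J η φ) (hη : 0 ≤ η) (x : ℝ) : (x, φ x) ∈ gapSet J :=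
  hφ.gap x _ (by simpa using hη)

/-- The Euler-Lagrange equations at w and w' are subtracted, and each difference is split by
changing one argument at a time. The two mixed second derivatives contribute at most -ρ times the
outer increments, the two pure ones at most M times the middle increment. The bound by η keeps the
mixed pairs in J. Dropping one of the two outer terms bounds φ or its inverse. -/
lemma lipschitz_aux (hφ : InvariantGraph G J η φ) (hG : G.IsTwist I) (hJ : Convex ℝ J)
    (hJI : J ⊆ I) (hB : G.Bounded J M ρ) (hη : 0 < η) {w w' : ℝ} (hw : w ≤ w')
    (hn : φ w' ≤ φ w + η) :
    ρ * (φ (φ w') - φ (φ w)) + ρ * (w' - w) ≤ 2 * M * (φ w' - φ w) := by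
  set x := φ w with hx
  set x' := φ w' with hx'
  have hxx : x ≤ x' := hφ.strictMono.monotone hw
  have hyy : φ x ≤ φ x' := hφ.strictMono.monotone hxx
  have e := hφ.del w
  have e' := hφ.del w'
  rw [← hx] at e; rw [← hx'] at e'
  have m1 : (x', φ x') ∈ gapSet J := hφ.mem hη.le x'
  have m2 : (x', φ x) ∈ gapSet J := hφ.gap x _ (by
    rw [show φ x - x' - (φ x - x) = -(x' - x) by ring, abs_neg, abs_of_nonneg] <;> linarith)
  have m3 : (x, φ x) ∈ gapSet J := hφ.mem hη.le x
  have m4 : (w, x') ∈ gapSet J := hφ.gap w _ (by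
    rw [← hx, show x' - w - (x - w) = (x' - x) by ring, abs_of_nonneg] <;> linarith)
  have m5 : (w, x) ∈ gapSet J := hφ.mem hη.le w
  have m6 : (w', x') ∈ gapSet J := hφ.mem hη.le w'
  obtain ⟨ξ1, k1, -, f1⟩ := hG.mvt₁ hJ hJI m2 m1
  obtain ⟨ξ2, k2, -, f2⟩ := hG.mvt₁ hJ hJI m3 m2
  obtain ⟨ξ3, k3, -, f3⟩ := hG.mvt₂ hJ hJI m5 m4
  obtain ⟨ξ4, k4, -, f4⟩ := hG.mvt₂ hJ hJI m4 m6
  simp only [sub_self, mul_zero, zero_add, add_zero] at f1 f2 f3 f4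
  have b1 := hB.twist _ k1
  have b2 := (abs_le.1 (hB.abs₁₁ _ k2)).2
  have b3 := (abs_le.1 (hB.abs₂₂ _ k3)).2
  have b4 := hB.twist _ k4
  nlinarith [mul_le_mul_of_nonneg_right b1 (sub_nonneg.2 hyy),
    mul_le_mul_of_nonneg_right b2 (sub_nonneg.2 hxx),
    mul_le_mul_of_nonneg_right b3 (sub_nonneg.2 hxx),
    mul_le_mul_of_nonneg_right b4 (sub_nonneg.2 hw)]

lemma lipschitz (hφ : InvariantGraph G J η φ) (hG : G.IsTwist I) (hJ : Convex ℝ J)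
    (hJI : J ⊆ I) (hB : G.Bounded J M ρ) (hη : 0 < η) (hρ : 0 < ρ) {x x' : ℝ} (h : x ≤ x') :
    φ x' - φ x ≤ 2 * M / ρ * (x' - x) := by
  refine sub_le_mul_of_local hη (fun x x' h h' => ?_) x x' h
  obtain ⟨w, rfl⟩ := hφ.surjective x
  obtain ⟨w', rfl⟩ := hφ.surjective x'
  have hw := hφ.strictMono.le_iff_le.1 h
  have := hφ.lipschitz_aux hG hJ hJI hB hη hw h'
  rw [div_mul_eq_mul_div, le_div_iff₀ hρ]
  nlinarith

lemma lipschitz_inv (hφ : InvariantGraph G J η φ) (hG : G.IsTwist I) (hJ : Convex ℝ J)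
    (hJI : J ⊆ I) (hB : G.Bounded J M ρ) (hη : 0 < η) (hρ : 0 < ρ) {x x' : ℝ} (h : x ≤ x') :
    x' - x ≤ 2 * M / ρ * (φ x' - φ x) := by
  obtain ⟨g, hg⟩ := hφ.surjective.hasRightInverse
  have hl : ∀ x, g (φ x) = x := fun x => hφ.strictMono.injective (hg (φ x))
  have := sub_le_mul_of_local (f := g) (Λ := 2 * M / ρ) hη (fun x x' h h' => ?_) (φ x) (φ x')
    (hφ.strictMono.monotone h)
  · simpa [hl] using this
  · obtain ⟨w, rfl⟩ := hφ.surjective x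
    obtain ⟨w', rfl⟩ := hφ.surjective x'
    have hw := hφ.strictMono.le_iff_le.1 h
    have := hφ.lipschitz_aux hG hJ hJI hB hη hw h'
    have h2 : φ (φ w) ≤ φ (φ w') := hφ.strictMono.monotone h
    rw [hl, hl, div_mul_eq_mul_div, le_div_iff₀ hρ]
    nlinarith

end InvariantGraph

/-- A solution of a discrete Jacobi equation that almost has positive solutions with bounded
slopes `m` grows at least exponentially slowly. -/
lemma jacobi_lower_bound (q : ℕ) (hq : 1 ≤ q) {M ρ Λ : ℝ} (hρ : 0 < ρ) (hM : ρ ≤ M) (hΛ : 1 ≤ Λ) :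
    ∃ τ > 0, ∃ c > 0, ∀ D β α m : ℕ → ℝ, D 0 = 0 → D 1 = 1 →
      (∀ k < q, ρ ≤ β k ∧ β k ≤ M) → (∀ k < q, Λ⁻¹ ≤ m k ∧ m k ≤ Λ) →
      (∀ k, k + 1 < q → -β k * D k + α k * D (k + 1) - β (k + 1) * D (k + 2) = 0) →
      (∀ k, k + 1 < q → |-β k / m k + α k - β (k + 1) * m (k + 1)| ≤ τ) → c ≤ D q := by
  have hM0 : 0 < M := hρ.trans_le hM
  have hΛ0 : 0 < Λ := one_pos.trans_le hΛ
  -- One step multiplies D (k+1) - m k * D k by at least (ρ/Λ)/M; half of this factor is kept, and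
  -- the other half absorbs the error.
  set μ := ρ / (2 * M * Λ) with hμ
  have hμ0 : 0 < μ := by positivity
  have hμ1 : μ ≤ 1 := by
    rw [hμ, div_le_one (by positivity)]
    nlinarith
  -- If the residual is at most 1 then α ≤ 1 + 2MΛ, so D grows at most by the factor (1 + 2MΛ)/ρ per
  -- step; the added 1 ensures Q ≥ 1.
  set Q := 1 + (1 + 2 * M * Λ) / ρ with hQ
  have hQ1 : 1 ≤ Q := by rw [hQ]; have : 0 < (1 + 2 * M * Λ) / ρ := by positivity
                         linarith
  refine ⟨min 1 (ρ / (2 * Λ) * μ ^ q / Q ^ q), by positivity, μ ^ q, by positivity, ?_⟩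
  intro D β α m hD0 hD1 hβ hm hrec hτ
  -- Discrete Riccati comparison: v k = D (k+1) - m k * D k measures by how much D outgrows the
  -- comparison slopes. The upper bound for D is carried along to control the error term.
  have key : ∀ k, k < q → μ ^ k ≤ D (k + 1) - m k * D k ∧ 0 ≤ D k ∧ 0 < D (k + 1) ∧
      D (k + 1) ≤ Q ^ k := by
    intro k
    induction k with
    | zero => intro _; simp [hD0, hD1]
    | succ k ih =>
      intro hk
      obtain ⟨i1, i2, i3, i4⟩ := ih (by omega)
      obtain ⟨b1, b2⟩ := hβ k (by omega)
      obtain ⟨b1', b2'⟩ := hβ (k + 1) hk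
      obtain ⟨m1, m2⟩ := hm k (by omega)
      obtain ⟨m1', m2'⟩ := hm (k + 1) hk
      have hmk : 0 < m k := (inv_pos.2 hΛ0).trans_le m1
      have hmk' : 0 < m (k + 1) := (inv_pos.2 hΛ0).trans_le m1'
      have r := hrec k hk
      set e := -β k / m k + α k - β (k + 1) * m (k + 1) with he
      have he1 : |e| ≤ 1 := (hτ k hk).trans (min_le_left _ _)
      have he2 : |e| ≤ ρ / (2 * Λ) * μ ^ q / Q ^ q := (hτ k hk).trans (min_le_right _ _)
      have hβm : β k / m k ≤ M * Λ := by
        rw [div_eq_mul_inv]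
        have : (m k)⁻¹ ≤ Λ := by rw [inv_le_comm₀ hmk hΛ0]; exact m1
        gcongr
      have hβm' : ρ / Λ ≤ β k / m k := by gcongr; linarith
      -- With residual e = 0 this is an exact positive recursion for v.
      have hv : β (k + 1) * (D (k + 2) - m (k + 1) * D (k + 1)) =
          β k / m k * (D (k + 1) - m k * D k) + e * D (k + 1) := by
        rw [he]; field_simp; linear_combination (-m k) * r
      have hDQ : D (k + 1) ≤ Q ^ q := i4.trans (pow_le_pow_right₀ hQ1 (by omega))
      have heD : |e * D (k + 1)| ≤ ρ / (2 * Λ) * μ ^ k := by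
        rw [abs_mul, abs_of_pos i3]
        calc |e| * D (k + 1) ≤ ρ / (2 * Λ) * μ ^ q / Q ^ q * Q ^ q := by gcongr
          _ = ρ / (2 * Λ) * μ ^ q := by field_simp
          _ ≤ _ := by
            gcongr ?_ * ?_
            exact pow_le_pow_of_le_one hμ0.le hμ1 (by omega)
      have hv2 : ρ / (2 * Λ) * μ ^ k ≤ β (k + 1) * (D (k + 2) - m (k + 1) * D (k + 1)) := by
        rw [hv]
        have h0 : 0 ≤ β k / m k := div_nonneg (by linarith) hmk.le
        have : ρ / Λ * μ ^ k ≤ β k / m k * (D (k + 1) - m k * D k) := by gcongr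
        have h2 : ρ / Λ = 2 * (ρ / (2 * Λ)) := by field_simp
        rw [h2] at this
        have := (abs_le.1 heD).1
        linarith
      have hvpos : 0 < D (k + 2) - m (k + 1) * D (k + 1) := by
        have : 0 < β (k + 1) * (D (k + 2) - m (k + 1) * D (k + 1)) :=
          lt_of_lt_of_le (by positivity) hv2
        exact pos_of_mul_pos_right this (hρ.trans_le b1').le
      have hv3 : μ ^ (k + 1) ≤ D (k + 2) - m (k + 1) * D (k + 1) := by
        have : ρ / (2 * Λ) * μ ^ k ≤ M * (D (k + 2) - m (k + 1) * D (k + 1)) :=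
          hv2.trans (by gcongr)
        rw [pow_succ, hμ]
        rw [hμ] at this
        have h3 : (ρ / (2 * M * Λ)) ^ k * (ρ / (2 * M * Λ)) =
          (ρ / (2 * Λ) * (ρ / (2 * M * Λ)) ^ k) / M := by field_simp
        rw [h3, div_le_iff₀ hM0]; linarith
      have hmD : 0 < m (k + 1) * D (k + 1) := by positivity
      refine ⟨hv3, i3.le, by linarith, ?_⟩
      have hα : α k ≤ 1 + 2 * M * Λ := by
        have h1 := (abs_le.1 he1).2
        have h2 : β (k + 1) * m (k + 1) ≤ M * Λ := by gcongr
        have : α k = e + β k / m k + β (k + 1) * m (k + 1) := by rw [he]; ring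
        linarith
      have h4 : ρ * D (k + 2) ≤ (1 + 2 * M * Λ) * D (k + 1) := by
        have h5 : ρ * D (k + 2) ≤ β (k + 1) * D (k + 2) := by
          have : 0 ≤ D (k + 2) := by linarith
          gcongr
        have h6 : 0 ≤ β k * D k := mul_nonneg (hρ.le.trans b1) i2
        have h7 : α k * D (k + 1) ≤ (1 + 2 * M * Λ) * D (k + 1) := by gcongr
        linarith
      have h8 : D (k + 2) ≤ (1 + 2 * M * Λ) / ρ * D (k + 1) := by
        rw [div_mul_eq_mul_div, le_div_iff₀ hρ]; linarith
      calc D (k + 1 + 1) ≤ (1 + 2 * M * Λ) / ρ * D (k + 1) := h8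
        _ ≤ Q * Q ^ k := by
          gcongr
          rw [hQ]; linarith
        _ = Q ^ (k + 1) := by ring
  obtain ⟨k, rfl⟩ : ∃ k, q = k + 1 := ⟨q - 1, by omega⟩
  obtain ⟨i1, i2, i3, i4⟩ := key k (by omega)
  have hmk : 0 < m k := (inv_pos.2 hΛ0).trans_le (hm k (by omega)).1
  calc μ ^ (k + 1) ≤ μ ^ k := pow_le_pow_of_le_one hμ0.le hμ1 (by omega)
    _ ≤ D (k + 1) := by nlinarith

/-! ### Deviation of perturbed orbits from an invariant graph. -/

namespace InvariantGraph

variable {G G₁ : GenJet} {I J : Set ℝ} {η M ρ ε : ℝ} {φ : ℝ → ℝ}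

lemma rho_le (hφ : InvariantGraph G J η φ) (hB : G.Bounded J M ρ) (hη : 0 < η) : ρ ≤ M := by
  have h := hφ.mem hη.le 0
  have h1 := hB.twist _ h
  have h2 := (abs_le.1 (hB.abs₁₂ _ h)).1
  linarith

lemma one_le (hφ : InvariantGraph G J η φ) (hB : G.Bounded J M ρ) (hη : 0 < η) (hρ : 0 < ρ) :
    1 ≤ 2 * M / ρ := by
  rw [le_div_iff₀ hρ]; linarith [hφ.rho_le hB hη]

/-- Both Lipschitz bounds in the form of a slope, so that no case distinction on the order of the
points is needed later. -/
lemma exists_slope (hφ : InvariantGraph G J η φ) (hG : G.IsTwist I) (hJ : Convex ℝ J)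
    (hJI : J ⊆ I) (hB : G.Bounded J M ρ) (hη : 0 < η) (hρ : 0 < ρ) (x x' : ℝ) :
    ∃ l, (2 * M / ρ)⁻¹ ≤ l ∧ l ≤ 2 * M / ρ ∧ x' - x = l * (φ x' - φ x) := by
  have hΛ := hφ.one_le hB hη hρ
  have key : ∀ x x', x < x' →
      ∃ l, (2 * M / ρ)⁻¹ ≤ l ∧ l ≤ 2 * M / ρ ∧ x' - x = l * (φ x' - φ x) := by
    intro x x' h
    have h1 := hφ.lipschitz hG hJ hJI hB hη hρ h.le
    have h2 := hφ.lipschitz_inv hG hJ hJI hB hη hρ h.le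
    have h3 : 0 < φ x' - φ x := sub_pos.2 (hφ.strictMono h)
    refine ⟨(x' - x) / (φ x' - φ x), ?_, ?_, by field_simp⟩
    · rw [le_div_iff₀ h3, inv_mul_le_iff₀ (by linarith)]; exact h1
    · rw [div_le_iff₀ h3]; exact h2
  rcases lt_trichotomy x x' with h | rfl | h
  · exact key x x' h
  · exact ⟨1, inv_le_one_of_one_le₀ hΛ, hΛ, by simp⟩
  · obtain ⟨l, h1, h2, h3⟩ := key x' x h
    exact ⟨l, h1, h2, by linarith⟩

/-- The distance of an orbit of a nearby map to the invariant graph is multiplied by a bounded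
factor, up to a small error. -/
lemma step (hφ : InvariantGraph G J η φ) (hG : G.IsTwist I) (hJ : Convex ℝ J)
    (hJI : J ⊆ I) (hB : G.Bounded J M ρ) (hη : 0 < η) (hρ : 0 < ρ) (hc : G.Close G₁ J ε)
    {x₀ x₁ x₂ : ℝ} (h0 : (x₀, x₁) ∈ gapSet J) (h1 : (x₁, x₂) ∈ gapSet J)
    (hd : G₁.h2 (x₀, x₁) + G₁.h1 (x₁, x₂) = 0) :
    ∃ θ e, ρ ^ 2 / (2 * M ^ 2) ≤ θ ∧ θ ≤ 2 * M ^ 2 / ρ ^ 2 ∧ |e| ≤ 2 * ε / ρ ∧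
      x₂ - φ x₁ = θ * (x₁ - φ x₀) + e := by
  -- The segment x₀, x₁, x₂ is compared with the graph orbit w, x₁, φ x₁ through the same middle
  -- point. The difference of the two Euler-Lagrange sums is linear in x₂ - φ x₁ and x₀ - w, and x₀
  -- - w is a bounded multiple of x₁ - φ x₀.
  obtain ⟨w, hw⟩ := hφ.surjective x₁
  have hdw := hφ.del w
  rw [hw] at hdw
  obtain ⟨l, l1, l2, l3⟩ := hφ.exists_slope hG hJ hJI hB hη hρ x₀ w
  have mw : (w, x₁) ∈ gapSet J := hw ▸ hφ.mem hη.le w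
  obtain ⟨ξ, k1, -, f1⟩ := hG.mvt₁ hJ hJI (hφ.mem hη.le x₁) h1
  obtain ⟨ζ, k2, -, f2⟩ := hG.mvt₂ hJ hJI mw h0
  simp only [sub_self, mul_zero, zero_add, add_zero] at f1 f2
  have a1 := hB.twist _ k1
  have a2 := hB.twist _ k2
  have b1 := (abs_le.1 (hB.abs₁₂ _ k1)).1
  have b2 := (abs_le.1 (hB.abs₁₂ _ k2)).1
  have c1 := abs_le.1 (hc.close₁ _ h1)
  have c2 := abs_le.1 (hc.close₂ _ h0)
  set β := -G.h12 ξ with hβ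
  set β' := -G.h12 ζ with hβ'
  have hβ0 : 0 < β := by linarith
  have hM0 : 0 < M := by linarith
  have hΛ0 : 0 < 2 * M / ρ := by positivity
  have hl0 : 0 < l := (inv_pos.2 hΛ0).trans_le l1
  rw [hw] at l3
  set E := G.h2 (x₀, x₁) + G.h1 (x₁, x₂) with hE
  have hE' : |E| ≤ 2 * ε := by rw [abs_le]; constructor <;> linarith
  refine ⟨β' / β * l, -E / β, ?_, ?_, ?_, ?_⟩
  · calc ρ ^ 2 / (2 * M ^ 2) = ρ / M * (2 * M / ρ)⁻¹ := by field_simp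
      _ ≤ β' / β * l := by
        have : 0 ≤ β' / β := div_nonneg (by linarith) hβ0.le
        gcongr <;> linarith
  · calc β' / β * l ≤ M / ρ * (2 * M / ρ) := by gcongr <;> linarith
      _ = _ := by field_simp
  · rw [abs_div, abs_neg, abs_of_pos hβ0]
    gcongr
    · linarith [abs_nonneg E]
    · linarith
  · field_simp
    linear_combination β' * l3 + f1 + f2 + hdw + hE

/-- An orbit of a nearby map that starts far from the invariant graph does not close up. -/
lemma far (hφ : InvariantGraph G J η φ) (hG : G.IsTwist I) (hJ : Convex ℝ J)
    (hJI : J ⊆ I) (hB : G.Bounded J M ρ) (hη : 0 < η) (hρ : 0 < ρ) (hε : 0 < ε)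
    (hc : G.Close G₁ J ε) {q : ℕ} {x : ℕ → ℝ}
    (hx : ∀ k < q, (x k, x (k + 1)) ∈ gapSet J)
    (hd : ∀ k, k + 1 < q → G₁.h2 (x k, x (k + 1)) + G₁.h1 (x (k + 1), x (k + 2)) = 0)
    {s : ℝ} (hs : |s| = 1) (h : 2 / ρ * (2 * (2 * M ^ 2 / ρ ^ 2)) ^ q * ε ≤ s * (x 1 - φ (x 0))) :
    ∀ k < q, 0 < s * (x (k + 1) - φ (x k)) := by
  have hM := hφ.rho_le hB hη
  have hM0 : 0 < M := hρ.trans_le hM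
  set A := 2 * (2 * M ^ 2 / ρ ^ 2) with hA
  have hA1 : 1 ≤ A := by
    rw [hA, mul_div_assoc', le_div_iff₀ (by positivity)]; nlinarith
  -- The factor of a step is at least 2/A, so a lower bound with weight A^(q-k) becomes twice the
  -- one with weight A^(q-k-1). One of the two copies pays for the error 2ε/ρ.
  have key : ∀ k < q, 2 / ρ * A ^ (q - k) * ε ≤ s * (x (k + 1) - φ (x k)) := by
    intro k
    induction k with
    | zero => intro _; simpa using h
    | succ k ih =>
      intro hk
      have ih' := ih (by omega)
      obtain ⟨θ, e, h1, h2, h3, h4⟩ := hφ.step hG hJ hJI hB hη hρ hc (hx k (by omega))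
        (hx (k + 1) hk) (hd k hk)
      have hse : -(2 * ε / ρ) ≤ s * e := by
        have : |s * e| ≤ 2 * ε / ρ := by rw [abs_mul, hs, one_mul]; exact h3
        exact (abs_le.1 this).1
      rw [h4]
      have e1 : ρ ^ 2 / (2 * M ^ 2) = 2 / A := by rw [hA]; field_simp
      rw [e1] at h1
      have hθ : 0 ≤ θ := le_trans (by positivity) h1
      have e2 : q - k = q - (k + 1) + 1 := by omega
      rw [e2, pow_succ] at ih'
      have e3 : 1 ≤ A ^ (q - (k + 1)) := one_le_pow₀ hA1
      have h5 : 2 / A * (2 / ρ * (A ^ (q - (k + 1)) * A) * ε) ≤ θ * (s * (x (k + 1) - φ (x k))) := by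
        gcongr
      have h6 : 2 / A * (2 / ρ * (A ^ (q - (k + 1)) * A) * ε) =
        2 * (2 / ρ * A ^ (q - (k + 1)) * ε) := by field_simp
      have h7 : 2 * ε / ρ ≤ 2 / ρ * A ^ (q - (k + 1)) * ε := by
        rw [show 2 * ε / ρ = 2 / ρ * 1 * ε by ring]; gcongr
      rw [h6] at h5
      linarith
  intro k hk
  exact lt_of_lt_of_le (by positivity) (key k hk)

/-- The next point of an orbit of a nearby map stays close to the invariant graph. -/
lemma next_close (hφ : InvariantGraph G J η φ) (hG : G.IsTwist I) (hJ : Convex ℝ J)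
    (hJI : J ⊆ I) (hB : G.Bounded J M ρ) (hη : 0 < η) (hρ : 0 < ρ) (hG₁ : G₁.IsTwist I)
    (hc : G.Close G₁ J ε) {x₀ x₁ x₂ : ℝ} (h0 : (x₀, x₁) ∈ gapSet J) (h1 : (x₁, x₂) ∈ gapSet I)
    (hd : G₁.h2 (x₀, x₁) + G₁.h1 (x₁, x₂) = 0)
    (hs : 2 * M ^ 2 / ρ ^ 2 * |x₁ - φ x₀| + 2 * ε / ρ < η) :
    |x₂ - φ x₁| < η := by
  obtain ⟨w, hw⟩ := hφ.surjective x₁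
  have hdw := hφ.del w
  rw [hw] at hdw
  obtain ⟨l, l1, l2, l3⟩ := hφ.exists_slope hG hJ hJI hB hη hρ x₀ w
  rw [hw] at l3
  have hM := hφ.rho_le hB hη
  have hM0 : 0 < M := hρ.trans_le hM
  have hl0 : 0 < l := lt_of_lt_of_le (by positivity) l1
  have mw : (w, x₁) ∈ gapSet J := hw ▸ hφ.mem hη.le w
  have mφ := hφ.mem hη.le x₁
  -- The pair (x₁, x₂) is not known to lie in J, so the estimates for G do not apply to it. They are
  -- applied to the test points φ x₁ ± η instead, and monotonicity of `G₁.h1` locates x₂ between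
  -- them.
  have mp : (x₁, φ x₁ + η) ∈ gapSet J := hφ.gap x₁ _ (by
    rw [show φ x₁ + η - x₁ - (φ x₁ - x₁) = η by ring, abs_of_pos hη])
  have mm : (x₁, φ x₁ - η) ∈ gapSet J := hφ.gap x₁ _ (by
    rw [show φ x₁ - η - x₁ - (φ x₁ - x₁) = -η by ring, abs_neg, abs_of_pos hη])
  obtain ⟨ξ, k1, -, f1⟩ := hG.mvt₁ hJ hJI mφ mp
  obtain ⟨ξ', k1', -, f1'⟩ := hG.mvt₁ hJ hJI mφ mm
  obtain ⟨ζ, k2, -, f2⟩ := hG.mvt₂ hJ hJI mw h0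
  simp only [sub_self, mul_zero, zero_add, add_zero] at f1 f1' f2
  have a1 := hB.twist _ k1
  have a1' := hB.twist _ k1'
  have b2 := hB.abs₁₂ _ k2
  have c1 := abs_le.1 (hc.close₁ _ mp)
  have c1' := abs_le.1 (hc.close₁ _ mm)
  have c2 := abs_le.1 (hc.close₂ _ h0)
  have hE : |G.h12 ζ * (x₀ - w)| ≤ M * (2 * M / ρ * |x₁ - φ x₀|) := by
    rw [abs_mul, abs_sub_comm, l3, abs_mul, abs_of_pos hl0]
    gcongr
  have hE2 : M * (2 * M / ρ * |x₁ - φ x₀|) + 2 * ε < ρ * η := by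
    have := mul_lt_mul_of_pos_left hs hρ
    calc _ = ρ * (2 * M ^ 2 / ρ ^ 2 * |x₁ - φ x₀| + 2 * ε / ρ) := by field_simp
      _ < _ := this
  have hE3 := abs_le.1 hE
  have g1 : (φ x₁ + η - φ x₁) = η := by ring
  have g2 : (φ x₁ - η - φ x₁) = -η := by ring
  rw [g1] at f1
  rw [g2] at f1'
  have r1 := mul_le_mul_of_nonneg_right a1 hη.le
  have r2 := mul_le_mul_of_nonneg_right a1' hη.le
  have u1 : G₁.h1 (x₁, φ x₁ + η) < G₁.h1 (x₁, x₂) := by linarith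
  have u2 : G₁.h1 (x₁, x₂) < G₁.h1 (x₁, φ x₁ - η) := by linarith
  have v1 := (hG₁.h1_lt_iff h1 (hJI mp)).1 u1
  have v2 := (hG₁.h1_lt_iff (hJI mm) h1).1 u2
  rw [abs_lt]; constructor <;> linarith

/-- An orbit of a nearby map that starts near the invariant graph stays near it. -/
lemma near (hφ : InvariantGraph G J η φ) (hG : G.IsTwist I) (hJ : Convex ℝ J)
    (hJI : J ⊆ I) (hB : G.Bounded J M ρ) (hη : 0 < η) (hρ : 0 < ρ) (hε : 0 < ε)
    (hG₁ : G₁.IsTwist I) (hc : G.Close G₁ J ε) {q : ℕ} {x : ℕ → ℝ}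
    (hx : ∀ k < q, (x k, x (k + 1)) ∈ gapSet I)
    (hd : ∀ k, k + 1 < q → G₁.h2 (x k, x (k + 1)) + G₁.h1 (x (k + 1), x (k + 2)) = 0)
    {e : ℝ} (h : |x 1 - φ (x 0)| + 2 * ε / ρ ≤ e)
    (he : (2 * M ^ 2 / ρ ^ 2 + 2) ^ q * e < η) :
    ∀ k < q, (x k, x (k + 1)) ∈ gapSet J ∧
      |x (k + 1) - φ (x k)| + 2 * ε / ρ ≤ (2 * M ^ 2 / ρ ^ 2 + 2) ^ k * e := by
  have hM0 : 0 < M := hρ.trans_le (hφ.rho_le hB hη)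
  set A := 2 * M ^ 2 / ρ ^ 2 with hA
  have hA0 : 0 < A := by positivity
  have he0 : 0 < e := lt_of_lt_of_le (by positivity) h
  have hpow : ∀ k ≤ q, (A + 2) ^ k * e < η := fun k hk =>
    lt_of_le_of_lt (by gcongr; linarith) he
  have hmem : ∀ k, |x (k + 1) - φ (x k)| ≤ η → (x k, x (k + 1)) ∈ gapSet J := fun k hk =>
    hφ.gap (x k) _ (by rwa [sub_sub_sub_cancel_right])
  have hε' : 0 < 2 * ε / ρ := by positivity
  intro k
  induction k with
  | zero =>
    intro hk
    refine ⟨hmem 0 ?_, by simpa using h⟩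
    have := hpow 0 (by omega)
    simp only [zero_add]; simp at this; linarith
  | succ k ih =>
    intro hk
    obtain ⟨i1, i2⟩ := ih (by omega)
    -- Adding 2ε/ρ to the deviation makes the affine recursion d ↦ A d + 2ε/ρ geometric with ratio A
    -- + 2.
    have h1 : A * |x (k + 1) - φ (x k)| + 2 * (2 * ε / ρ) ≤ (A + 2) ^ (k + 1) * e := by
      rw [pow_succ, mul_comm _ (A + 2), mul_assoc]
      refine le_trans ?_ (mul_le_mul_of_nonneg_left i2 (by positivity))
      have := abs_nonneg (x (k + 1) - φ (x k))
      nlinarith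
    have h2 := hφ.next_close hG hJ hJI hB hη hρ hG₁ hc i1 (hx (k + 1) hk) (hd k hk)
      (lt_of_le_of_lt (by linarith) (hpow (k + 1) hk.le))
    have i3 := hmem (k + 1) h2.le
    refine ⟨i3, ?_⟩
    obtain ⟨θ, e', g1, g2, g3, g4⟩ := hφ.step hG hJ hJI hB hη hρ hc i1 i3 (hd k hk)
    have hθ : 0 ≤ θ := le_trans (by positivity) g1
    have : |x (k + 2) - φ (x (k + 1))| ≤ A * |x (k + 1) - φ (x k)| + 2 * ε / ρ := by
      rw [g4]
      refine (abs_add_le _ _).trans ?_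
      rw [abs_mul, abs_of_nonneg hθ]
      gcongr
    show |x (k + 2) - φ (x (k + 1))| + _ ≤ _
    linarith

/-- A pseudo-orbit shadows the orbit on the invariant graph for a bounded time. -/
lemma dist_iterate_le (hφ : InvariantGraph G J η φ) (hG : G.IsTwist I) (hJ : Convex ℝ J)
    (hJI : J ⊆ I) (hB : G.Bounded J M ρ) (hη : 0 < η) (hρ : 0 < ρ) {q : ℕ} {x : ℕ → ℝ} {e R : ℝ}
    (he : 0 ≤ e) (hR : 1 ≤ R) (hx : ∀ k < q, |x (k + 1) - φ (x k)| ≤ R ^ k * e) :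
    ∀ k ≤ q, |x k - φ^[k] (x 0)| ≤ (1 + R + 2 * M / ρ) ^ k * e := by
  have hΛ := hφ.one_le hB hη hρ
  intro k
  induction k with
  | zero => intro _; simpa using he
  | succ k ih =>
    intro hk
    have i1 := ih (by omega)
    have i2 := hx k (by omega)
    have i3 : |φ (x k) - φ (φ^[k] (x 0))| ≤ 2 * M / ρ * |x k - φ^[k] (x 0)| := by
      rcases le_total (x k) (φ^[k] (x 0)) with h | h
      · have h' := hφ.strictMono.monotone h
        rw [abs_sub_comm, abs_sub_comm (x k), abs_of_nonneg (by linarith),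
          abs_of_nonneg (by linarith)]
        exact hφ.lipschitz hG hJ hJI hB hη hρ h
      · have h' := hφ.strictMono.monotone h
        rw [abs_of_nonneg (by linarith), abs_of_nonneg (by linarith)]
        exact hφ.lipschitz hG hJ hJI hB hη hρ h
    rw [Function.iterate_succ_apply']
    calc |x (k + 1) - φ (φ^[k] (x 0))| ≤ |x (k + 1) - φ (x k)| + |φ (x k) - φ (φ^[k] (x 0))| :=
          abs_sub_le _ _ _
      _ ≤ R ^ k * e + 2 * M / ρ * ((1 + R + 2 * M / ρ) ^ k * e) :=
          add_le_add i2 (i3.trans (by gcongr))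
      _ ≤ (1 + R + 2 * M / ρ) ^ k * e + 2 * M / ρ * ((1 + R + 2 * M / ρ) ^ k * e) := by
          gcongr; linarith
      _ ≤ (1 + R + 2 * M / ρ) ^ (k + 1) * e := by
          rw [pow_succ]
          have : 0 ≤ (1 + R + 2 * M / ρ) ^ k * e := by positivity
          nlinarith

end InvariantGraph

/-- `X k y` is the `k`-th point of the orbit segment of `q` steps that starts with `x` and `y`. -/
structure IsShooting (G : GenJet) (I : Set ℝ) (q : ℕ) (x : ℝ) (X : ℕ → ℝ → ℝ) : Prop where
  zero : ∀ y, X 0 y = x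
  one : ∀ y, X 1 y = y
  gap : ∀ y, y - x ∈ I → ∀ k < q, (X k y, X (k + 1) y) ∈ gapSet I
  del : ∀ y, y - x ∈ I → ∀ k, k + 1 < q →
    G.h2 (X k y, X (k + 1) y) + G.h1 (X (k + 1) y, X (k + 2) y) = 0

/-- Each point is an implicit function of the two preceding ones, so differentiability propagates
along the segment; the differentiated Euler-Lagrange equation is the Jacobi equation for D. -/
lemma IsShooting.exists_deriv {G : GenJet} {I : Set ℝ} (hG : G.IsTwist I) {q : ℕ} {x : ℝ}
    {X : ℕ → ℝ → ℝ} (hX : IsShooting G I q x X) {y : ℝ} (hy : y - x ∈ I) :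
    ∃ D : ℕ → ℝ, D 0 = 0 ∧ D 1 = 1 ∧ (∀ k ≤ q, HasDerivAt (X k) (D k) y) ∧
      ∀ k, k + 1 < q → G.h12 (X k y, X (k + 1) y) * D k +
        (G.h22 (X k y, X (k + 1) y) + G.h11 (X (k + 1) y, X (k + 2) y)) * D (k + 1) +
        G.h12 (X (k + 1) y, X (k + 2) y) * D (k + 2) = 0 := by
  have X0 : X 0 = fun _ => x := funext hX.zero
  have X1 : X 1 = id := funext hX.one
  have hev : ∀ᶠ t in 𝓝 y, t - x ∈ I :=
    (continuousAt_id.sub continuousAt_const).eventually (hG.isOpen.mem_nhds hy)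
  have stepD : ∀ k, k + 1 < q → ∀ a b, HasDerivAt (X k) a y → HasDerivAt (X (k + 1)) b y →
      HasDerivAt (X (k + 2)) ((-(G.h12 (X k y, X (k + 1) y) * a + G.h22 (X k y, X (k + 1) y) * b)
        - G.h11 (X (k + 1) y, X (k + 2) y) * b) / G.h12 (X (k + 1) y, X (k + 2) y)) y := by
    intro k hk a b ha hb
    have h2 := (hG.hasDeriv₂ _ (hX.gap y hy k (by omega))).comp_hasDerivAt y (ha.prodMk hb)
    simp only [form_apply] at h2
    refine hG.hasDerivAt_of_h1 (Y := X (k + 2)) hb h2.neg ?_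
    filter_upwards [hev] with t ht
    refine ⟨hX.gap t ht (k + 1) hk, ?_⟩
    have := hX.del t ht k hk
    simp only [Pi.neg_apply, Function.comp]
    linarith
  have d0 : HasDerivAt (X 0) 0 y := by rw [X0]; exact hasDerivAt_const _ _
  have d1 : HasDerivAt (X 1) 1 y := by rw [X1]; exact hasDerivAt_id _
  have hdiff : ∀ k, k + 1 ≤ q → HasDerivAt (X k) (deriv (X k) y) y ∧
      HasDerivAt (X (k + 1)) (deriv (X (k + 1)) y) y := by
    intro k
    induction k with
    | zero => intro _; exact ⟨d0.differentiableAt.hasDerivAt, d1.differentiableAt.hasDerivAt⟩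
    | succ k ih =>
      intro hk
      obtain ⟨i1, i2⟩ := ih (by omega)
      exact ⟨i2, (stepD k (by omega) _ _ i1 i2).differentiableAt.hasDerivAt⟩
  refine ⟨fun k => deriv (X k) y, d0.deriv, d1.deriv, fun k hk => ?_, fun k hk => ?_⟩
  · rcases Nat.eq_zero_or_pos k with rfl | h
    · exact d0.differentiableAt.hasDerivAt
    · obtain ⟨j, rfl⟩ : ∃ j, k = j + 1 := ⟨k - 1, by omega⟩
      exact (hdiff j hk).2
  · obtain ⟨i1, i2⟩ := hdiff k hk.le
    have := (stepD k hk _ _ i1 i2).deriv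
    have hne := (hG.neg _ (hX.gap y hy (k + 1) hk)).ne
    simp only at this ⊢
    rw [this]
    field_simp
    ring

/-- Existence, uniqueness and nondegeneracy of closed orbit segments near a map with an
invariant graph of periodic points. -/
theorem exists_unique_closed_orbit (q : ℕ) (hq : 1 ≤ q) {M ρ B η : ℝ} (hM : 0 < M) (hρ : 0 < ρ)
    (hB : 0 < B) (hη : 0 < η) :
    ∃ ε₀ > 0, ∃ c > 0, ∀ ε, 0 < ε → ε ≤ ε₀ → ∀ (I J : Set ℝ) (G : GenJet) (φ : ℝ → ℝ) (P : ℝ),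
      G.IsTwist I → Convex ℝ J → J ⊆ I → G.Bounded J M ρ → G.Lip J B →
      InvariantGraph G J η φ → (∀ x, φ^[q] x = x + P) →
      ∀ G₁ : GenJet, G₁.IsTwist I → G.Close G₁ J ε → ∀ (x : ℝ) (X : ℕ → ℝ → ℝ),
        IsShooting G₁ I q x X →
        (∀ y, y - x ∈ I → X q y = x + P → ∀ k < q, (X k y, X (k + 1) y) ∈ gapSet J) →
        ∃ y, y - x ∈ J ∧ X q y = x + P ∧ (∀ y', y' - x ∈ I → X q y' = x + P → y' = y) ∧
          ∃ d, HasDerivAt (X q) d y ∧ c ≤ d := by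
  -- The bounds ρ ≤ -h₁₂ ≤ M contradict each other here, so there is no invariant graph and the
  -- claim is vacuous.
  by_cases hMρ : M < ρ
  · refine ⟨1, one_pos, 1, one_pos, ?_⟩
    intro ε _ _ I J G φ P _ _ _ hBd _ hφ
    exact absurd (hφ.rho_le hBd hη) (not_le.2 hMρ)
  push Not at hMρ
  have hΛ : 1 ≤ 2 * M / ρ := by rw [le_div_iff₀ hρ]; linarith
  -- The constants 2M and ρ/2 leave room for the perturbed second derivatives, since ε ≤ ρ/2 and ρ ≤
  -- M.
  obtain ⟨τ, hτ, c, hc, hjac⟩ := jacobi_lower_bound q hq (M := 2 * M) (ρ := ρ / 2)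
    (Λ := 2 * M / ρ) (by positivity) (by linarith) hΛ
  set Λ := 2 * M / ρ with hΛdef
  have hΛ0 : 0 < Λ := by positivity
  set A := 2 * M ^ 2 / ρ ^ 2 with hA
  have hA0 : 0 < A := by positivity
  set R := A + 2 with hR
  set W := 1 + R + Λ with hW
  have hR1 : 1 ≤ R := by linarith
  have hW1 : 1 ≤ W := by linarith
  -- Kε is the deviation beyond which a segment cannot close; K₂ε includes the extra 2ε/ρ of the
  -- growth estimate. R is the growth factor of the deviation from the graph, W that of the distance
  -- to the orbit of x, and Tε bounds the residual of the Jacobi equation.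
  set K := 2 / ρ * (2 * A) ^ q with hK
  have hK0 : 0 < K := by positivity
  set K₂ := K + 2 / ρ with hK2
  have hK20 : 0 < K₂ := by positivity
  set T := (2 * Λ + 2) * (1 + B * (W ^ q * K₂ + 1)) with hT
  have hT0 : 0 < T := by positivity
  refine ⟨min (ρ / 2) (min (η / (2 * (R ^ q * K₂))) (τ / T)), by positivity, c, hc, ?_⟩
  intro ε hε hεle I J G φ P hG hJ hJI hBd hLip hφ hper G₁ hG₁ hcl x X hX hloop
  have e1 : ε ≤ ρ / 2 := hεle.trans (min_le_left _ _)
  have e2 : R ^ q * (K₂ * ε) < η := by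
    have : ε ≤ η / (2 * (R ^ q * K₂)) :=
      hεle.trans ((min_le_right _ _).trans (min_le_left _ _))
    rw [le_div_iff₀ (by positivity)] at this
    nlinarith
  have e3 : T * ε ≤ τ := by
    have : ε ≤ τ / T := hεle.trans ((min_le_right _ _).trans (min_le_right _ _))
    rw [le_div_iff₀ hT0] at this
    linarith
  have hKη : K * ε < η := by
    have : 1 ≤ R ^ q := one_le_pow₀ hR1
    have h2 : K * ε ≤ K₂ * ε := by gcongr; rw [hK2]; have : 0 < 2 / ρ := by positivity
                                   linarith
    have h3 : K₂ * ε ≤ R ^ q * (K₂ * ε) := le_mul_of_one_le_left (by positivity) this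
    linarith
  set y₀ := φ x with hy0
  -- points near the graph
  have hNJ : ∀ y ∈ Set.Icc (y₀ - K * ε) (y₀ + K * ε), y - x ∈ J := by
    intro y hy
    refine hφ.gap x _ ?_
    rw [sub_sub_sub_cancel_right, abs_le]
    constructor <;> linarith [hy.1, hy.2]
  have hfar : ∀ y, y - x ∈ I → (∀ k < q, (X k y, X (k + 1) y) ∈ gapSet J) → ∀ s : ℝ, |s| = 1 →
      K * ε ≤ s * (y - y₀) → ∀ k < q, 0 < s * (X (k + 1) y - φ (X k y)) := by
    intro y hy hyJ s hs hys
    refine hφ.far hG hJ hJI hBd hη hρ hε hcl (x := fun k => X k y) hyJ (hX.del y hy) hs ?_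
    simpa [hX.zero, hX.one, hK, hA] using hys
  have hgt : ∀ y, y - x ∈ I → (∀ k < q, (X k y, X (k + 1) y) ∈ gapSet J) → K * ε ≤ y - y₀ →
      x + P < X q y := by
    intro y hy hyJ h
    have h1 := hfar y hy hyJ 1 (by simp) (by simpa using h)
    -- Each point lies above the φ-image of its predecessor, and φ is increasing, so the segment
    -- stays above the graph orbit of x.
    have : ∀ k < q, φ^[k + 1] x < X (k + 1) y := by
      intro k
      induction k with
      | zero => intro hk; have := h1 0 hk; simp [hX.zero] at this; simpa using this
      | succ k ih =>
        intro hk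
        have h2 := h1 (k + 1) hk
        rw [Function.iterate_succ_apply']
        have := hφ.strictMono (ih (by omega))
        linarith
    obtain ⟨k, rfl⟩ : ∃ k, q = k + 1 := ⟨q - 1, by omega⟩
    rw [← hper]
    exact this k (by omega)
  have hlt : ∀ y, y - x ∈ I → (∀ k < q, (X k y, X (k + 1) y) ∈ gapSet J) → K * ε ≤ y₀ - y →
      X q y < x + P := by
    intro y hy hyJ h
    have h1 := hfar y hy hyJ (-1) (by simp) (by linarith)
    have : ∀ k < q, X (k + 1) y < φ^[k + 1] x := by
      intro k
      induction k with
      | zero => intro hk; have := h1 0 hk; simp [hX.zero] at this; simpa using this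
      | succ k ih =>
        intro hk
        have h2 := h1 (k + 1) hk
        rw [Function.iterate_succ_apply']
        have := hφ.strictMono (ih (by omega))
        linarith
    obtain ⟨k, rfl⟩ : ∃ k, q = k + 1 := ⟨q - 1, by omega⟩
    rw [← hper]
    exact this k (by omega)
  have hnear : ∀ y ∈ Set.Icc (y₀ - K * ε) (y₀ + K * ε), ∀ k < q,
      (X k y, X (k + 1) y) ∈ gapSet J ∧
      |X (k + 1) y - φ (X k y)| + 2 * ε / ρ ≤ R ^ k * (K₂ * ε) := by
    intro y hy
    have hyI := hJI (hNJ y hy)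
    refine hφ.near hG hJ hJI hBd hη hρ hε hG₁ hcl (x := fun k => X k y) (hX.gap y hyI)
      (hX.del y hyI) ?_ e2
    simp only [hX.zero, hX.one]
    have : |y - φ x| ≤ K * ε := by rw [abs_le]; constructor <;> linarith [hy.1, hy.2]
    rw [hK2, add_mul]
    have h3 : 2 * ε / ρ = 2 / ρ * ε := by ring
    linarith
  have hder : ∀ y ∈ Set.Icc (y₀ - K * ε) (y₀ + K * ε), ∃ d, HasDerivAt (X q) d y ∧ c ≤ d := by
    intro y hy
    have hyI := hJI (hNJ y hy)
    obtain ⟨D, D0, D1, hD, hrec⟩ := hX.exists_deriv hG₁ hyI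
    refine ⟨D q, hD q le_rfl, ?_⟩
    have hdist : ∀ k ≤ q, |X k y - φ^[k] x| ≤ W ^ q * (K₂ * ε) := by
      intro k hk
      have := hφ.dist_iterate_le hG hJ hJI hBd hη hρ (q := q) (x := fun k => X k y)
        (e := K₂ * ε) (R := R) (by positivity) hR1 (fun k hk => by
          have := (hnear y hy k hk).2
          have h3 : 0 < 2 * ε / ρ := by positivity
          linarith) k hk
      rw [hX.zero] at this
      refine this.trans ?_
      gcongr
    -- a nearby orbit on the graph
    set h := ε / Λ ^ q with hh
    have hh0 : 0 < h := by positivity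
    set u : ℕ → ℝ := fun k => φ^[k] (x + h) - φ^[k] x with hu
    have hmono : ∀ k, φ^[k] x < φ^[k] (x + h) := fun k => hφ.strictMono.iterate k (by linarith)
    have hu0 : ∀ k, 0 < u k := fun k => sub_pos.2 (hmono k)
    have husucc : ∀ k, u (k + 1) ≤ Λ * u k ∧ u k ≤ Λ * u (k + 1) := by
      intro k
      simp only [hu, Function.iterate_succ_apply']
      exact ⟨hφ.lipschitz hG hJ hJI hBd hη hρ (hmono k).le,
        hφ.lipschitz_inv hG hJ hJI hBd hη hρ (hmono k).le⟩
    have hub : ∀ k ≤ q, u k ≤ ε := by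
      have : ∀ k, u k ≤ Λ ^ k * h := by
        intro k
        induction k with
        | zero => simp [hu]
        | succ k ih =>
          calc u (k + 1) ≤ Λ * u k := (husucc k).1
            _ ≤ Λ * (Λ ^ k * h) := by gcongr
            _ = _ := by ring
      intro k hk
      calc u k ≤ Λ ^ k * h := this k
        _ ≤ Λ ^ q * h := by gcongr
        _ = ε := by rw [hh]; field_simp
    set z : ℕ → ℝ × ℝ := fun k => (φ^[k] x, φ^[k + 1] x) with hz
    set z' : ℕ → ℝ × ℝ := fun k => (φ^[k] (x + h), φ^[k + 1] (x + h)) with hz'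
    have hzJ : ∀ k, z k ∈ gapSet J := fun k => by
      simp only [hz, Function.iterate_succ_apply']; exact hφ.mem hη.le _
    have hzJ' : ∀ k, z' k ∈ gapSet J := fun k => by
      simp only [hz', Function.iterate_succ_apply']; exact hφ.mem hη.le _
    have hzz : ∀ k < q, ‖z' k - z k‖ ≤ ε := by
      intro k hk
      rw [Prod.norm_def]
      refine max_le ?_ ?_
      · rw [Real.norm_eq_abs]
        show |u k| ≤ ε
        rw [abs_of_pos (hu0 _)]; exact hub k hk.le
      · rw [Real.norm_eq_abs]
        show |u (k + 1)| ≤ ε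
        rw [abs_of_pos (hu0 _)]; exact hub (k + 1) hk
    set p : ℕ → ℝ × ℝ := fun k => (X k y, X (k + 1) y) with hp
    have hpJ : ∀ k < q, p k ∈ gapSet J := fun k hk => (hnear y hy k hk).1
    have hpz : ∀ k < q, ‖p k - z k‖ ≤ W ^ q * (K₂ * ε) := by
      intro k hk
      rw [Prod.norm_def]
      exact max_le (hdist k hk.le) (hdist (k + 1) hk)
    -- Replacing the coefficients at ξ by those of the perturbed segment costs ε for the change of
    -- jet and B times the distance for the change of base point.
    have hclose : ∀ k < q, ∀ ξ, ‖ξ - z k‖ ≤ ‖z' k - z k‖ →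
        ε + B * ‖p k - ξ‖ ≤ (1 + B * (W ^ q * K₂ + 1)) * ε := by
      intro k hk ξ hξ
      have : ‖p k - ξ‖ ≤ W ^ q * (K₂ * ε) + ε := by
        have h1 : p k - ξ = (p k - z k) - (ξ - z k) := by abel
        rw [h1]
        exact (norm_sub_le _ _).trans (add_le_add (hpz k hk) (hξ.trans (hzz k hk)))
      have := mul_le_mul_of_nonneg_left this hB.le
      linarith
    -- By the mean value theorem u solves a Jacobi equation exactly, with coefficients taken at ξ
    -- and ζ.
    choose ξ ξJ ξn ξe using fun k => hG.mvt₁ hJ hJI (hzJ k) (hzJ' k)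
    choose ζ ζJ ζn ζe using fun k => hG.mvt₂ hJ hJI (hzJ k) (hzJ' k)
    set r := (1 + B * (W ^ q * K₂ + 1)) * ε with hr
    have c11 : ∀ k < q, |G₁.h11 (p k) - G.h11 (ξ k)| ≤ r := fun k hk =>
      (abs_sub_le _ (G.h11 (p k)) _).trans ((add_le_add (hcl.close₁₁ _ (hpJ k hk))
        (hLip.lip₁₁ _ (hpJ k hk) _ (ξJ k))).trans (hclose k hk _ (ξn k)))
    have c12 : ∀ k < q, |G₁.h12 (p k) - G.h12 (ξ k)| ≤ r := fun k hk =>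
      (abs_sub_le _ (G.h12 (p k)) _).trans ((add_le_add (hcl.close₁₂ _ (hpJ k hk))
        (hLip.lip₁₂ _ (hpJ k hk) _ (ξJ k))).trans (hclose k hk _ (ξn k)))
    have c12' : ∀ k < q, |G₁.h12 (p k) - G.h12 (ζ k)| ≤ r := fun k hk =>
      (abs_sub_le _ (G.h12 (p k)) _).trans ((add_le_add (hcl.close₁₂ _ (hpJ k hk))
        (hLip.lip₁₂ _ (hpJ k hk) _ (ζJ k))).trans (hclose k hk _ (ζn k)))
    have c22 : ∀ k < q, |G₁.h22 (p k) - G.h22 (ζ k)| ≤ r := fun k hk =>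
      (abs_sub_le _ (G.h22 (p k)) _).trans ((add_le_add (hcl.close₂₂ _ (hpJ k hk))
        (hLip.lip₂₂ _ (hpJ k hk) _ (ζJ k))).trans (hclose k hk _ (ζn k)))
    -- The comparison slopes are u (k+1) / u k, which lie in [1/Λ, Λ] by the bi-Lipschitz property
    -- of φ.
    refine hjac D (fun k => -G₁.h12 (p k)) (fun k => G₁.h22 (p k) + G₁.h11 (p (k + 1)))
      (fun k => u (k + 1) / u k) D0 D1 ?_ ?_ ?_ ?_
    · intro k hk
      have h1 := abs_le.1 (hcl.close₁₂ _ (hpJ k hk))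
      have h2 := hBd.twist _ (hpJ k hk)
      have h3 := (abs_le.1 (hBd.abs₁₂ _ (hpJ k hk))).1
      constructor <;> linarith
    · intro k _
      obtain ⟨h1, h2⟩ := husucc k
      refine ⟨?_, by rw [div_le_iff₀ (hu0 k)]; exact h1⟩
      rw [le_div_iff₀ (hu0 k), inv_mul_le_iff₀ hΛ0]; exact h2
    · intro k hk
      have := hrec k hk
      simp only [hp]
      linarith
    · intro k hk
      have hk' : k < q := by omega
      have e := ξe (k + 1)
      have e' := ζe k
      have d1 := hφ.del (φ^[k] x)
      have d2 := hφ.del (φ^[k] (x + h))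
      simp only [← Function.iterate_succ_apply' φ] at d1 d2
      have eq : G.h12 (ζ k) * u k + G.h22 (ζ k) * u (k + 1) + G.h11 (ξ (k + 1)) * u (k + 1) +
          G.h12 (ξ (k + 1)) * u (k + 2) = 0 := by
        simp only [hz, hz'] at e e'
        simp only [hu]
        linarith
      have eq2 : G.h12 (ζ k) / (u (k + 1) / u k) + G.h22 (ζ k) + G.h11 (ξ (k + 1)) +
          G.h12 (ξ (k + 1)) * (u (k + 2) / u (k + 1)) = 0 := by
        have n0 := (hu0 k).ne'
        have n1 := (hu0 (k + 1)).ne'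
        field_simp
        linear_combination eq
      have m1 : u k / u (k + 1) ≤ Λ := by rw [div_le_iff₀ (hu0 _)]; exact (husucc k).2
      have m1' : 0 < u k / u (k + 1) := div_pos (hu0 _) (hu0 _)
      have m2 : u (k + 2) / u (k + 1) ≤ Λ := by rw [div_le_iff₀ (hu0 _)]; exact (husucc (k + 1)).1
      have m2' : 0 < u (k + 2) / u (k + 1) := div_pos (hu0 _) (hu0 _)
      have t1 : |(G₁.h12 (p k) - G.h12 (ζ k)) * (u k / u (k + 1))| ≤ r * Λ := by
        rw [abs_mul, abs_of_pos m1']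
        have := c12' k hk'
        have := abs_nonneg (G₁.h12 (p k) - G.h12 (ζ k))
        gcongr
      have t2 : |(G₁.h12 (p (k + 1)) - G.h12 (ξ (k + 1))) * (u (k + 2) / u (k + 1))| ≤ r * Λ := by
        rw [abs_mul, abs_of_pos m2']
        have := c12 (k + 1) hk
        have := abs_nonneg (G₁.h12 (p (k + 1)) - G.h12 (ξ (k + 1)))
        gcongr
      have t3 := c22 k hk'
      have t4 := c11 (k + 1) hk
      have eq3 : - -G₁.h12 (p k) / (u (k + 1) / u k) + (G₁.h22 (p k) + G₁.h11 (p (k + 1))) -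
          -G₁.h12 (p (k + 1)) * (u (k + 2) / u (k + 1)) =
          (G₁.h12 (p k) - G.h12 (ζ k)) * (u k / u (k + 1)) + (G₁.h22 (p k) - G.h22 (ζ k)) +
          (G₁.h11 (p (k + 1)) - G.h11 (ξ (k + 1))) +
          (G₁.h12 (p (k + 1)) - G.h12 (ξ (k + 1))) * (u (k + 2) / u (k + 1)) := by
        have : ∀ a : ℝ, a / (u (k + 1) / u k) = a * (u k / u (k + 1)) := fun a => by
          rw [div_div_eq_mul_div, mul_div_assoc]
        rw [this] at eq2 ⊢
        linear_combination eq2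
      show |- -G₁.h12 (p k) / (u (k + 1) / u k) + (G₁.h22 (p k) + G₁.h11 (p (k + 1))) -
          -G₁.h12 (p (k + 1)) * (u (k + 2) / u (k + 1))| ≤ τ
      rw [eq3]
      have hfin : 2 * (r * Λ) + 2 * r ≤ τ := by
        have : T * ε = 2 * (r * Λ) + 2 * r := by rw [hT, hr]; ring
        linarith
      rw [abs_le] at t1 t2 t3 t4 ⊢
      constructor <;> linarith [t1.1, t1.2, t2.1, t2.2, t3.1, t3.2, t4.1, t4.2]
  have hKε : 0 < K * ε := by positivity
  have hleft : y₀ - K * ε ∈ Set.Icc (y₀ - K * ε) (y₀ + K * ε) := ⟨le_rfl, by linarith⟩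
  have hright : y₀ + K * ε ∈ Set.Icc (y₀ - K * ε) (y₀ + K * ε) := ⟨by linarith, le_rfl⟩
  have hcont : ContinuousOn (X q) (Set.Icc (y₀ - K * ε) (y₀ + K * ε)) := fun y hy => by
    obtain ⟨d, hd, -⟩ := hder y hy
    exact hd.continuousAt.continuousWithinAt
  have hmono : StrictMonoOn (X q) (Set.Icc (y₀ - K * ε) (y₀ + K * ε)) := by
    refine strictMonoOn_of_deriv_pos (convex_Icc _ _) hcont fun y hy => ?_
    obtain ⟨d, hd, hcd⟩ := hder y (interior_subset hy)
    rw [hd.deriv]; linarith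
  have v1 := hlt _ (hJI (hNJ _ hleft)) (fun k hk => (hnear _ hleft k hk).1) (by linarith)
  have v2 := hgt _ (hJI (hNJ _ hright)) (fun k hk => (hnear _ hright k hk).1) (by linarith)
  obtain ⟨y, hy, hyP⟩ := intermediate_value_Icc (by linarith) hcont ⟨v1.le, v2.le⟩
  refine ⟨y, hNJ y hy, hyP, ?_, hder y hy⟩
  -- Any closing y' has all its pairs in J, so the estimate away from the graph applies and puts y'
  -- in the window, where the last point is injective in y.
  intro y' hy' hyP'
  have hl := hloop y' hy' hyP'
  have b1 : y' - y₀ < K * ε := by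
    by_contra hcon
    exact absurd (hgt y' hy' hl (not_lt.1 hcon)) (by rw [hyP']; exact lt_irrefl _)
  have b2 : y₀ - y' < K * ε := by
    by_contra hcon
    exact absurd (hlt y' hy' hl (not_lt.1 hcon)) (by rw [hyP']; exact lt_irrefl _)
  exact hmono.injOn ⟨by linarith, by linarith⟩ hy (hyP'.trans hyP.symm)

/-- A solution of the discrete Euler-Lagrange equation that is translated by `P` after
`q` steps. -/
structure IsPeriodicSeq (G : GenJet) (I : Set ℝ) (q : ℕ) (P : ℝ) (s : ℕ → ℝ) : Prop where
  gap : ∀ k, (s k, s (k + 1)) ∈ gapSet I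
  del : ∀ k, G.h2 (s k, s (k + 1)) + G.h1 (s (k + 1), s (k + 2)) = 0
  periodic : ∀ k, s (k + q) = s k + P

/-! ### Periodic sequences cannot touch without crossing. -/

namespace IsPeriodicSeq

variable {G : GenJet} {I : Set ℝ} {q : ℕ} {P : ℝ} {s s' : ℕ → ℝ}

lemma shift (h : IsPeriodicSeq G I q P s) : IsPeriodicSeq G I q P (fun k => s (k + 1)) where
  gap k := h.gap (k + 1)
  del k := h.del (k + 1)
  periodic k := by rw [show k + q + 1 = (k + 1) + q by ring]; exact h.periodic (k + 1)

lemma add_mul (h : IsPeriodicSeq G I q P s) (k n : ℕ) : s (k + q * n) = s k + n * P := by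
  induction n with
  | zero => simp
  | succ n ih => rw [mul_add, ← add_assoc, mul_one, h.periodic, ih]; push_cast; ring

/-- By the twist condition two consecutive points determine all later ones; periodicity carries the
agreement back to the earlier indices. -/
lemma eq_of_eq (hG : G.IsTwist I) (h : IsPeriodicSeq G I q P s) (h' : IsPeriodicSeq G I q P s')
    {i : ℕ} (h0 : s i = s' i) (h1 : s (i + 1) = s' (i + 1)) (hq : 1 ≤ q) : s = s' := by
  have key : ∀ j, s (i + j) = s' (i + j) ∧ s (i + j + 1) = s' (i + j + 1) := by
    intro j
    induction j with
    | zero => exact ⟨h0, h1⟩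
    | succ j ih =>
      obtain ⟨i1, i2⟩ := ih
      refine ⟨i2, ?_⟩
      have e := h.del (i + j)
      have e' := h'.del (i + j)
      have g := h.gap (i + j + 1)
      have g' := h'.gap (i + j + 1)
      rw [← i1, ← i2] at e'
      rw [← i2] at g'
      exact hG.h1_inj (x := s (i + j + 1)) g g'
        (show G.h1 (s (i + j + 1), s (i + j + 2)) = G.h1 (s (i + j + 1), s' (i + j + 2)) by linarith)
  funext k
  have h2 := h.add_mul k i
  have h2' := h'.add_mul k i
  obtain ⟨j, hj⟩ : ∃ j, k + q * i = i + j := by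
    refine ⟨k + q * i - i, ?_⟩
    have : 1 * i ≤ q * i := Nat.mul_le_mul_right i hq
    omega
  rw [hj] at h2 h2'
  have := (key j).1
  linarith

/-- At a contact point, raising the left or the right neighbour lowers the Euler-Lagrange sum. Both
sums vanish, so no neighbour can be strictly larger, and the sequences agree at two consecutive
indices. -/
lemma eq_of_le_of_eq (hG : G.IsTwist I) (h : IsPeriodicSeq G I q P s)
    (h' : IsPeriodicSeq G I q P s') (hq : 1 ≤ q) (hle : ∀ k, s k ≤ s' k) {i : ℕ}
    (hi : s i = s' i) : s = s' := by
  -- Indices are natural numbers; a shift by one period gives the contact point a left neighbour.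
  wlog hi1 : 1 ≤ i generalizing i
  · exact this (i := i + q) (by rw [h.periodic, h'.periodic, hi]) (by omega)
  obtain ⟨j, rfl⟩ : ∃ j, i = j + 1 := ⟨i - 1, by omega⟩
  refine eq_of_eq hG h h' hi (le_antisymm (hle _) ?_) hq
  have e := h.del j
  have e' := h'.del j
  have g := h.gap j
  have g' := h'.gap j
  have k1 := h.gap (j + 1)
  have k1' := h'.gap (j + 1)
  rw [← hi] at e' g' k1'
  by_contra hcon
  push Not at hcon
  have a := hG.h1_lt k1 k1' hcon
  rcases (hle j).lt_or_eq with h3 | h3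
  · have b := hG.h2_lt g g' h3
    linarith
  · rw [h3] at e; linarith

lemma lt_of_lt (h : IsPeriodicSeq G I q P s) (h' : IsPeriodicSeq G I q P s') (hq : 1 ≤ q)
    (hlt : ∀ k < q, s k < s' k) (k : ℕ) : s k < s' k := by
  have h1 := h.add_mul (k % q) (k / q)
  have h2 := h'.add_mul (k % q) (k / q)
  rw [Nat.mod_add_div] at h1 h2
  have := hlt (k % q) (Nat.mod_lt _ hq)
  linarith

end IsPeriodicSeq

/-! ### From a continuous family of periodic sequences to an invariant graph. -/

section Order

variable {G : GenJet} {I : Set ℝ} {q : ℕ} {P : ℝ} {x : ℝ → ℕ → ℝ} {s s' : ℕ → ℝ}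

/-- Along a family of periodic sequences that tends to infinity, every periodic sequence that is
not met lies below the family. -/
lemma lt_family (hG : G.IsTwist I) (hq : 1 ≤ q) (hx : ∀ t, IsPeriodicSeq G I q P (x t))
    (hc : ∀ k, Continuous fun t => x t k) (htop : ∀ k, Tendsto (fun t => x t k) atTop atTop)
    (hs : IsPeriodicSeq G I q P s) {S : Set ℝ} (hS : IsPreconnected S) {b : ℝ}
    (hb : Set.Ioi b ⊆ S) (hne : ∀ t ∈ S, x t ≠ s) : ∀ t ∈ S, ∀ k, s k < x t k := by
  have hr : (Finset.range q).Nonempty := ⟨0, by simp; omega⟩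
  -- f is the smallest gap over one period. A zero of f is a contact without crossing, which forces
  -- equality and is excluded on S; so f has constant sign on the connected set S, and it is
  -- positive for large t.
  set f : ℝ → ℝ := fun t => (Finset.range q).inf' hr fun k => x t k - s k with hf
  have hfc : Continuous f :=
    Continuous.finset_inf'_apply hr fun k _ => (hc k).sub continuous_const
  have hf0 : ∀ t ∈ S, f t ≠ 0 := by
    intro t ht h0
    obtain ⟨i, hi, hfi⟩ := Finset.exists_mem_eq_inf' hr fun k => x t k - s k
    have hle : ∀ k < q, s k ≤ x t k := fun k hk => by
      have : f t ≤ x t k - s k := Finset.inf'_le _ (Finset.mem_range.2 hk)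
      linarith
    refine hne t ht (hs.eq_of_le_of_eq hG (hx t) hq (fun k => ?_) (i := i) ?_).symm
    · have h1 := hs.add_mul (k % q) (k / q)
      have h2 := (hx t).add_mul (k % q) (k / q)
      rw [Nat.mod_add_div] at h1 h2
      have := hle (k % q) (Nat.mod_lt _ hq)
      linarith
    · have : f t = x t i - s i := hfi
      linarith
  have hev : ∀ᶠ t in atTop, 0 < f t := by
    have : ∀ᶠ t in atTop, ∀ k ∈ Finset.range q, s k < x t k :=
      (Finset.eventually_all _).2 fun k _ => (htop k).eventually_gt_atTop (s k)
    filter_upwards [this] with t ht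
    exact (Finset.lt_inf'_iff _).2 fun k hk => sub_pos.2 (ht k hk)
  obtain ⟨t₁, h1, h1S⟩ := (hev.and (eventually_gt_atTop b)).exists
  intro t ht
  have hpos : 0 < f t := by
    by_contra hneg
    obtain ⟨t', ht', h0⟩ := hS.intermediate_value ht (hb h1S) hfc.continuousOn
      ⟨not_lt.1 hneg, h1.le⟩
    exact hf0 t' ht' h0
  refine hs.lt_of_lt (hx t) hq fun k hk => ?_
  have : f t ≤ x t k - s k := Finset.inf'_le _ (Finset.mem_range.2 hk)
  linarith

/-- A sequence never met would lie below the whole family, which tends to -∞ at the other end.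
Choosing the last parameter at which it is met puts the later members strictly above it. -/
lemma exists_mem_family (hG : G.IsTwist I) (hq : 1 ≤ q) (hx : ∀ t, IsPeriodicSeq G I q P (x t))
    (hc : ∀ k, Continuous fun t => x t k) (htop : ∀ k, Tendsto (fun t => x t k) atTop atTop)
    (hbot : ∀ k, Tendsto (fun t => x t k) atBot atBot) (hs : IsPeriodicSeq G I q P s) :
    ∃ t, x t = s ∧ ∀ t' > t, ∀ k, s k < x t' k := by
  set Z := {t | x t = s} with hZ
  have hne : Z.Nonempty := by
    by_contra hcon
    have := lt_family hG hq hx hc htop hs isPreconnected_univ (b := 0) (Set.subset_univ _)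
      (fun t _ ht => hcon ⟨t, ht⟩)
    obtain ⟨t, ht⟩ := ((hbot 0).eventually_lt_atBot (s 0)).exists
    exact absurd (this t trivial 0) (not_lt.2 ht.le)
  have hcl : IsClosed Z := by
    have : Z = ⋂ k, {t | x t k = s k} := by
      ext t; simp [hZ, funext_iff]
    rw [this]
    exact isClosed_iInter fun k => isClosed_eq (hc k) continuous_const
  have hbd : BddAbove Z := by
    obtain ⟨b, hb⟩ := ((htop 0).eventually_gt_atTop (s 0)).exists_forall_of_atTop
    refine ⟨b, fun t ht => ?_⟩
    by_contra hcon
    have := hb t (not_le.1 hcon).le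
    rw [show x t = s from ht] at this
    exact lt_irrefl _ this
  refine ⟨sSup Z, hcl.csSup_mem hne hbd, ?_⟩
  refine lt_family hG hq hx hc htop hs isPreconnected_Ioi subset_rfl fun t ht h => ?_
  exact absurd (le_csSup hbd (show t ∈ Z from h)) (not_le.2 ht)

/-- A continuous family of periodic sequences that tends to infinity in both directions defines
an invariant graph. -/
theorem exists_graph_map (hG : G.IsTwist I) (hq : 1 ≤ q)
    (hx : ∀ t, IsPeriodicSeq G I q P (x t))
    (hc : ∀ k, Continuous fun t => x t k) (htop : ∀ k, Tendsto (fun t => x t k) atTop atTop)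
    (hbot : ∀ k, Tendsto (fun t => x t k) atBot atBot) :
    ∃ φ : ℝ → ℝ, StrictMono φ ∧ Function.Surjective φ ∧ (∀ x, φ^[q] x = x + P) ∧
      ∀ x, IsPeriodicSeq G I q P fun k => φ^[k] x := by
  -- Comparing the last parameters of two sequences orders them completely.
  have htri : ∀ s s', IsPeriodicSeq G I q P s → IsPeriodicSeq G I q P s' →
      (∀ k, s k < s' k) ∨ s = s' ∨ (∀ k, s' k < s k) := by
    intro s s' hs hs'
    obtain ⟨t, ht, h⟩ := exists_mem_family hG hq hx hc htop hbot hs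
    obtain ⟨t', ht', h'⟩ := exists_mem_family hG hq hx hc htop hbot hs'
    rcases lt_trichotomy t t' with hlt | rfl | hlt
    · left; rw [← ht']; exact h t' hlt
    · right; left; rw [← ht, ← ht']
    · right; right; rw [← ht]; exact h' t hlt
  -- The family reaches every initial value, and by the trichotomy only one sequence starts there; φ
  -- sends y to its next point.
  have hex : ∀ y, ∃ s, IsPeriodicSeq G I q P s ∧ s 0 = y := fun y => by
    obtain ⟨t, ht⟩ := (hc 0).surjective (htop 0) (hbot 0) y
    exact ⟨x t, hx t, ht⟩
  choose o ho ho0 using hex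
  have huniq : ∀ s, IsPeriodicSeq G I q P s → s = o (s 0) := by
    intro s hs
    rcases htri s (o (s 0)) hs (ho _) with h | h | h
    · exact absurd (h 0) (by rw [ho0]; exact lt_irrefl _)
    · exact h
    · exact absurd (h 0) (by rw [ho0]; exact lt_irrefl _)
  have hiter : ∀ y k, (fun y => o y 1)^[k] y = o y k := by
    intro y k
    induction k with
    | zero => exact (ho0 y).symm
    | succ k ih =>
      rw [Function.iterate_succ_apply', ih]
      have : ∀ k, IsPeriodicSeq G I q P fun j => o y (j + k) := by
        intro k
        induction k with
        | zero => exact ho y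
        | succ k ih => simpa only [add_right_comm, ← add_assoc] using ih.shift
      have h2 := congrFun (huniq _ (this k)) 1
      simp only [zero_add] at h2
      rw [← h2, add_comm]
  have hper : ∀ y, (fun y => o y 1)^[q] y = y + P := fun y => by
    rw [hiter, ← zero_add q, (ho y).periodic, ho0]
  refine ⟨fun y => o y 1, ?_, ?_, hper, ?_⟩
  · intro y y' h
    rcases htri _ _ (ho y) (ho y') with h1 | h1 | h1
    · exact h1 1
    · have := congrFun h1 0
      rw [ho0, ho0] at this
      exact absurd this h.ne
    · have := h1 0
      rw [ho0, ho0] at this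
      exact absurd this (not_lt.2 h.le)
  · intro y
    obtain ⟨j, rfl⟩ : ∃ j, q = j + 1 := ⟨q - 1, by omega⟩
    refine ⟨(fun y => o y 1)^[j] (y - P), ?_⟩
    have := hper (y - P)
    rw [Function.iterate_succ_apply'] at this
    simpa using this
  · intro y
    simp only [hiter]
    exact ho y

end Order

/-! ## Twist maps -/

lemma norm_iteratedFDeriv_lt_of_cNorm_lt {E G : Type*} [NormedAddCommGroup E] [NormedSpace ℝ E]
    [NormedAddCommGroup G] [NormedSpace ℝ G] {k : ℕ} {f : E → G} {ε : ℝ}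
    (h : cNorm k f < ENNReal.ofReal ε) {j : ℕ} (hj : j ≤ k) (x : E) :
    ‖iteratedFDeriv ℝ j f x‖ < ε := by
  have h1 : ‖iteratedFDeriv ℝ j f x‖ₑ ≤ cNorm k f :=
    (le_iSup (fun x => ‖iteratedFDeriv ℝ j f x‖ₑ) x).trans
      (Finset.single_le_sum (f := fun j => ⨆ x : E, ‖iteratedFDeriv ℝ j f x‖ₑ)
        (fun _ _ => zero_le) (Finset.mem_range.2 (by omega)))
  have h2 := h1.trans_lt h
  rw [← ofReal_norm] at h2
  exact (ENNReal.ofReal_lt_ofReal_iff_of_nonneg (norm_nonneg _)).1 h2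

/-- A continuous function that increases by `m > 0` in each period tends to infinity. -/
lemma tendsto_of_add_period {f : ℝ → ℝ} (hf : Continuous f) {m : ℝ} (hm : 0 < m)
    (h : ∀ t, f (t + 1) = f t + m) : Tendsto f atTop atTop ∧ Tendsto f atBot atBot := by
  have hper : Function.Periodic (fun t => f t - m * t) 1 := fun t => by
    simp only [h]; ring
  have hc : Continuous fun t => f t - m * t := hf.sub (continuous_const.mul continuous_id)
  obtain ⟨C, hC⟩ := (hper.isBounded_of_continuous one_ne_zero hc).exists_norm_le
  have hb : ∀ t, |f t - m * t| ≤ C := fun t => hC _ ⟨t, rfl⟩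
  constructor
  · refine tendsto_atTop_mono (f := fun t => m * t + -C) (fun t => ?_) ?_
    · have := (abs_le.1 (hb t)).1; linarith
    · exact tendsto_atTop_add_const_right _ _ (tendsto_id.const_mul_atTop hm)
  · refine tendsto_atBot_mono (f := fun t => m * t + C) (fun t => ?_) ?_
    · have := (abs_le.1 (hb t)).2; linarith
    · exact tendsto_atBot_add_const_right _ _ (tendsto_id.const_mul_atBot hm)

lemma partial₁_eq {H : ℝ × ℝ → ℝ} {z : ℝ × ℝ} (h : DifferentiableAt ℝ H z) :
    partial₁ H z = fderiv ℝ H z (1, 0) := by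
  have := h.hasFDerivAt.comp_hasDerivAt (f := fun t => (t, z.2)) z.1
    ((hasDerivAt_id z.1).prodMk (hasDerivAt_const z.1 z.2))
  exact this.deriv

lemma partial₂_eq {H : ℝ × ℝ → ℝ} {z : ℝ × ℝ} (h : DifferentiableAt ℝ H z) :
    partial₂ H z = fderiv ℝ H z (0, 1) := by
  have := h.hasFDerivAt.comp_hasDerivAt (f := fun t => (z.1, t)) z.2
    ((hasDerivAt_const z.2 z.1).prodMk (hasDerivAt_id z.2))
  exact this.deriv

/-! ### Generating functions on the plane and their jets. -/

section Jet

variable {H H₁ : ℝ × ℝ → ℝ}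

/-- The second derivative as a bilinear form. -/
def hess (H : ℝ × ℝ → ℝ) (z v w : ℝ × ℝ) : ℝ := fderiv ℝ (fderiv ℝ H) z v w

lemma contDiff_fderiv (h : ContDiff ℝ 2 H) : ContDiff ℝ 1 (fderiv ℝ H) :=
  h.fderiv_right (by norm_num)

lemma hasFDerivAt_fderiv_apply (h : ContDiff ℝ 2 H) (v z : ℝ × ℝ) :
    HasFDerivAt (fun z => fderiv ℝ H z v) (form (hess H z (1, 0) v) (hess H z (0, 1) v)) z := by
  have h1 := (((contDiff_fderiv h).differentiable one_ne_zero) z).hasFDerivAt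
  have h2 := h1.clm_apply (hasFDerivAt_const v z)
  refine h2.congr_fderiv ?_
  ext <;> simp [hess]

lemma partial₁_fun (h : ContDiff ℝ 2 H) : partial₁ H = fun z => fderiv ℝ H z (1, 0) :=
  funext fun z => partial₁_eq (h.differentiable two_ne_zero z)

lemma partial₂_fun (h : ContDiff ℝ 2 H) : partial₂ H = fun z => fderiv ℝ H z (0, 1) :=
  funext fun z => partial₂_eq (h.differentiable two_ne_zero z)

lemma hess_symm (h : ContDiff ℝ 2 H) (z v w : ℝ × ℝ) : hess H z v w = hess H z w v :=
  (h.contDiffAt.isSymmSndFDerivAt (by simp)).eq v w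

lemma partial₁₁_eq (h : ContDiff ℝ 2 H) (z : ℝ × ℝ) :
    partial₁ (partial₁ H) z = hess H z (1, 0) (1, 0) := by
  rw [partial₁_fun h]
  have := hasFDerivAt_fderiv_apply h (1, 0) z
  rw [partial₁_eq this.differentiableAt, this.fderiv]; simp

lemma partial₁₂_eq (h : ContDiff ℝ 2 H) (z : ℝ × ℝ) :
    partial₁ (partial₂ H) z = hess H z (1, 0) (0, 1) := by
  rw [partial₂_fun h]
  have := hasFDerivAt_fderiv_apply h (0, 1) z
  rw [partial₁_eq this.differentiableAt, this.fderiv]; simp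

lemma partial₂₂_eq (h : ContDiff ℝ 2 H) (z : ℝ × ℝ) :
    partial₂ (partial₂ H) z = hess H z (0, 1) (0, 1) := by
  rw [partial₂_fun h]
  have := hasFDerivAt_fderiv_apply h (0, 1) z
  rw [partial₂_eq this.differentiableAt, this.fderiv]; simp

/-- The jet of a function. -/
def jetOf (H : ℝ × ℝ → ℝ) : GenJet :=
  ⟨partial₁ H, partial₂ H, partial₁ (partial₁ H), partial₁ (partial₂ H), partial₂ (partial₂ H)⟩

lemma continuous_hess (h : ContDiff ℝ 2 H) (v w : ℝ × ℝ) : Continuous fun z => hess H z v w :=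
  (((contDiff_fderiv h).continuous_fderiv one_ne_zero).clm_apply continuous_const).clm_apply
    continuous_const

lemma isTwist_jetOf {M ρ : ℝ} (h : IsTwistGenerating H M ρ) : (jetOf H).IsTwist Set.univ where
  isOpen := isOpen_univ
  convex := convex_univ
  hasDeriv₁ z _ := by
    have := hasFDerivAt_fderiv_apply h.contDiff (1, 0) z
    simp only [jetOf, partial₁₁_eq h.contDiff, partial₁₂_eq h.contDiff]
    rw [partial₁_fun h.contDiff, hess_symm h.contDiff z (1, 0) (0, 1)]
    exact this
  hasDeriv₂ z _ := by
    have := hasFDerivAt_fderiv_apply h.contDiff (0, 1) z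
    simp only [jetOf, partial₂₂_eq h.contDiff, partial₁₂_eq h.contDiff]
    rw [partial₂_fun h.contDiff]
    exact this
  cont₁₁ z _ := by
    simp only [jetOf, funext (partial₁₁_eq h.contDiff)]
    exact (continuous_hess h.contDiff _ _).continuousAt
  cont₁₂ z _ := by
    simp only [jetOf, funext (partial₁₂_eq h.contDiff)]
    exact (continuous_hess h.contDiff _ _).continuousAt
  cont₂₂ z _ := by
    simp only [jetOf, funext (partial₂₂_eq h.contDiff)]
    exact (continuous_hess h.contDiff _ _).continuousAt
  neg z _ := (h.twist z).trans (neg_lt_zero.2 h.rho_pos)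

lemma bounded_jetOf {M ρ : ℝ} (h : IsTwistGenerating H M ρ) :
    (jetOf H).Bounded Set.univ M ρ where
  abs₁₁ z _ := (h.bound₁₁ z).le
  abs₁₂ z _ := (h.bound₁₂ z).le
  abs₂₂ z _ := (h.bound₂₂ z).le
  twist z _ := (h.twist z).le

lemma abs_multilinear_le (A : ContinuousMultilinearMap ℝ (fun _ : Fin 2 => ℝ × ℝ) ℝ)
    {v w : ℝ × ℝ} (hv : ‖v‖ ≤ 1) (hw : ‖w‖ ≤ 1) : |A ![v, w]| ≤ ‖A‖ := by
  refine (A.le_opNorm ![v, w]).trans ?_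
  rw [Fin.prod_univ_two]
  refine mul_le_of_le_one_right (norm_nonneg _) ?_
  simpa using mul_le_one₀ hv (norm_nonneg _) hw

lemma hess_eq (H : ℝ × ℝ → ℝ) (z v w : ℝ × ℝ) :
    hess H z v w = iteratedFDeriv ℝ 2 H z ![v, w] := by
  rw [iteratedFDeriv_two_apply]; rfl

lemma norm_e₁ : ‖((1, 0) : ℝ × ℝ)‖ ≤ 1 := by simp [Prod.norm_def]
lemma norm_e₂ : ‖((0, 1) : ℝ × ℝ)‖ ≤ 1 := by simp [Prod.norm_def]

/-- The only use of the third derivative: it makes the coefficients of the Jacobi equation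
Lipschitz. -/
lemma hess_lip (h : ContDiff ℝ 3 H) {B : ℝ} (hB : ∀ z, ‖iteratedFDeriv ℝ 3 H z‖ ≤ B)
    {v w : ℝ × ℝ} (hv : ‖v‖ ≤ 1) (hw : ‖w‖ ≤ 1) (z z' : ℝ × ℝ) :
    |hess H z v w - hess H z' v w| ≤ B * ‖z - z'‖ := by
  rw [hess_eq, hess_eq, ← _root_.sub_apply]
  refine (abs_multilinear_le _ hv hw).trans ?_
  refine Convex.norm_image_sub_le_of_norm_fderiv_le (𝕜 := ℝ) (s := Set.univ) (fun x _ => ?_)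
    (fun x _ => ?_) convex_univ trivial trivial
  · exact h.differentiable_iteratedFDeriv (m := 2) (by norm_num) x
  · rw [norm_fderiv_iteratedFDeriv]; exact hB x

lemma lip_jetOf (h : ContDiff ℝ 3 H) {B : ℝ} (hB : ∀ z, ‖iteratedFDeriv ℝ 3 H z‖ ≤ B) :
    (jetOf H).Lip Set.univ B := by
  have h2 : ContDiff ℝ 2 H := h.of_le (by norm_num)
  refine ⟨fun z _ w _ => ?_, fun z _ w _ => ?_, fun z _ w _ => ?_⟩
  · simp only [jetOf, partial₁₁_eq h2]; exact hess_lip h hB norm_e₁ norm_e₁ z w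
  · simp only [jetOf, partial₁₂_eq h2]; exact hess_lip h hB norm_e₁ norm_e₂ z w
  · simp only [jetOf, partial₂₂_eq h2]; exact hess_lip h hB norm_e₂ norm_e₂ z w

lemma hess_sub (h : ContDiff ℝ 2 H) (h₁ : ContDiff ℝ 2 H₁) (z v w : ℝ × ℝ) :
    hess H₁ z v w - hess H z v w = hess (fun z => H₁ z - H z) z v w := by
  have e : fderiv ℝ (fun z => H₁ z - H z) = fun z => fderiv ℝ H₁ z - fderiv ℝ H z :=
    funext fun z => fderiv_fun_sub (h₁.differentiable two_ne_zero z)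
      (h.differentiable two_ne_zero z)
  have d₁ := ((contDiff_fderiv h₁).differentiable one_ne_zero) z
  have d := ((contDiff_fderiv h).differentiable one_ne_zero) z
  simp only [hess]
  rw [e, fderiv_fun_sub d₁ d]
  rfl

lemma close_jetOf (h : ContDiff ℝ 2 H) (h₁ : ContDiff ℝ 2 H₁) {ε : ℝ}
    (hε : cNorm 2 (fun z => H₁ z - H z) < ENNReal.ofReal ε) :
    (jetOf H).Close (jetOf H₁) Set.univ ε := by
  have first : ∀ z v : ℝ × ℝ, ‖v‖ ≤ 1 → |fderiv ℝ H₁ z v - fderiv ℝ H z v| ≤ ε := by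
    intro z v hv
    have h1 := (norm_iteratedFDeriv_lt_of_cNorm_lt hε (j := 1) (by norm_num) z).le
    rw [norm_iteratedFDeriv_one, fderiv_fun_sub (h₁.differentiable two_ne_zero z)
      (h.differentiable two_ne_zero z)] at h1
    rw [← _root_.sub_apply]
    refine (ContinuousLinearMap.le_opNorm (fderiv ℝ H₁ z - fderiv ℝ H z) v).trans ?_
    exact (mul_le_of_le_one_right (norm_nonneg _) hv).trans h1
  have second : ∀ z v w : ℝ × ℝ, ‖v‖ ≤ 1 → ‖w‖ ≤ 1 → |hess H₁ z v w - hess H z v w| ≤ ε := by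
    intro z v w hv hw
    rw [hess_sub h h₁, hess_eq]
    exact (abs_multilinear_le _ hv hw).trans
      (norm_iteratedFDeriv_lt_of_cNorm_lt hε (j := 2) le_rfl z).le
  refine ⟨fun z _ => ?_, fun z _ => ?_, fun z _ => ?_, fun z _ => ?_, fun z _ => ?_⟩
  · simp only [jetOf, partial₁_fun h, partial₁_fun h₁]; exact first z _ norm_e₁
  · simp only [jetOf, partial₂_fun h, partial₂_fun h₁]; exact first z _ norm_e₂
  · simp only [jetOf, partial₁₁_eq h, partial₁₁_eq h₁]; exact second z _ _ norm_e₁ norm_e₁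
  · simp only [jetOf, partial₁₂_eq h, partial₁₂_eq h₁]; exact second z _ _ norm_e₁ norm_e₂
  · simp only [jetOf, partial₂₂_eq h, partial₂₂_eq h₁]; exact second z _ _ norm_e₂ norm_e₂

end Jet

/-! ### Integrable curves and loops of twist maps. -/

section TwistMap

variable {H : ℝ × ℝ → ℝ} {F : ℝ × ℝ → ℝ × ℝ} {M ρ : ℝ}

lemma IsGeneratedBy.fst_eq (hF : IsGeneratedBy F H) (z : ℝ × ℝ) :
    (jetOf H).h1 (z.1, (F z).1) = -z.2 := by
  have := ((hF z.1 z.2 (F z).1 (F z).2).1 rfl).1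
  simp only [jetOf]; linarith

lemma IsGeneratedBy.snd_eq (hF : IsGeneratedBy F H) (z : ℝ × ℝ) :
    (F z).2 = (jetOf H).h2 (z.1, (F z).1) :=
  ((hF z.1 z.2 (F z).1 (F z).2).1 rfl).2

lemma IsGeneratedBy.continuous (hF : IsGeneratedBy F H) (h : IsTwistGenerating H M ρ) :
    Continuous F := by
  have hG := isTwist_jetOf h
  have h1 : Continuous fun z => (F z).1 := continuous_iff_continuousAt.2 fun z =>
    hG.continuousAt_of_h1 (u := fun z => z.1) (v := fun z => -z.2) continuousAt_fst
      continuousAt_snd.neg (Eventually.of_forall fun z => ⟨trivial, hF.fst_eq z⟩)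
  have h2 : Continuous (jetOf H).h2 := continuous_iff_continuousAt.2 fun z =>
    (hG.hasDeriv₂ z trivial).continuousAt
  have h3 : Continuous fun z => (F z).2 := by
    simp only [hF.snd_eq]
    exact h2.comp (continuous_fst.prodMk h1)
  exact h1.prodMk h3

/-- Periodicity of H passes to its derivatives, and the equations generating F determine the image
uniquely. -/
lemma IsGeneratedBy.add_one (hF : IsGeneratedBy F H) (h : IsTwistGenerating H M ρ) (z : ℝ × ℝ) :
    F (z + (1, 0)) = F z + (1, 0) := by
  have per : ∀ z, H (z + (1, 1)) = H z := fun z => h.periodic z.1 z.2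
  have hd : ∀ z, fderiv ℝ H (z + (1, 1)) = fderiv ℝ H z := fun z => by
    rw [← fderiv_comp_add_right, show (fun z => H (z + (1, 1))) = H from funext per]
  refine (hF (z.1 + 1) (z.2 + 0) ((F z).1 + 1) ((F z).2 + 0)).2 ?_
  have h1 := hF.fst_eq z
  have h2 := hF.snd_eq z
  simp only [jetOf, partial₁_fun h.contDiff, partial₂_fun h.contDiff] at h1 h2 ⊢
  have := hd (z.1, (F z).1)
  simp only [Prod.mk_add_mk] at this
  rw [this]
  constructor <;> linarith

lemma IsGeneratedBy.add_int (hF : IsGeneratedBy F H) (h : IsTwistGenerating H M ρ) (m : ℤ)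
    (z : ℝ × ℝ) : F (z + ((m : ℝ), 0)) = F z + ((m : ℝ), 0) := by
  induction m using Int.induction_on generalizing z with
  | zero =>
    have : (((0 : ℤ) : ℝ), (0 : ℝ)) = 0 := by ext <;> simp
    rw [this, add_zero, add_zero]
  | succ n ih =>
    have e : (((n : ℤ) + 1 : ℤ) : ℝ) = (n : ℤ) + 1 := by push_cast; ring
    rw [e, show z + (((n : ℤ) : ℝ) + 1, (0 : ℝ)) = z + (((n : ℤ) : ℝ), 0) + (1, 0) by ext <;> simp [add_assoc],
      hF.add_one h, ih]
    ext <;> simp [add_assoc]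
  | pred n ih =>
    have := hF.add_one h (z + (((-(n : ℤ) - 1 : ℤ) : ℝ), 0))
    rw [show z + (((-(n : ℤ) - 1 : ℤ) : ℝ), 0) + (1, 0) = z + (((-(n : ℤ) : ℤ) : ℝ), 0) by
      ext
      · simp; ring
      · simp, ih] at this
    rw [← sub_eq_iff_eq_add] at this
    rw [← this]
    ext <;> simp; ring

lemma IsGeneratedBy.iterate_add_int (hF : IsGeneratedBy F H) (h : IsTwistGenerating H M ρ) (m : ℤ)
    (k : ℕ) (z : ℝ × ℝ) : F^[k] (z + ((m : ℝ), 0)) = F^[k] z + ((m : ℝ), 0) := by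
  induction k generalizing z with
  | zero => rfl
  | succ k ih => rw [Function.iterate_succ_apply, hF.add_int h, ih, Function.iterate_succ_apply]

lemma IsGeneratedBy.del (hF : IsGeneratedBy F H) (z : ℝ × ℝ) (k : ℕ) :
    (jetOf H).h2 ((F^[k] z).1, (F^[k + 1] z).1) +
      (jetOf H).h1 ((F^[k + 1] z).1, (F^[k + 2] z).1) = 0 := by
  have h1 := hF.snd_eq (F^[k] z)
  have h2 := hF.fst_eq (F^[k + 1] z)
  simp only [← Function.iterate_succ_apply' F] at h1 h2
  rw [h2, ← h1]; ring

/-- An essential invariant curve of periodic points is a graph. -/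
lemma exists_invariantGraph (hF : IsGeneratedBy F H) (h : IsTwistGenerating H M ρ) {p : ℤ} {q : ℕ}
    (hq : 1 ≤ q) (hc : HasIntegrableCurve F p q) :
    ∃ φ, InvariantGraph (jetOf H) Set.univ 1 φ ∧ ∀ x, φ^[q] x = x + p := by
  have hG := isTwist_jetOf h
  obtain ⟨c, ⟨cc, ⟨m, hm, hcm⟩, -⟩, hper⟩ := hc
  have key : ∀ (c : ℝ → ℝ × ℝ) (m : ℤ), Continuous c → 0 < m →
      (∀ t, c (t + 1) = c t + ((m : ℝ), 0)) → (∀ t, F^[q] (c t) = c t + ((p : ℝ), 0)) →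
      ∃ φ, InvariantGraph (jetOf H) Set.univ 1 φ ∧ ∀ x, φ^[q] x = x + p := by
    intro c m cc hm hcm hper
    have hcont : ∀ k, Continuous fun t => (F^[k] (c t)).1 := fun k =>
      continuous_fst.comp (((hF.continuous h).iterate k).comp cc)
    have htd : ∀ k, Tendsto (fun t => (F^[k] (c t)).1) atTop atTop ∧
        Tendsto (fun t => (F^[k] (c t)).1) atBot atBot := fun k =>
      tendsto_of_add_period (hcont k) (m := m) (by exact_mod_cast hm) fun t => by
        rw [hcm, hF.iterate_add_int h]; rfl
    obtain ⟨φ, h1, h2, h3, h4⟩ := exists_graph_map (q := q) (P := p)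
      (x := fun t k => (F^[k] (c t)).1) hG hq
      (fun t => ⟨fun _ => trivial, hF.del (c t), fun k => by
        rw [Function.iterate_add_apply, hper, hF.iterate_add_int h]; rfl⟩) hcont
      (fun k => (htd k).1) (fun k => (htd k).2)
    exact ⟨φ, ⟨h1, h2, fun _ _ _ => trivial, fun x => (h4 x).del 0⟩, h3⟩
  -- A curve that runs around the annulus in the negative direction is reversed first.
  rcases lt_or_gt_of_ne hm with hneg | hpos
  · refine key (fun t => c (-t)) (-m) (cc.comp continuous_neg) (by omega) (fun t => ?_)
      (fun t => hper _)
    have := hcm (-(t + 1))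
    rw [show -(t + 1) + 1 = -t by ring] at this
    rw [this]
    ext <;> simp
  · exact key c m cc hpos hcm hper

/-- Twist maps near one with a rationally integrable curve have nondegenerate unique loops. -/
theorem twist_loops (q : ℕ) (M B ρ : ℝ) (hq : 1 ≤ q) (hM : 0 < M) (hB : 0 < B) (hρ : 0 < ρ) :
    ∃ ε c : ℝ, 0 < ε ∧ 0 < c ∧
      ∀ (p : ℤ) (H : ℝ × ℝ → ℝ) (F : ℝ × ℝ → ℝ × ℝ),
        IsTwistGenerating H M ρ → ContDiff ℝ 3 H →
        (∀ z, ‖iteratedFDeriv ℝ 3 H z‖ ≤ B) →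
        IsGeneratedBy F H → HasIntegrableCurve F p q →
        ∀ (H₁ : ℝ × ℝ → ℝ) (F₁ : ℝ × ℝ → ℝ × ℝ),
          (∃ M₁ ρ₁ : ℝ, IsTwistGenerating H₁ M₁ ρ₁) →
          IsGeneratedBy F₁ H₁ →
          cNorm 2 (fun z => H₁ z - H z) < ENNReal.ofReal ε →
          ∀ x : ℝ, ∃ r : ℝ,
            (F₁^[q] (x, r)).1 = x + p ∧
            (∀ r' : ℝ, (F₁^[q] (x, r')).1 = x + p → r' = r) ∧
            ∃ d : ℝ, HasDerivAt (fun r' : ℝ => (F₁^[q] (x, r')).1) d r ∧ c < |d| := by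
  obtain ⟨ε, hε, c, hc, key⟩ := exists_unique_closed_orbit q hq hM hρ hB one_pos
  -- The derivative of the first image point in r is 1 / (-h₁₂) ≥ 1 / (M + ε); the factor 2 makes
  -- the final inequality strict.
  refine ⟨ε, c / (2 * (M + ε)), hε, by positivity, ?_⟩
  intro p H F hH hH3 hHB hF hcurve H₁ F₁ ⟨M₁, ρ₁, hH₁⟩ hF₁ hclose x
  obtain ⟨φ, hφ, hφq⟩ := exists_invariantGraph hF hH hq hcurve
  have hG₁ := isTwist_jetOf hH₁
  have hcl := close_jetOf hH.contDiff hH₁.contDiff hclose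
  have hone : ∀ y, F₁ (x, -(jetOf H₁).h1 (x, y)) = (y, (jetOf H₁).h2 (x, y)) := fun y =>
    (hF₁ _ _ _ _).2 ⟨rfl, rfl⟩
  have hinv : ∀ r, -(jetOf H₁).h1 (x, (F₁ (x, r)).1) = r := fun r => by
    have := hF₁.fst_eq (x, r); simp only at this; rw [this, neg_neg]
  -- The orbit is parametrized by its second point y instead of the momentum r = -h₁(x, y).
  set X : ℕ → ℝ → ℝ := fun k y => (F₁^[k] (x, -(jetOf H₁).h1 (x, y))).1 with hX
  have hXs : IsShooting (jetOf H₁) Set.univ q x X :=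
    ⟨fun y => rfl, fun y => by simp [hX, hone], fun _ _ _ _ => trivial,
      fun y _ k _ => hF₁.del _ k⟩
  have hXr : ∀ r, X q (F₁ (x, r)).1 = (F₁^[q] (x, r)).1 := fun r => by
    simp only [hX]; rw [hinv]
  obtain ⟨y, -, hy, huniq, d, hd, hcd⟩ := key ε hε le_rfl Set.univ Set.univ (jetOf H) φ p
    (isTwist_jetOf hH) convex_univ subset_rfl (bounded_jetOf hH) (lip_jetOf hH3 hHB) hφ hφq
    (jetOf H₁) hG₁ hcl x X hXs (fun _ _ _ _ _ => trivial)
  refine ⟨-(jetOf H₁).h1 (x, y), hy, fun r' hr' => ?_, ?_⟩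
  · rw [← huniq (F₁ (x, r')).1 trivial ((hXr r').trans hr'), hinv]
  · have hY := hG₁.hasDerivAt_of_h1 (u := fun _ => x) (v := fun r => -r)
      (Y := fun r => (F₁ (x, r)).1) (t₀ := -(jetOf H₁).h1 (x, y)) (hasDerivAt_const _ x)
      (hasDerivAt_neg _) (Eventually.of_forall fun r => ⟨trivial, hF₁.fst_eq (x, r)⟩)
    simp only [hone] at hY
    have hcomp := HasDerivAt.comp (h₂ := X q) (-(jetOf H₁).h1 (x, y)) (by rw [hone]; exact hd) hY
    refine ⟨_, hcomp.congr_of_eventuallyEq (Eventually.of_forall fun r => (hXr r).symm), ?_⟩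
    have n0 := hG₁.neg (x, y) trivial
    have n1 := (abs_le.1 (hcl.close₁₂ (x, y) trivial)).1
    have n2 := (abs_le.1 ((bounded_jetOf hH).abs₁₂ (x, y) trivial)).1
    set b := (jetOf H₁).h12 (x, y) with hb
    have hd0 : 0 < d := hc.trans_le hcd
    rw [mul_zero, sub_zero, neg_div, ← div_neg, abs_of_pos (by
      have : 0 < -b := by linarith
      positivity), div_lt_iff₀ (by positivity)]
    have h3 : 1 / (M + ε) ≤ 1 / -b := one_div_le_one_div_of_le (by linarith) (by linarith)
    have h4 : c * (1 / (M + ε)) ≤ d * (1 / -b) := by gcongr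
    have h5 : c ≤ d * (1 / -b) * (M + ε) := by
      have := mul_le_mul_of_nonneg_right h4 (by positivity : 0 ≤ M + ε)
      rwa [mul_assoc, one_div_mul_cancel (by positivity), mul_one] at this
    nlinarith

end TwistMap

/-! ## Plane geometry -/

/-- The cross product of two plane vectors. -/
def cr (a b : Plane) : ℝ := a 0 * b 1 - a 1 * b 0

/-- The unit vector with angle `θ`, with respect to the orientation `o = ±1`. -/
def ang (o θ : ℝ) : Plane := !₂[Real.cos θ, o * Real.sin θ]

lemma inner_eq (a b : Plane) : inner ℝ a b = a 0 * b 0 + a 1 * b 1 := by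
  simp [PiLp.inner_apply, Fin.sum_univ_two, mul_comm]

lemma norm_sq_eq (a : Plane) : ‖a‖ ^ 2 = a 0 ^ 2 + a 1 ^ 2 := by
  rw [← real_inner_self_eq_norm_sq, inner_eq]; ring

@[simp] lemma ang_zero (o θ : ℝ) : ang o θ 0 = Real.cos θ := rfl
@[simp] lemma ang_one (o θ : ℝ) : ang o θ 1 = o * Real.sin θ := rfl

lemma norm_ang {o : ℝ} (ho : o * o = 1) (θ : ℝ) : ‖ang o θ‖ = 1 := by
  have : ‖ang o θ‖ ^ 2 = 1 := by
    rw [norm_sq_eq, ang_zero, ang_one]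
    linear_combination Real.sin_sq_add_cos_sq θ + Real.sin θ ^ 2 * ho
  nlinarith [norm_nonneg (ang o θ)]

lemma cr_sub (a b c : Plane) : cr a (b - c) = cr a b - cr a c := by simp [cr]; ring
lemma cr_smul (a b : Plane) (r : ℝ) : cr a (r • b) = r * cr a b := by simp [cr]; ring
lemma sub_cr (a b c : Plane) : cr (a - b) c = cr a c - cr b c := by simp [cr]; ring
lemma smul_cr (a b : Plane) (r : ℝ) : cr (r • a) b = r * cr a b := by simp [cr]; ring
lemma cr_zero (a : Plane) : cr a 0 = 0 := by simp [cr]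

/-- Lagrange's identity: sin² + cos² = 1 for a pair of vectors. -/
lemma cr_sq_add_inner_sq (a b : Plane) : cr a b ^ 2 + inner ℝ a b ^ 2 = ‖a‖ ^ 2 * ‖b‖ ^ 2 := by
  rw [inner_eq, norm_sq_eq, norm_sq_eq, cr]; ring

lemma abs_cr_le (a b : Plane) : |cr a b| ≤ ‖a‖ * ‖b‖ := by
  refine abs_le_of_sq_le_sq ?_ (by positivity)
  nlinarith [cr_sq_add_inner_sq a b, sq_nonneg (inner ℝ a b)]

lemma cr_ang {o : ℝ} (a b : ℝ) : cr (ang o a) (ang o b) = o * Real.sin (b - a) := by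
  rw [cr, Real.sin_sub]; simp; ring

lemma hasDerivAt_apply {f : ℝ → Plane} {f' : Plane} {t : ℝ} (h : HasDerivAt f f' t) (i : Fin 2) :
    HasDerivAt (fun t => f t i) (f' i) t :=
  ((EuclideanSpace.proj (𝕜 := ℝ) i).hasFDerivAt.comp_hasDerivAt t h)

lemma hasDerivAt_cr {f : ℝ → Plane} {f' : Plane} {t : ℝ} (h : HasDerivAt f f' t) (a : Plane) :
    HasDerivAt (fun t => cr a (f t)) (cr a f') t :=
  ((hasDerivAt_apply h 1).const_mul _).sub ((hasDerivAt_apply h 0).const_mul _)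

lemma continuous_cr {X : Type*} [TopologicalSpace X] {f g : X → Plane} (hf : Continuous f)
    (hg : Continuous g) : Continuous fun x => cr (f x) (g x) := by
  unfold cr; fun_prop

lemma sign_abs {o : ℝ} (ho : o * o = 1) : |o| = 1 := by
  rcases mul_self_eq_one_iff.1 ho with h | h <;> simp [h]

lemma le_abs_of_sign {o : ℝ} (ho : o * o = 1) (x : ℝ) : o * x ≤ |x| := by
  have := le_abs_self (o * x)
  rwa [abs_mul, sign_abs ho, one_mul] at this

lemma ne_zero_of_sign {o : ℝ} (ho : o * o = 1) : o ≠ 0 := by rintro rfl; simp at ho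

/-- The curve `γ` is a regular `C²` curve with positive curvature (with respect to the
orientation `o`) and tangent angle `ψ`. -/
structure IsConvexCurve (γ : ℝ → Plane) (o : ℝ) (ψ : ℝ → ℝ) : Prop where
  contDiff : ContDiff ℝ 2 γ
  sign : o * o = 1
  regular : ∀ t, deriv γ t ≠ 0
  deriv_eq : ∀ t, deriv γ t = ‖deriv γ t‖ • ang o (ψ t)
  angle : ∀ t, HasDerivAt ψ (o * cr (deriv γ t) (deriv (deriv γ) t) / ‖deriv γ t‖ ^ 2) t
  pos : ∀ t, 0 < o * cr (deriv γ t) (deriv (deriv γ) t)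

/-! ### Tangent angles of locally convex curves. -/

section Curve

variable {γ : ℝ → Plane} {o : ℝ} {ψ : ℝ → ℝ}

lemma hasDerivAt_of_contDiff (h : ContDiff ℝ 2 γ) (t : ℝ) : HasDerivAt γ (deriv γ t) t :=
  (h.differentiable two_ne_zero t).hasDerivAt

lemma contDiff_deriv (h : ContDiff ℝ 2 γ) : ContDiff ℝ 1 (deriv γ) :=
  ((contDiff_succ_iff_deriv (n := 1)).1 (by simpa [one_add_one_eq_two] using h)).2.2

lemma hasDerivAt_deriv (h : ContDiff ℝ 2 γ) (t : ℝ) :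
    HasDerivAt (deriv γ) (deriv (deriv γ) t) t :=
  ((contDiff_deriv h).differentiable one_ne_zero t).hasDerivAt

lemma continuous_deriv_deriv (h : ContDiff ℝ 2 γ) : Continuous (deriv (deriv γ)) :=
  (contDiff_deriv h).continuous_deriv le_rfl

lemma eq_of_hasDerivAt_zero {f : ℝ → ℝ} (h : ∀ t, HasDerivAt f 0 t) (s t : ℝ) : f s = f t :=
  is_const_of_deriv_eq_zero (fun t => (h t).differentiableAt) (fun t => (h t).deriv) s t

/-- A regular curve without inflection points has a tangent angle function. -/
lemma exists_isConvexCurve (h : ContDiff ℝ 2 γ) (hr : ∀ t, deriv γ t ≠ 0)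
    (hcr : ∀ t, cr (deriv γ t) (deriv (deriv γ) t) ≠ 0) : ∃ o ψ, IsConvexCurve γ o ψ := by
  have hc1 : Continuous (deriv γ) := (contDiff_deriv h).continuous
  have hc2 := continuous_deriv_deriv h
  have hcc : Continuous fun t => cr (deriv γ t) (deriv (deriv γ) t) := continuous_cr hc1 hc2
  -- A continuous function without zeros has constant sign, and o is that sign. Reflecting the
  -- second coordinate by o reduces clockwise curves to counterclockwise ones.
  obtain ⟨o, ho, hpos⟩ : ∃ o : ℝ, o * o = 1 ∧
      ∀ t, 0 < o * cr (deriv γ t) (deriv (deriv γ) t) := by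
    have nz : ∀ s t, cr (deriv γ s) (deriv (deriv γ) s) < 0 →
        0 < cr (deriv γ t) (deriv (deriv γ) t) → False := fun s t hs ht => by
      obtain ⟨x, hx⟩ := mem_range_of_exists_le_of_exists_ge hcc ⟨s, hs.le⟩ ⟨t, ht.le⟩
      exact hcr x hx
    rcases lt_or_gt_of_ne (hcr 0) with h0 | h0
    · refine ⟨-1, by norm_num, fun t => ?_⟩
      have : ¬ 0 < cr (deriv γ t) (deriv (deriv γ) t) := nz 0 t h0
      have := lt_of_le_of_ne (not_lt.1 this) (hcr t)
      linarith
    · refine ⟨1, by norm_num, fun t => ?_⟩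
      have : ¬ cr (deriv γ t) (deriv (deriv γ) t) < 0 := fun h => nz t 0 h h0
      have := lt_of_le_of_ne (not_lt.1 this) (hcr t).symm
      linarith
  have hn : ∀ t, 0 < ‖deriv γ t‖ := fun t => norm_pos_iff.2 (hr t)
  set f : ℝ → ℝ := fun t => o * cr (deriv γ t) (deriv (deriv γ) t) / ‖deriv γ t‖ ^ 2 with hf
  have hfc : Continuous f := (continuous_const.mul hcc).div (hc1.norm.pow 2)
    fun t => (pow_pos (hn t) 2).ne'
  -- The argument of the initial velocity is the initial value of the angle, which then grows at the
  -- rate of turning f.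
  set w : ℂ := ⟨deriv γ 0 0, o * deriv γ 0 1⟩ with hw
  have hwn : ‖w‖ = ‖deriv γ 0‖ := by
    have h1 : ‖w‖ ^ 2 = ‖deriv γ 0‖ ^ 2 := by
      rw [← Complex.normSq_eq_norm_sq, Complex.normSq_apply, norm_sq_eq]
      simp only [hw]; linear_combination (deriv γ 0 1) ^ 2 * ho
    exact (pow_left_inj₀ (norm_nonneg _) (norm_nonneg _) two_ne_zero).1 h1
  set ψ : ℝ → ℝ := fun t => Complex.arg w + ∫ x in (0 : ℝ)..t, f x with hψ
  have hψd : ∀ t, HasDerivAt ψ (f t) t := fun t =>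
    (hfc.integral_hasStrictDerivAt 0 t).hasDerivAt.const_add _
  have hψ0 : ψ 0 = Complex.arg w := by simp [hψ]
  have hcos0 : ‖deriv γ 0‖ * Real.cos (ψ 0) = deriv γ 0 0 := by
    rw [hψ0, ← hwn, Complex.norm_mul_cos_arg]
  have hsin0 : ‖deriv γ 0‖ * Real.sin (ψ 0) = o * deriv γ 0 1 := by
    rw [hψ0, ← hwn, Complex.norm_mul_sin_arg]
  -- the normal component in the rotating frame vanishes
  set n : ℝ → ℝ := fun t => o * Real.cos (ψ t) * deriv γ t 1 - Real.sin (ψ t) * deriv γ t 0 with hnn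
  set r : ℝ → ℝ := fun t => deriv γ t 0 ^ 2 + deriv γ t 1 ^ 2 with hrr
  have hrpos : ∀ t, 0 < r t := fun t => by
    simp only [hrr]; rw [← norm_sq_eq]; exact pow_pos (hn t) 2
  have hn0 : ∀ t, n t = 0 := by
    -- n²/r is the squared sine of the angle between the velocity and the direction ψ. Both turn at
    -- the same rate, so it keeps its initial value 0.
    have hconst : ∀ t, HasDerivAt (fun t => n t ^ 2 / r t) 0 t := by
      intro t
      have a0 := hasDerivAt_apply (hasDerivAt_deriv h t) 0
      have a1 := hasDerivAt_apply (hasDerivAt_deriv h t) 1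
      have dc := (hψd t).cos
      have ds := (hψd t).sin
      have dn : HasDerivAt n _ t := ((dc.const_mul o).mul a1).sub (ds.mul a0)
      have dr : HasDerivAt r _ t := (a0.pow 2).add (a1.pow 2)
      refine ((dn.pow 2).div dr (hrpos t).ne').congr_deriv ?_
      have hr0 := (hrpos t).ne'
      have hft : f t = o * cr (deriv γ t) (deriv (deriv γ) t) / r t := by
        simp only [hf, hrr]; rw [norm_sq_eq]
      rw [div_eq_zero_iff]; left
      simp only [hft, hnn, cr]
      simp only [Pi.pow_apply]
      field_simp
      simp only [hrr]
      set a := deriv γ t 0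
      set b := deriv γ t 1
      set c := deriv (deriv γ) t 0
      set d := deriv (deriv γ) t 1
      set C := Real.cos (ψ t)
      set S := Real.sin (ψ t)
      rcases mul_self_eq_one_iff.1 ho with h | h <;> rw [h] <;> ring
    intro t
    have h1 := eq_of_hasDerivAt_zero hconst t 0
    have h2 : n 0 = 0 := by
      have : ‖deriv γ 0‖ * n 0 = 0 := by
        simp only [hnn]
        linear_combination o * deriv γ 0 1 * hcos0 - deriv γ 0 0 * hsin0
      exact (mul_eq_zero.1 this).resolve_left (hn 0).ne'
    simp only [h2] at h1
    have : n t ^ 2 = 0 := by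
      have h3 := (hrpos t).ne'
      field_simp at h1
      simpa using h1
    exact pow_eq_zero_iff two_ne_zero |>.1 this
  -- The tangential component is the speed up to sign; it has no zeros and is positive at 0, so the
  -- sign is + throughout.
  set p : ℝ → ℝ := fun t => Real.cos (ψ t) * deriv γ t 0 + o * Real.sin (ψ t) * deriv γ t 1 with hp
  have hψc : Continuous ψ := continuous_iff_continuousAt.2 fun t => (hψd t).continuousAt
  have hpsq : ∀ t, p t ^ 2 = ‖deriv γ t‖ ^ 2 := by
    intro t
    have h1 := hn0 t
    simp only [hnn] at h1
    rw [norm_sq_eq]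
    simp only [hp]
    have h2 := Real.sin_sq_add_cos_sq (ψ t)
    linear_combination (-(o * Real.cos (ψ t) * deriv γ t 1 - Real.sin (ψ t) * deriv γ t 0)) * h1 +
      (deriv γ t 0 ^ 2 + deriv γ t 1 ^ 2) * h2 + deriv γ t 1 ^ 2 * ho *
      (Real.sin (ψ t) ^ 2 + Real.cos (ψ t) ^ 2)
  have hpc : Continuous p := by
    have e0 : Continuous fun t => deriv γ t 0 := by fun_prop
    have e1 : Continuous fun t => deriv γ t 1 := by fun_prop
    simp only [hp]
    exact ((Real.continuous_cos.comp hψc).mul e0).add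
      ((continuous_const.mul (Real.continuous_sin.comp hψc)).mul e1)
  have hp0 : 0 < p 0 := by
    have : ‖deriv γ 0‖ * p 0 = ‖deriv γ 0‖ ^ 2 := by
      rw [norm_sq_eq]
      simp only [hp]
      linear_combination deriv γ 0 0 * hcos0 + o * deriv γ 0 1 * hsin0 + deriv γ 0 1 ^ 2 * ho
    have h2 : 0 < ‖deriv γ 0‖ * p 0 := this ▸ pow_pos (hn 0) 2
    exact pos_of_mul_pos_right h2 (hn 0).le
  have hppos : ∀ t, 0 < p t := by
    intro t
    by_contra hneg
    obtain ⟨x, hx⟩ := mem_range_of_exists_le_of_exists_ge hpc ⟨t, not_lt.1 hneg⟩ ⟨0, hp0.le⟩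
    have := hpsq x
    rw [hx] at this
    have := pow_pos (hn x) 2
    linarith
  have hpn : ∀ t, p t = ‖deriv γ t‖ := fun t =>
    (pow_left_inj₀ (hppos t).le (norm_nonneg _) two_ne_zero).1 (hpsq t)
  refine ⟨o, ψ, h, ho, hr, fun t => ?_, hψd, hpos⟩
  have h1 := hn0 t
  simp only [hnn] at h1
  have h2 := Real.sin_sq_add_cos_sq (ψ t)
  rw [← hpn]
  ext i
  fin_cases i
  · show deriv γ t 0 = p t * Real.cos (ψ t)
    simp only [hp]
    linear_combination (-deriv γ t 0) * h2 - Real.sin (ψ t) * h1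
  · show deriv γ t 1 = p t * (o * Real.sin (ψ t))
    simp only [hp]
    linear_combination (-deriv γ t 1) * h2 - Real.sin (ψ t) ^ 2 * deriv γ t 1 * ho +
      o * Real.cos (ψ t) * h1 - Real.cos (ψ t) ^ 2 * deriv γ t 1 * ho

namespace IsConvexCurve

variable (h : IsConvexCurve γ o ψ)
include h

lemma norm_pos (t : ℝ) : 0 < ‖deriv γ t‖ := norm_pos_iff.2 (h.regular t)

lemma strictMono : StrictMono ψ :=
  strictMono_of_deriv_pos fun t => by
    rw [(h.angle t).deriv]
    exact div_pos (h.pos t) (pow_pos (h.norm_pos t) 2)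

lemma continuous_angle : Continuous ψ :=
  continuous_iff_continuousAt.2 fun t => (h.angle t).continuousAt

lemma cr_deriv (s t : ℝ) : o * cr (deriv γ s) (deriv γ t) =
    ‖deriv γ s‖ * ‖deriv γ t‖ * Real.sin (ψ t - ψ s) := by
  conv_lhs => rw [h.deriv_eq s, h.deriv_eq t]
  rw [smul_cr, cr_smul, cr_ang]
  linear_combination ‖deriv γ s‖ * ‖deriv γ t‖ * Real.sin (ψ t - ψ s) * h.sign

lemma hasDerivAt_height (s t : ℝ) : HasDerivAt (fun t => o * cr (deriv γ s) (γ t - γ s))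
    (‖deriv γ s‖ * ‖deriv γ t‖ * Real.sin (ψ t - ψ s)) t := by
  rw [← h.cr_deriv]
  exact (hasDerivAt_cr ((hasDerivAt_of_contDiff h.contDiff t).sub_const _) _).const_mul o

/-- The height over the tangent line at s increases as long as the tangent has turned by less than
π. -/
lemma height_pos {s t : ℝ} (hst : s < t) (hψ : ψ t ≤ ψ s + Real.pi) :
    0 < o * cr (deriv γ s) (γ t - γ s) := by
  have hm : StrictMonoOn (fun t => o * cr (deriv γ s) (γ t - γ s)) (Set.Icc s t) := by
    refine strictMonoOn_of_deriv_pos (convex_Icc _ _)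
      (fun x _ => (h.hasDerivAt_height s x).continuousAt.continuousWithinAt) fun x hx => ?_
    rw [interior_Icc] at hx
    rw [(h.hasDerivAt_height s x).deriv]
    have h1 := h.strictMono hx.1
    have h2 := h.strictMono hx.2
    exact mul_pos (mul_pos (h.norm_pos s) (h.norm_pos x))
      (Real.sin_pos_of_pos_of_lt_pi (by linarith) (by linarith))
  have := hm ⟨le_rfl, hst.le⟩ ⟨hst.le, le_rfl⟩ hst
  simpa [cr_zero] using this

/-- The gain of ψ over a period is constant because the curvature is periodic, and a multiple of 2π
because the velocity is. -/
lemma exists_turning {L : ℝ} (hper : Function.Periodic γ L) :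
    ∃ n : ℤ, ∀ t, ψ (t + L) = ψ t + n * (2 * Real.pi) := by
  have p1 : ∀ t, deriv γ (t + L) = deriv γ t := fun t => by
    rw [← deriv_comp_add_const, show (fun t => γ (t + L)) = γ from funext hper]
  have p2 : ∀ t, deriv (deriv γ) (t + L) = deriv (deriv γ) t := fun t => by
    rw [← deriv_comp_add_const, show (fun t => deriv γ (t + L)) = deriv γ from funext p1]
  have hd : ∀ t, HasDerivAt (fun t => ψ (t + L) - ψ t) 0 t := fun t => by
    have h1 := (h.angle (t + L)).comp_add_const t L
    rw [p1, p2] at h1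
    exact (h1.sub (h.angle t)).congr_deriv (sub_self _)
  have e : ang o (ψ (0 + L)) = ang o (ψ 0) := by
    have h1 := h.deriv_eq (0 + L)
    rw [p1] at h1
    have h2 := h1.symm.trans (h.deriv_eq 0)
    exact smul_right_injective _ (h.norm_pos 0).ne' h2
  have e0 : Real.cos (ψ (0 + L)) = Real.cos (ψ 0) := congrArg (fun v : Plane => v 0) e
  have e1 : o * Real.sin (ψ (0 + L)) = o * Real.sin (ψ 0) := congrArg (fun v : Plane => v 1) e
  have e2 := mul_left_cancel₀ (ne_zero_of_sign h.sign) e1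
  obtain ⟨n, hn⟩ := Real.Angle.angle_eq_iff_two_pi_dvd_sub.1 (Real.Angle.cos_sin_inj e0 e2)
  refine ⟨n, fun t => ?_⟩
  have := eq_of_hasDerivAt_zero hd t 0
  linarith

end IsConvexCurve

end Curve

/-- The curve `γ` is a closed strictly convex curve of period `L` (with respect to the orientation
`o`) and tangent angle `ψ`. -/
structure IsOval (γ : ℝ → Plane) (L o : ℝ) (ψ : ℝ → ℝ) : Prop extends IsConvexCurve γ o ψ where
  period_pos : 0 < L
  periodic : Function.Periodic γ L
  turn : ∀ t, ψ (t + L) = ψ t + 2 * Real.pi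

/-- The intersection of the open half-planes bounded by the tangent lines. -/
def ovalInterior (γ : ℝ → Plane) (o : ℝ) : Set Plane :=
  {P | ∀ s, 0 < o * cr (deriv γ s) (P - γ s)}

/-! ### Ovals and the boundaries of tables. -/

section

variable {γ : ℝ → Plane} {L o : ℝ} {ψ : ℝ → ℝ} {Ω : Set Plane}

lemma periodic_deriv (h : Function.Periodic γ L) : Function.Periodic (deriv γ) L := fun t => by
  rw [← deriv_comp_add_const, show (fun t => γ (t + L)) = γ from funext h]

namespace IsOval

/-- Past a turn of π the height decreases, but it reaches 0 only at s + L. -/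
lemma height_pos (h : IsOval γ L o ψ) {s t : ℝ} (h1 : s < t) (h2 : t < s + L) :
    0 < o * cr (deriv γ s) (γ t - γ s) := by
  rcases le_or_gt (ψ t) (ψ s + Real.pi) with hψ | hψ
  · exact h.toIsConvexCurve.height_pos h1 hψ
  have hm : StrictAntiOn (fun t => o * cr (deriv γ s) (γ t - γ s)) (Set.Icc t (s + L)) := by
    refine strictAntiOn_of_deriv_neg (convex_Icc _ _)
      (fun x _ => (h.hasDerivAt_height s x).continuousAt.continuousWithinAt) fun x hx => ?_
    rw [interior_Icc] at hx
    rw [(h.hasDerivAt_height s x).deriv]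
    have k1 := h.strictMono hx.1
    have k2 := h.strictMono hx.2
    rw [h.turn] at k2
    refine mul_neg_of_pos_of_neg (mul_pos (h.norm_pos s) (h.norm_pos x)) ?_
    rw [← Real.sin_sub_two_pi]
    exact Real.sin_neg_of_neg_of_neg_pi_lt (by linarith) (by linarith)
  have := hm ⟨le_rfl, h2.le⟩ ⟨h2.le, le_rfl⟩ h2
  simpa [cr_zero, h.periodic s] using this

lemma height_nonneg (h : IsOval γ L o ψ) (s t : ℝ) : 0 ≤ o * cr (deriv γ s) (γ t - γ s) := by
  obtain ⟨t', ⟨h1, h2⟩, ht⟩ := h.periodic.exists_mem_Ico h.period_pos t s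
  rw [ht]
  rcases h1.lt_or_eq with h3 | rfl
  · exact (h.height_pos h3 h2).le
  · simp [cr_zero]

/-- A point of the closed region on a tangent line is the point of tangency. -/
lemma eq_of_height_eq_zero (h : IsOval γ L o ψ) {P : Plane}
    (hP : ∀ s, 0 ≤ o * cr (deriv γ s) (P - γ s)) {s : ℝ}
    (h0 : o * cr (deriv γ s) (P - γ s) = 0) : P = γ s := by
  set a := deriv γ s with ha
  have hn : 0 < a 0 ^ 2 + a 1 ^ 2 := by rw [← norm_sq_eq]; exact pow_pos (h.norm_pos s) 2
  have hcr : cr a (P - γ s) = 0 := (mul_eq_zero.1 h0).resolve_left (ne_zero_of_sign h.sign)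
  set l := inner ℝ a (P - γ s) / (a 0 ^ 2 + a 1 ^ 2) with hl
  have e : P - γ s = l • a := by
    have hn' := hn.ne'
    have h1 : a 0 * (P - γ s) 1 - a 1 * (P - γ s) 0 = 0 := hcr
    ext i
    rw [PiLp.smul_apply, smul_eq_mul, hl, inner_eq, div_mul_eq_mul_div, eq_div_iff hn']
    fin_cases i
    · show (P - γ s) 0 * _ = _ * a 0
      linear_combination (-a 1) * h1
    · show (P - γ s) 1 * _ = _ * a 1
      linear_combination (a 0) * h1
  have d0 := hasDerivAt_apply (hasDerivAt_deriv h.contDiff s) 0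
  have d1 := hasDerivAt_apply (hasDerivAt_deriv h.contDiff s) 1
  have g := (hasDerivAt_of_contDiff h.contDiff s).const_sub P
  have g0 := hasDerivAt_apply g 0
  have g1 := hasDerivAt_apply g 1
  have hd := (((d0.mul g1).sub (d1.mul g0)).const_mul o)
  -- The height of P over a moving tangent line attains its minimum 0 at s. For P = γ s + l γ'(s)
  -- its derivative there is -l times a positive curvature term, so l = 0.
  have hmin : IsLocalMin (fun u => o * cr (deriv γ u) (P - γ u)) s :=
    Eventually.of_forall fun u => h0.le.trans (hP u)
  have hz := hmin.hasDerivAt_eq_zero hd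
  have e0 : (P - γ s) 0 = l * a 0 := by rw [e]; rfl
  have e1 : (P - γ s) 1 = l * a 1 := by rw [e]; rfl
  have hpos := h.pos s
  rw [e0, e1] at hz
  have : l * (o * cr a (deriv (deriv γ) s)) = 0 := by
    simp only [cr]
    simp only [PiLp.neg_apply, ← ha] at hz
    linear_combination -hz
  have hl0 := (mul_eq_zero.1 this).resolve_right hpos.ne'
  rw [hl0, zero_smul] at e
  exact sub_eq_zero.1 e

/-- Strict convexity rests on `eq_of_height_eq_zero`: an inner point of a segment on a tangent line
would force both ends to be the same point of tangency. -/
lemma isTable (h : IsOval γ L o ψ) : IsTable (ovalInterior γ o) γ L := by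
  have hc1 : Continuous (deriv γ) := (contDiff_deriv h.contDiff).continuous
  have hcγ : Continuous γ := h.contDiff.continuous
  have hlin : ∀ (P Q : Plane) (a b : ℝ) (s : ℝ), a + b = 1 →
      o * cr (deriv γ s) (a • P + b • Q - γ s) =
        a * (o * cr (deriv γ s) (P - γ s)) + b * (o * cr (deriv γ s) (Q - γ s)) := by
    intro P Q a b s hab
    simp only [cr, PiLp.sub_apply, PiLp.add_apply, PiLp.smul_apply, smul_eq_mul]
    obtain rfl : a = 1 - b := by linarith
    ring
  have hopen : IsOpen (ovalInterior γ o) := by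
    have hd : Function.Periodic (deriv γ) L := periodic_deriv h.periodic
    have : ovalInterior γ o = {P | ∀ s ∈ Set.Icc 0 L, 0 < o * cr (deriv γ s) (P - γ s)} := by
      ext P
      refine ⟨fun hP s _ => hP s, fun hP s => ?_⟩
      have hper : Function.Periodic (fun s => o * cr (deriv γ s) (P - γ s)) L := fun s => by
        simp only [h.periodic s, hd s]
      obtain ⟨s', hs', e⟩ := hper.exists_mem_Ico₀ h.period_pos s
      rw [e]
      exact hP s' ⟨hs'.1, hs'.2.le⟩
    rw [this, isOpen_iff_eventually]
    intro P hP
    have hcont : Continuous fun z : Plane × ℝ => o * cr (deriv γ z.2) (z.1 - γ z.2) :=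
      continuous_const.mul (continuous_cr (hc1.comp continuous_snd)
        (continuous_fst.sub (hcγ.comp continuous_snd)))
    -- Infinitely many strict inequalities remain true nearby since the parameter may be restricted
    -- to a compact period.
    exact isCompact_Icc.eventually_forall_of_forall_eventually fun s hs =>
      hcont.continuousAt.eventually (lt_mem_nhds (hP s hs))
  have hsub : closure (ovalInterior γ o) ⊆ {P | ∀ s, 0 ≤ o * cr (deriv γ s) (P - γ s)} := by
    refine closure_minimal (fun P hP s => (hP s).le) ?_
    simp only [Set.ofPred_forall]
    exact isClosed_iInter fun s => isClosed_le continuous_const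
      (continuous_const.mul (continuous_cr continuous_const (continuous_id.sub continuous_const)))
  have hstrict : ∀ {P Q : Plane} {a b : ℝ}, P ∈ closure (ovalInterior γ o) →
      Q ∈ closure (ovalInterior γ o) → P ≠ Q → 0 < a → 0 < b → a + b = 1 →
      a • P + b • Q ∈ ovalInterior γ o := by
    intro P Q a b hP hQ hne ha hb hab s
    rw [hlin P Q a b s hab]
    have h1 := hsub hP s
    have h2 := hsub hQ s
    rcases h1.lt_or_eq with h3 | h3
    · have := mul_pos ha h3
      have := mul_nonneg hb.le h2
      linarith
    · rcases h2.lt_or_eq with h4 | h4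
      · have := mul_pos hb h4
        have := mul_nonneg ha.le h1
        linarith
      · exact absurd ((h.eq_of_height_eq_zero (hsub hP) h3.symm).trans
          (h.eq_of_height_eq_zero (hsub hQ) h4.symm).symm) hne
  have hinj : ∀ s t, s < t → t < s + L → γ s ≠ γ t := fun s t h1 h2 e => by
    have := h.height_pos h1 h2
    rw [← e, sub_self, cr_zero, mul_zero] at this
    exact lt_irrefl _ this
  -- an interior point
  have hL2 : 0 < L / 2 := half_pos h.period_pos
  have hne : (ovalInterior γ o).Nonempty := by
    refine ⟨(1 / 2 : ℝ) • γ 0 + (1 / 2 : ℝ) • γ (L / 2), fun s => ?_⟩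
    rw [hlin _ _ _ _ s (by norm_num)]
    have h1 := h.height_nonneg s 0
    have h2 := h.height_nonneg s (L / 2)
    rcases h1.lt_or_eq with h3 | h3
    · linarith
    · rcases h2.lt_or_eq with h4 | h4
      · linarith
      · exact absurd ((h.eq_of_height_eq_zero (fun u => h.height_nonneg u 0) h3.symm).trans
          (h.eq_of_height_eq_zero (fun u => h.height_nonneg u (L / 2)) h4.symm).symm)
          (hinj 0 (L / 2) hL2 (by linarith))
  obtain ⟨P₀, hP₀⟩ := hne
  have hcl : ∀ s, γ s ∈ closure (ovalInterior γ o) := by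
    intro s
    -- Boundary points are approached along the segment to the interior point P₀.
    have ht : Tendsto (fun e : ℝ => (1 - e) • γ s + e • P₀) (𝓝[>] 0) (𝓝 (γ s)) := by
      have : Continuous fun e : ℝ => (1 - e) • γ s + e • P₀ := by fun_prop
      simpa using (this.tendsto 0).mono_left nhdsWithin_le_nhds
    refine mem_closure_of_tendsto ht ?_
    filter_upwards [Ioo_mem_nhdsGT (zero_lt_one' ℝ)] with e he u
    rw [hlin _ _ _ _ u (by ring)]
    have h1 := h.height_nonneg u s
    have h2 := mul_pos he.1 (hP₀ u)
    have h3 := mul_nonneg (sub_nonneg.2 he.2.le) h1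
    linarith
  refine ⟨hopen, ⟨P₀, hP₀⟩, ?_, ?_, ?_, h.contDiff, h.regular, h.period_pos, h.periodic, ?_, ?_⟩
  · -- boundedness: every direction is a normal direction
    obtain ⟨C, hC⟩ := (h.periodic.isBounded_of_continuous h.period_pos.ne' hcγ).exists_norm_le
    have hψs : Function.Surjective ψ := by
      have ht := tendsto_of_add_period (f := fun t => ψ (t * L))
        (h.continuous_angle.comp (continuous_id.mul continuous_const)) Real.two_pi_pos
        (fun t => by rw [add_mul, one_mul, h.turn])
      intro y
      obtain ⟨t, ht⟩ := (h.continuous_angle.comp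
        (continuous_id.mul continuous_const)).surjective ht.1 ht.2 y
      exact ⟨t * L, ht⟩
    have hkey : ∀ P ∈ ovalInterior γ o, ∀ θ, -C ≤ o * cr (ang o θ) P := by
      intro P hP θ
      obtain ⟨s, rfl⟩ := hψs θ
      have h1 := hP s
      rw [h.deriv_eq, smul_cr, cr_sub] at h1
      have h2 : 0 < o * (cr (ang o (ψ s)) P - cr (ang o (ψ s)) (γ s)) := by
        have h3 : 0 < ‖deriv γ s‖ * (o * (cr (ang o (ψ s)) P - cr (ang o (ψ s)) (γ s))) := by
          linarith
        exact pos_of_mul_pos_right h3 (norm_nonneg _)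
      have h4 : |o * cr (ang o (ψ s)) (γ s)| ≤ C := by
        rw [abs_mul, sign_abs h.sign, one_mul]
        refine (abs_cr_le _ _).trans ?_
        rw [norm_ang h.sign, one_mul]
        exact hC _ ⟨s, rfl⟩
      have := (abs_le.1 h4).1
      linarith
    refine (Metric.isBounded_iff_subset_closedBall 0).2 ⟨2 * C, fun P hP => ?_⟩
    rw [mem_closedBall_zero_iff]
    -- These four angles bound each coordinate of P from both sides.
    have k1 := hkey P hP 0
    have k2 := hkey P hP (Real.pi)
    have k3 := hkey P hP (Real.pi / 2)
    have k4 := hkey P hP (-(Real.pi / 2))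
    simp [cr] at k1 k2 k3 k4
    have ho := h.sign
    have b0 : |P 0| ≤ C := by
      rw [← mul_assoc, ho, one_mul] at k3 k4
      rw [abs_le]; constructor <;> linarith
    have b1 : |P 1| ≤ C := by
      have : |o * P 1| ≤ C := by rw [abs_le]; constructor <;> linarith
      rwa [abs_mul, sign_abs ho, one_mul] at this
    have hC0 : 0 ≤ C := (abs_nonneg _).trans b0
    refine abs_le_of_sq_le_sq' ?_ (by positivity) |>.2
    rw [norm_sq_eq]
    have c0 := sq_le_sq' (abs_le.1 b0).1 (abs_le.1 b0).2
    have c1 := sq_le_sq' (abs_le.1 b1).1 (abs_le.1 b1).2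
    nlinarith
  · intro P hP Q hQ a b ha hb hab s
    rw [hlin P Q a b s hab]
    rcases ha.lt_or_eq with ha' | rfl
    · have := mul_pos ha' (hP s)
      have := mul_nonneg hb (hQ s).le
      linarith
    · have hb1 : b = 1 := by linarith
      subst hb1
      simpa using hQ s
  · intro P hP Q hQ hne a b ha hb hab
    exact interior_mono subset_closure (hopen.interior_eq.symm ▸ hstrict hP hQ hne ha hb hab)
  · intro s hs t ht e
    rcases lt_trichotomy s t with h1 | h1 | h1
    · exact absurd e (hinj s t h1 (by linarith [ht.2, hs.1]))
    · exact h1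
    · exact absurd e.symm (hinj t s h1 (by linarith [hs.2, ht.1]))
  · rw [hopen.frontier_eq]
    ext P
    constructor
    · rintro ⟨s, rfl⟩
      exact ⟨hcl s, fun hs => by
        have := hs s
        simp [cr_zero] at this⟩
    · rintro ⟨h1, h2⟩
      have h3 : ∃ s, o * cr (deriv γ s) (P - γ s) ≤ 0 := by
        by_contra hcon
        push Not at hcon
        exact h2 hcon
      obtain ⟨s, hs⟩ := h3
      exact ⟨s, (h.eq_of_height_eq_zero (hsub h1) (le_antisymm hs (hsub h1 s))).symm⟩

end IsOval

/-- A supporting functional at γ s is maximal on the curve there, so it kills γ'(s) and its level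
line is the tangent. Its sign is read off from nearby curve points, which lie on the positive side
by local convexity. -/
lemma IsTable.height_pos (hT : IsTable Ω γ L) (h : IsConvexCurve γ o ψ) {P : Plane} (hP : P ∈ Ω)
    (s : ℝ) : 0 < o * cr (deriv γ s) (P - γ s) := by
  have hs : γ s ∈ frontier Ω := hT.range_eq ▸ ⟨s, rfl⟩
  have hs' : γ s ∉ Ω := by
    rw [hT.isOpen.frontier_eq] at hs; exact hs.2
  obtain ⟨f, hf⟩ := geometric_hahn_banach_open_point hT.convex hT.isOpen hs'
  have hfc : ∀ t, f (γ t) ≤ f (γ s) := fun t => by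
    have ht : γ t ∈ closure Ω := frontier_subset_closure (hT.range_eq ▸ ⟨t, rfl⟩)
    exact closure_minimal (t := {x | f x ≤ f (γ s)}) (fun x hx => (hf x hx).le)
      (isClosed_le f.continuous continuous_const) ht
  have hd : f (deriv γ s) = 0 :=
    IsLocalMax.hasDerivAt_eq_zero (Eventually.of_forall hfc : IsLocalMax (fun t => f (γ t)) s)
      (f.hasFDerivAt.comp_hasDerivAt s (hasDerivAt_of_contDiff hT.contDiff s))
  have hfe : ∀ v : Plane, f v = v 0 * f !₂[1, 0] + v 1 * f !₂[0, 1] := fun v => by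
    conv_lhs => rw [show v = v 0 • !₂[(1 : ℝ), 0] + v 1 • !₂[(0 : ℝ), 1] by
      ext i; fin_cases i <;> simp]
    rw [map_add, map_smul, map_smul]; rfl
  set α := f !₂[1, 0] with hα
  set β := f !₂[0, 1] with hβ
  set a := deriv γ s with ha
  have hn : 0 < a 0 ^ 2 + a 1 ^ 2 := by rw [← norm_sq_eq]; exact pow_pos (h.norm_pos s) 2
  set c := (a 0 * β - a 1 * α) / (a 0 ^ 2 + a 1 ^ 2) with hc
  rw [hfe] at hd
  have hfcr : ∀ v, f v = c * cr a v := fun v => by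
    rw [hfe, hc, cr, div_mul_eq_mul_div, eq_div_iff hn.ne']
    linear_combination (v 0 * a 0 + v 1 * a 1) * hd
  have hlt : c * o < 0 := by
    obtain ⟨t, ht1, ht2⟩ : ∃ t, s < t ∧ ψ t ≤ ψ s + Real.pi := by
      have : ∀ᶠ t in 𝓝[>] s, ψ t < ψ s + Real.pi :=
        (h.continuous_angle.continuousAt.eventually
          (gt_mem_nhds (by linarith [Real.pi_pos]))).filter_mono nhdsWithin_le_nhds
      obtain ⟨t, h1, h2⟩ := (this.and self_mem_nhdsWithin).exists
      exact ⟨t, h2, h1.le⟩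
    have h1 := h.height_pos ht1 ht2
    have h2 := hfc t
    have h3 : f (γ t - γ s) ≤ 0 := by rw [map_sub]; linarith
    rw [hfcr] at h3
    have h4 : c * o ≤ 0 := by
      by_contra hcon
      have h5 := mul_pos (not_le.1 hcon) h1
      have h6 : c * o * (o * cr a (γ t - γ s)) = c * cr a (γ t - γ s) := by
        linear_combination c * cr a (γ t - γ s) * h.sign
      linarith
    refine lt_of_le_of_ne h4 fun h0 => ?_
    have hc0 := (mul_eq_zero.1 h0).resolve_right (ne_zero_of_sign h.sign)
    obtain ⟨Q, hQ⟩ := hT.nonempty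
    have := hf Q hQ
    rw [hfcr, hfcr, hc0] at this
    simp at this
  have h1 := hf P hP
  have h2 : f (P - γ s) < 0 := by rw [map_sub]; linarith
  rw [hfcr] at h2
  by_contra hcon
  have h5 := mul_nonneg_of_nonpos_of_nonpos hlt.le (not_lt.1 hcon)
  have h6 : c * o * (o * cr a (P - γ s)) = c * cr a (P - γ s) := by
    linear_combination c * cr a (P - γ s) * h.sign
  linarith

/-- The boundary of a table with nowhere vanishing curvature is an oval. -/
lemma IsTable.isOval (hT : IsTable Ω γ L) (h : IsConvexCurve γ o ψ) : IsOval γ L o ψ := by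
  obtain ⟨n, hn⟩ := h.exists_turning hT.periodic
  refine ⟨h, hT.period_pos, hT.periodic, ?_⟩
  have hpi := Real.two_pi_pos
  have hn0 : 0 < n := by
    have h1 := h.strictMono (lt_add_of_pos_right 0 hT.period_pos)
    rw [hn] at h1
    have : (0 : ℝ) < n := by
      have h2 : 0 < (n : ℝ) * (2 * Real.pi) := by linarith
      exact pos_of_mul_pos_left h2 hpi.le
    exact_mod_cast this
  suffices hn1 : n ≤ 1 by
    have : n = 1 := by omega
    subst this
    simpa using hn
  by_contra hcon
  have hn2 : (2 : ℝ) ≤ n := by exact_mod_cast (by omega : 2 ≤ n)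
  -- If the tangent turned at least twice, some other boundary point would have the same tangent
  -- direction as γ 0. Each of the two points lies on the inner side of the other's tangent, so the
  -- tangents coincide, and the midpoint, interior by strict convexity, has height 0.
  obtain ⟨t, ⟨ht1, ht2⟩, ht⟩ := intermediate_value_Icc hT.period_pos.le
    h.continuous_angle.continuousOn (show ψ 0 + 2 * Real.pi ∈ Set.Icc (ψ 0) (ψ L) by
      have := hn 0
      rw [zero_add] at this
      constructor <;> nlinarith)
  have t0 : t ≠ 0 := by rintro rfl; linarith
  have tL : t ≠ L := by
    rintro rfl
    have := hn 0
    rw [zero_add] at this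
    nlinarith
  have hmem : ∀ s, γ s ∈ closure Ω := fun s =>
    frontier_subset_closure (hT.range_eq ▸ ⟨s, rfl⟩)
  have hnn : ∀ P ∈ closure Ω, ∀ s, 0 ≤ o * cr (deriv γ s) (P - γ s) := by
    intro P hP s
    exact closure_minimal (t := {P | 0 ≤ o * cr (deriv γ s) (P - γ s)})
      (fun Q hQ => (hT.height_pos h hQ s).le) (isClosed_le continuous_const (continuous_const.mul
        (continuous_cr continuous_const (continuous_id.sub continuous_const)))) hP
  have hne : γ 0 ≠ γ t := fun e => t0 (hT.injOn ⟨le_rfl, hT.period_pos⟩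
    ⟨ht1, lt_of_le_of_ne ht2 tL⟩ e).symm
  have hang : ang o (ψ t) = ang o (ψ 0) := by
    rw [ht]; simp [ang]
  have k1 := hnn _ (hmem t) 0
  have k2 := hnn _ (hmem 0) t
  rw [h.deriv_eq, smul_cr] at k1 k2
  rw [hang] at k2
  have e1 : 0 ≤ o * cr (ang o (ψ 0)) (γ t - γ 0) :=
    nonneg_of_mul_nonneg_right (by linarith) (h.norm_pos 0)
  have e2 : 0 ≤ o * cr (ang o (ψ 0)) (γ 0 - γ t) :=
    nonneg_of_mul_nonneg_right (by linarith) (h.norm_pos t)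
  rw [cr_sub] at e1 e2
  have e3 : o * cr (ang o (ψ 0)) (γ t - γ 0) = 0 := by rw [cr_sub]; linarith
  have hint := hT.strictConvex (hmem 0) (hmem t) hne (a := 1 / 2) (b := 1 / 2) (by norm_num)
    (by norm_num) (by norm_num)
  rw [hT.convex.interior_closure_eq_interior_of_nonempty_interior
    (by rw [hT.isOpen.interior_eq]; exact hT.nonempty), hT.isOpen.interior_eq] at hint
  have h3 := hT.height_pos h hint 0
  rw [show (1 / 2 : ℝ) • γ 0 + (1 / 2 : ℝ) • γ t - γ 0 = (1 / 2 : ℝ) • (γ t - γ 0) by module,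
    cr_smul, h.deriv_eq, smul_cr] at h3
  have : o * (1 / 2 * (‖deriv γ 0‖ * cr (ang o (ψ 0)) (γ t - γ 0))) =
    1 / 2 * ‖deriv γ 0‖ * (o * cr (ang o (ψ 0)) (γ t - γ 0)) := by ring
  rw [this, e3, mul_zero] at h3
  exact lt_irrefl _ h3

end

/-! ## The generating function of a billiard -/

section FormCalculus

variable {f g : ℝ × ℝ → ℝ} {a b c d : ℝ} {z : ℝ × ℝ}

lemma form_mul (hf : HasFDerivAt f (form a b) z) (hg : HasFDerivAt g (form c d) z) :
    HasFDerivAt (fun z => f z * g z) (form (a * g z + f z * c) (b * g z + f z * d)) z := by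
  refine (hf.mul hg).congr_fderiv ?_
  ext <;> simp <;> ring

lemma form_add (hf : HasFDerivAt f (form a b) z) (hg : HasFDerivAt g (form c d) z) :
    HasFDerivAt (fun z => f z + g z) (form (a + c) (b + d)) z := by
  refine (hf.add hg).congr_fderiv ?_
  ext <;> simp

lemma form_sub (hf : HasFDerivAt f (form a b) z) (hg : HasFDerivAt g (form c d) z) :
    HasFDerivAt (fun z => f z - g z) (form (a - c) (b - d)) z := by
  refine (hf.sub hg).congr_fderiv ?_
  ext <;> simp

lemma form_neg (hf : HasFDerivAt f (form a b) z) :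
    HasFDerivAt (fun z => -f z) (form (-a) (-b)) z := by
  refine hf.neg.congr_fderiv ?_
  ext <;> simp

lemma form_comp {h : ℝ → ℝ} {h' : ℝ} (hh : HasDerivAt h h' (f z))
    (hf : HasFDerivAt f (form a b) z) :
    HasFDerivAt (fun z => h (f z)) (form (h' * a) (h' * b)) z := by
  refine (hh.comp_hasFDerivAt z hf).congr_fderiv ?_
  ext <;> simp

lemma form_fst {h : ℝ → ℝ} {h' : ℝ} (hh : HasDerivAt h h' z.1) :
    HasFDerivAt (fun z : ℝ × ℝ => h z.1) (form h' 0) z := by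
  refine (hh.comp_hasFDerivAt z hasFDerivAt_fst).congr_fderiv ?_
  ext <;> simp

lemma form_snd {h : ℝ → ℝ} {h' : ℝ} (hh : HasDerivAt h h' z.2) :
    HasFDerivAt (fun z : ℝ × ℝ => h z.2) (form 0 h') z := by
  refine (hh.comp_hasFDerivAt z hasFDerivAt_snd).congr_fderiv ?_
  ext <;> simp

end FormCalculus

/-- The inverse of the length of a chord. -/
def chordInv (γ : ℝ → Plane) (a b : ℝ) : ℝ := ‖γ b - γ a‖⁻¹

/-- The jet of the function `-‖γ b - γ a‖`, which generates the billiard map. -/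
def billiardJet (γ : ℝ → Plane) : GenJet where
  h1 z := inner ℝ (deriv γ z.1) (chordDir γ z.1 z.2)
  h2 z := -inner ℝ (deriv γ z.2) (chordDir γ z.1 z.2)
  h11 z := inner ℝ (deriv (deriv γ) z.1) (chordDir γ z.1 z.2) -
    cr (deriv γ z.1) (chordDir γ z.1 z.2) ^ 2 * chordInv γ z.1 z.2
  h12 z := cr (deriv γ z.1) (chordDir γ z.1 z.2) * cr (deriv γ z.2) (chordDir γ z.1 z.2) *
    chordInv γ z.1 z.2
  h22 z := -inner ℝ (deriv (deriv γ) z.2) (chordDir γ z.1 z.2) -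
    cr (deriv γ z.2) (chordDir γ z.1 z.2) ^ 2 * chordInv γ z.1 z.2

lemma norm_eq_sqrt (a : Plane) : ‖a‖ = Real.sqrt (a 0 ^ 2 + a 1 ^ 2) := by
  rw [← norm_sq_eq, Real.sqrt_sq (norm_nonneg _)]

lemma chordDir_apply (γ : ℝ → Plane) (a b : ℝ) (i : Fin 2) :
    chordDir γ a b i = chordInv γ a b * (γ b i - γ a i) := by
  simp [chordDir, chordInv]

/-! ### The derivatives of the chord length. -/

section Jet

variable {γ : ℝ → Plane} {L o : ℝ} {ψ : ℝ → ℝ}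

lemma hasFDerivAt_chordInv (h : ContDiff ℝ 2 γ) {z : ℝ × ℝ} (hz : γ z.2 ≠ γ z.1) :
    HasFDerivAt (fun z => chordInv γ z.1 z.2)
      (form (chordInv γ z.1 z.2 ^ 3 * (deriv γ z.1 0 * (γ z.2 0 - γ z.1 0) +
          deriv γ z.1 1 * (γ z.2 1 - γ z.1 1)))
        (-(chordInv γ z.1 z.2 ^ 3 * (deriv γ z.2 0 * (γ z.2 0 - γ z.1 0) +
          deriv γ z.2 1 * (γ z.2 1 - γ z.1 1))))) z := by
  have e : (fun z : ℝ × ℝ => chordInv γ z.1 z.2) = fun z => (Real.sqrt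
      ((γ z.2 0 - γ z.1 0) * (γ z.2 0 - γ z.1 0) + (γ z.2 1 - γ z.1 1) * (γ z.2 1 - γ z.1 1)))⁻¹ := by
    funext z; rw [chordInv, norm_eq_sqrt]; simp [sq]
  have hpos : 0 < (γ z.2 0 - γ z.1 0) * (γ z.2 0 - γ z.1 0) +
      (γ z.2 1 - γ z.1 1) * (γ z.2 1 - γ z.1 1) := by
    have h1 := pow_pos (norm_pos_iff.2 (sub_ne_zero.2 hz)) 2
    rw [norm_sq_eq] at h1
    simpa [sq] using h1
  have hi : ∀ i : Fin 2, HasFDerivAt (fun z : ℝ × ℝ => γ z.2 i - γ z.1 i)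
      (form (0 - deriv γ z.1 i) (deriv γ z.2 i - 0)) z := fun i =>
    form_sub (form_snd (h := fun t => γ t i) (hasDerivAt_apply (hasDerivAt_of_contDiff h z.2) i))
      (form_fst (h := fun t => γ t i) (hasDerivAt_apply (hasDerivAt_of_contDiff h z.1) i))
  have hs := form_add (form_mul (hi 0) (hi 0)) (form_mul (hi 1) (hi 1))
  have hd := (Real.hasDerivAt_sqrt hpos.ne').inv (Real.sqrt_pos.2 hpos).ne'
  have := form_comp (h := fun x => (Real.sqrt x)⁻¹) hd hs
  have ez := congrFun e z
  simp only at ez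
  rw [e, ez]
  set S := Real.sqrt ((γ z.2 0 - γ z.1 0) * (γ z.2 0 - γ z.1 0) +
      (γ z.2 1 - γ z.1 1) * (γ z.2 1 - γ z.1 1)) with hS
  have hS0 : S ≠ 0 := (Real.sqrt_pos.2 hpos).ne'
  refine this.congr_fderiv ?_
  congr 1
  · simp only [zero_sub]; field_simp; ring
  · simp only [sub_zero]; field_simp; ring

lemma chordInv_sq_mul {z : ℝ × ℝ} (hz : γ z.2 ≠ γ z.1) :
    chordInv γ z.1 z.2 ^ 2 * ((γ z.2 0 - γ z.1 0) ^ 2 + (γ z.2 1 - γ z.1 1) ^ 2) = 1 := by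
  have h1 := norm_pos_iff.2 (sub_ne_zero.2 hz)
  have h2 := norm_sq_eq (γ z.2 - γ z.1)
  simp only [PiLp.sub_apply] at h2
  rw [← h2, chordInv]
  field_simp

/-- The product rule gives inner products; the normalization of the chord combines them into cross
products. -/
lemma hasFDerivAt_billiard₁ (h : ContDiff ℝ 2 γ) {z : ℝ × ℝ} (hz : γ z.2 ≠ γ z.1) :
    HasFDerivAt (billiardJet γ).h1 (form ((billiardJet γ).h11 z) ((billiardJet γ).h12 z)) z := by
  have hu := hasFDerivAt_chordInv h hz
  have hi : ∀ i : Fin 2, HasFDerivAt (fun z : ℝ × ℝ => γ z.2 i - γ z.1 i)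
      (form (0 - deriv γ z.1 i) (deriv γ z.2 i - 0)) z := fun i =>
    form_sub (form_snd (h := fun t => γ t i) (hasDerivAt_apply (hasDerivAt_of_contDiff h z.2) i))
      (form_fst (h := fun t => γ t i) (hasDerivAt_apply (hasDerivAt_of_contDiff h z.1) i))
  have ha : ∀ i : Fin 2, HasFDerivAt (fun z : ℝ × ℝ => deriv γ z.1 i)
      (form (deriv (deriv γ) z.1 i) 0) z := fun i =>
    form_fst (h := fun t => deriv γ t i) (hasDerivAt_apply (hasDerivAt_deriv h z.1) i)
  have hd := form_add (form_mul (ha 0) (form_mul hu (hi 0))) (form_mul (ha 1) (form_mul hu (hi 1)))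
  have e : (billiardJet γ).h1 = fun z => deriv γ z.1 0 * (chordInv γ z.1 z.2 * (γ z.2 0 - γ z.1 0)) +
      deriv γ z.1 1 * (chordInv γ z.1 z.2 * (γ z.2 1 - γ z.1 1)) := by
    funext z; simp only [billiardJet, inner_eq, chordDir_apply]
  have h1 := chordInv_sq_mul hz
  rw [e]
  refine hd.congr_fderiv ?_
  simp only [billiardJet, inner_eq, cr, chordDir_apply]
  set u := chordInv γ z.1 z.2
  set x := γ z.2 0 - γ z.1 0
  set y := γ z.2 1 - γ z.1 1
  congr 1
  · linear_combination ((deriv γ z.1 0 ^ 2 + deriv γ z.1 1 ^ 2) * u) * h1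
  · linear_combination (-(deriv γ z.1 0 * deriv γ z.2 0 + deriv γ z.1 1 * deriv γ z.2 1) * u) * h1

lemma hasFDerivAt_billiard₂ (h : ContDiff ℝ 2 γ) {z : ℝ × ℝ} (hz : γ z.2 ≠ γ z.1) :
    HasFDerivAt (billiardJet γ).h2 (form ((billiardJet γ).h12 z) ((billiardJet γ).h22 z)) z := by
  have hu := hasFDerivAt_chordInv h hz
  have hi : ∀ i : Fin 2, HasFDerivAt (fun z : ℝ × ℝ => γ z.2 i - γ z.1 i)
      (form (0 - deriv γ z.1 i) (deriv γ z.2 i - 0)) z := fun i =>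
    form_sub (form_snd (h := fun t => γ t i) (hasDerivAt_apply (hasDerivAt_of_contDiff h z.2) i))
      (form_fst (h := fun t => γ t i) (hasDerivAt_apply (hasDerivAt_of_contDiff h z.1) i))
  have ha : ∀ i : Fin 2, HasFDerivAt (fun z : ℝ × ℝ => deriv γ z.2 i)
      (form 0 (deriv (deriv γ) z.2 i)) z := fun i =>
    form_snd (h := fun t => deriv γ t i) (hasDerivAt_apply (hasDerivAt_deriv h z.2) i)
  have hd := form_neg
    (form_add (form_mul (ha 0) (form_mul hu (hi 0))) (form_mul (ha 1) (form_mul hu (hi 1))))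
  have e : (billiardJet γ).h2 = fun z => -(deriv γ z.2 0 * (chordInv γ z.1 z.2 * (γ z.2 0 - γ z.1 0)) +
      deriv γ z.2 1 * (chordInv γ z.1 z.2 * (γ z.2 1 - γ z.1 1))) := by
    funext z; simp only [billiardJet, inner_eq, chordDir_apply]
  have h1 := chordInv_sq_mul hz
  rw [e]
  refine hd.congr_fderiv ?_
  simp only [billiardJet, inner_eq, cr, chordDir_apply]
  set u := chordInv γ z.1 z.2
  set x := γ z.2 0 - γ z.1 0
  set y := γ z.2 1 - γ z.1 1
  congr 1
  · linear_combination (-(deriv γ z.1 0 * deriv γ z.2 0 + deriv γ z.1 1 * deriv γ z.2 1) * u) * h1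
  · linear_combination ((deriv γ z.2 0 ^ 2 + deriv γ z.2 1 ^ 2) * u) * h1

lemma continuousAt_chordInv (hc : Continuous γ) {z : ℝ × ℝ} (hz : γ z.2 ≠ γ z.1) :
    ContinuousAt (fun z : ℝ × ℝ => chordInv γ z.1 z.2) z := by
  refine ContinuousAt.inv₀ ?_ (norm_ne_zero_iff.2 (sub_ne_zero.2 hz))
  exact ((hc.comp continuous_snd).sub (hc.comp continuous_fst)).norm.continuousAt

lemma continuousAt_chordDir (hc : Continuous γ) {z : ℝ × ℝ} (hz : γ z.2 ≠ γ z.1) :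
    ContinuousAt (fun z : ℝ × ℝ => chordDir γ z.1 z.2) z :=
  (continuousAt_chordInv hc hz).smul
    ((hc.comp continuous_snd).sub (hc.comp continuous_fst)).continuousAt

lemma continuousAt_cr {X : Type*} [TopologicalSpace X] {f g : X → Plane} {x : X}
    (hf : ContinuousAt f x) (hg : ContinuousAt g x) : ContinuousAt (fun x => cr (f x) (g x)) x := by
  have : Continuous fun p : Plane × Plane => cr p.1 p.2 := continuous_cr continuous_fst continuous_snd
  exact ContinuousAt.comp (f := fun x => (f x, g x)) this.continuousAt (hf.prodMk hg)

namespace IsOval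

lemma ne_of_gap (h : IsOval γ L o ψ) {a b : ℝ} (hab : b - a ∈ Set.Ioo 0 L) : γ b ≠ γ a := fun e => by
  have := h.height_pos (s := a) (t := b) (by linarith [hab.1]) (by linarith [hab.2])
  rw [e, sub_self, cr_zero, mul_zero] at this
  exact lt_irrefl _ this

lemma height_pos' (h : IsOval γ L o ψ) {a b : ℝ} (h1 : a < b) (h2 : b < a + L) :
    0 < o * cr (deriv γ b) (γ a - γ b) := by
  have := h.height_pos (s := b) (t := a + L) h2 (by linarith)
  rwa [h.periodic] at this

lemma isTwist (h : IsOval γ L o ψ) : (billiardJet γ).IsTwist (Set.Ioo 0 L) where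
  isOpen := isOpen_Ioo
  convex := convex_Ioo _ _
  hasDeriv₁ z hz := hasFDerivAt_billiard₁ h.contDiff (h.ne_of_gap hz)
  hasDeriv₂ z hz := hasFDerivAt_billiard₂ h.contDiff (h.ne_of_gap hz)
  cont₁₁ z hz := by
    have c1 := continuousAt_chordDir h.contDiff.continuous (h.ne_of_gap hz)
    have c2 := continuousAt_chordInv h.contDiff.continuous (h.ne_of_gap hz)
    have c3 : ContinuousAt (fun z : ℝ × ℝ => deriv γ z.1) z :=
      ((contDiff_deriv h.contDiff).continuous.comp continuous_fst).continuousAt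
    have c4 : ContinuousAt (fun z : ℝ × ℝ => deriv (deriv γ) z.1) z :=
      ((continuous_deriv_deriv h.contDiff).comp continuous_fst).continuousAt
    exact (c4.inner c1).sub (((continuousAt_cr c3 c1).pow 2).mul c2)
  cont₁₂ z hz := by
    have c1 := continuousAt_chordDir h.contDiff.continuous (h.ne_of_gap hz)
    have c2 := continuousAt_chordInv h.contDiff.continuous (h.ne_of_gap hz)
    have c3 : ContinuousAt (fun z : ℝ × ℝ => deriv γ z.1) z :=
      ((contDiff_deriv h.contDiff).continuous.comp continuous_fst).continuousAt
    have c4 : ContinuousAt (fun z : ℝ × ℝ => deriv γ z.2) z :=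
      ((contDiff_deriv h.contDiff).continuous.comp continuous_snd).continuousAt
    exact ((continuousAt_cr c3 c1).mul (continuousAt_cr c4 c1)).mul c2
  cont₂₂ z hz := by
    have c1 := continuousAt_chordDir h.contDiff.continuous (h.ne_of_gap hz)
    have c2 := continuousAt_chordInv h.contDiff.continuous (h.ne_of_gap hz)
    have c3 : ContinuousAt (fun z : ℝ × ℝ => deriv γ z.2) z :=
      ((contDiff_deriv h.contDiff).continuous.comp continuous_snd).continuousAt
    have c4 : ContinuousAt (fun z : ℝ × ℝ => deriv (deriv γ) z.2) z :=
      ((continuous_deriv_deriv h.contDiff).comp continuous_snd).continuousAt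
    exact (c4.inner c1).neg.sub (((continuousAt_cr c3 c1).pow 2).mul c2)
  neg z hz := by
    have h1 : z.1 < z.2 := by linarith [hz.1]
    have h2 : z.2 < z.1 + L := by linarith [hz.2]
    have k1 := h.height_pos h1 h2
    have k2 := h.height_pos' h1 h2
    have hi : 0 < chordInv γ z.1 z.2 :=
      inv_pos.2 (norm_pos_iff.2 (sub_ne_zero.2 (h.ne_of_gap hz)))
    -- h₁₂ is minus a product of the heights of each end point over the tangent at the other; both
    -- are positive on an oval.
    have e : (billiardJet γ).h12 z = -(chordInv γ z.1 z.2 ^ 3 *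
        ((o * cr (deriv γ z.1) (γ z.2 - γ z.1)) * (o * cr (deriv γ z.2) (γ z.1 - γ z.2)))) := by
      simp only [billiardJet, cr, chordDir_apply, PiLp.sub_apply]
      rcases mul_self_eq_one_iff.1 h.sign with ho | ho <;> rw [ho] <;> ring
    rw [e, neg_lt_zero]
    positivity

end IsOval

end Jet

/-! ## Quantitative convexity -/

/-- Uniform bounds for a regular curve with nowhere vanishing curvature. -/
structure CurveBounds (γ : ℝ → Plane) (σ C k : ℝ) : Prop where
  speed : ∀ t, σ ≤ ‖deriv γ t‖
  deriv_le : ∀ t, ‖deriv γ t‖ ≤ C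
  deriv2_le : ∀ t, ‖deriv (deriv γ) t‖ ≤ C
  cr_ge : ∀ t, k ≤ |cr (deriv γ t) (deriv (deriv γ) t)|

lemma norm_normalize_sub_le {v w : Plane} (hw : w ≠ 0) :
    ‖‖v‖⁻¹ • v - ‖w‖⁻¹ • w‖ ≤ 2 * ‖v - w‖ / ‖w‖ := by
  have hw0 : 0 < ‖w‖ := norm_pos_iff.2 hw
  by_cases hv : v = 0
  · subst hv
    simp only [smul_zero, zero_sub, norm_neg, norm_smul, norm_inv, norm_norm]
    rw [inv_mul_cancel₀ hw0.ne', mul_div_assoc, div_self hw0.ne']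
    norm_num
  have hv0 : 0 < ‖v‖ := norm_pos_iff.2 hv
  have e : ‖v‖⁻¹ • v - ‖w‖⁻¹ • w = ‖w‖⁻¹ • (v - w) + (‖v‖⁻¹ - ‖w‖⁻¹) • v := by module
  have h1 : ‖(‖v‖⁻¹ - ‖w‖⁻¹) • v‖ ≤ ‖v - w‖ / ‖w‖ := by
    rw [norm_smul, Real.norm_eq_abs, inv_sub_inv hv0.ne' hw0.ne', abs_div, abs_mul, abs_norm,
      abs_norm, div_mul_eq_mul_div, mul_comm ‖v‖ ‖w‖, mul_div_mul_right _ _ hv0.ne']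
    gcongr
    rw [abs_sub_comm]
    exact abs_norm_sub_norm_le v w
  rw [e]
  refine (norm_add_le _ _).trans ?_
  rw [norm_smul, norm_inv, norm_norm]
  have : ‖w‖⁻¹ * ‖v - w‖ = ‖v - w‖ / ‖w‖ := by ring
  rw [this, mul_div_assoc, two_mul]
  gcongr

lemma norm_normalize {v : Plane} (hv : v ≠ 0) : ‖‖v‖⁻¹ • v‖ = 1 := by
  rw [norm_smul, norm_inv, norm_norm, inv_mul_cancel₀ (norm_ne_zero_iff.2 hv)]

lemma one_sub_inner {u v : Plane} (hu : ‖u‖ = 1) (hv : ‖v‖ = 1) :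
    1 - inner ℝ u v = ‖v - u‖ ^ 2 / 2 := by
  rw [norm_sub_sq_real, hu, hv, real_inner_comm]; ring

namespace IsOval

variable {γ : ℝ → Plane} {L o σ C k : ℝ} {ψ : ℝ → ℝ}

lemma abs_cr (h : IsOval γ L o ψ) (t : ℝ) :
    o * cr (deriv γ t) (deriv (deriv γ) t) = |cr (deriv γ t) (deriv (deriv γ) t)| := by
  rw [← abs_of_pos (h.pos t), abs_mul, sign_abs h.sign, one_mul]

lemma bound_pos (h : IsOval γ L o ψ) (b : CurveBounds γ σ C k) : 0 < C :=
  (h.norm_pos 0).trans_le (b.deriv_le 0)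

/-- The tangent turns at a rate between k/C² and C²/σ²; this also bounds the period from both sides.
-/
lemma angle_le (h : IsOval γ L o ψ) (b : CurveBounds γ σ C k) (hσ : 0 < σ) {s t : ℝ}
    (hst : s ≤ t) : ψ t - ψ s ≤ C ^ 2 / σ ^ 2 * (t - s) := by
  refine Convex.image_sub_le_mul_sub_of_deriv_le convex_univ h.continuous_angle.continuousOn
    (fun t _ => (h.angle t).differentiableAt.differentiableWithinAt) (fun t _ => ?_)
    s trivial t trivial hst
  rw [(h.angle t).deriv, h.abs_cr]
  have h1 := abs_cr_le (deriv γ t) (deriv (deriv γ) t)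
  have h2 := b.deriv_le t
  have h3 := b.deriv2_le t
  have h4 := b.speed t
  have hC := h.bound_pos b
  gcongr
  calc _ ≤ _ := h1
    _ ≤ C * C := by gcongr
    _ = C ^ 2 := by ring

lemma le_angle (h : IsOval γ L o ψ) (b : CurveBounds γ σ C k) {s t : ℝ}
    (hst : s ≤ t) : k / C ^ 2 * (t - s) ≤ ψ t - ψ s := by
  refine Convex.mul_sub_le_image_sub_of_le_deriv convex_univ h.continuous_angle.continuousOn
    (fun t _ => (h.angle t).differentiableAt.differentiableWithinAt) (fun t _ => ?_)
    s trivial t trivial hst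
  rw [(h.angle t).deriv, h.abs_cr]
  have h2 := b.deriv_le t
  have h4 := h.norm_pos t
  have h5 := b.cr_ge t
  gcongr

lemma le_period (h : IsOval γ L o ψ) (b : CurveBounds γ σ C k) (hσ : 0 < σ) :
    2 * Real.pi ≤ C ^ 2 / σ ^ 2 * L := by
  have := h.angle_le b hσ (le_add_of_nonneg_right h.period_pos.le : (0 : ℝ) ≤ 0 + L)
  rw [h.turn] at this
  linarith

lemma period_le (h : IsOval γ L o ψ) (b : CurveBounds γ σ C k) :
    k / C ^ 2 * L ≤ 2 * Real.pi := by
  have := h.le_angle b (le_add_of_nonneg_right h.period_pos.le : (0 : ℝ) ≤ 0 + L)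
  rw [h.turn] at this
  linarith

lemma hasDerivAt_height_sub (h : IsOval γ L o ψ) (c s t u : ℝ) :
    HasDerivAt (fun t => o * cr (deriv γ s) (γ t - γ s) - c * (t - u) ^ 2)
      (‖deriv γ s‖ * ‖deriv γ t‖ * Real.sin (ψ t - ψ s) - 2 * c * (t - u)) t := by
  refine ((h.hasDerivAt_height s t).sub
    ((((hasDerivAt_id t).sub_const u).pow 2).const_mul c)).congr_deriv ?_
  simp; ring

/-- The height of the curve over its tangent lines near the point of tangency. -/
lemma le_height_left (h : IsOval γ L o ψ) (b : CurveBounds γ σ C k) (hσ : 0 < σ) (hk : 0 < k)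
    {s t : ℝ} (h1 : s ≤ t) (h2 : C ^ 2 / σ ^ 2 * (t - s) ≤ Real.pi / 2) :
    σ ^ 2 * k / (Real.pi * C ^ 2) * (t - s) ^ 2 ≤ o * cr (deriv γ s) (γ t - γ s) := by
  set c := σ ^ 2 * k / (Real.pi * C ^ 2) with hc
  have hC := h.bound_pos b
  have hm : MonotoneOn (fun t => o * cr (deriv γ s) (γ t - γ s) - c * (t - s) ^ 2)
      (Set.Icc s t) := by
    refine monotoneOn_of_deriv_nonneg (convex_Icc _ _)
      (fun x _ => (h.hasDerivAt_height_sub c s x s).continuousAt.continuousWithinAt)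
      (fun x _ => (h.hasDerivAt_height_sub c s x s).differentiableAt.differentiableWithinAt)
      fun x hx => ?_
    rw [interior_Icc] at hx
    rw [(h.hasDerivAt_height_sub c s x s).deriv, sub_nonneg]
    have k1 := h.angle_le b hσ hx.1.le
    have k2 := h.le_angle b hx.1.le
    have k3 := h.strictMono hx.1
    have k4 : C ^ 2 / σ ^ 2 * (x - s) ≤ C ^ 2 / σ ^ 2 * (t - s) := by
      have := hx.2; gcongr
    have k5 := Real.mul_le_sin (x := ψ x - ψ s) (by linarith) (by linarith)
    have n1 := b.speed s
    have n2 := b.speed x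
    have hpi := Real.pi_pos
    have hx0 : 0 ≤ x - s := by linarith [hx.1]
    calc 2 * c * (x - s) = σ * σ * (2 / Real.pi * (k / C ^ 2 * (x - s))) := by
          rw [hc]; field_simp
      _ ≤ ‖deriv γ s‖ * ‖deriv γ x‖ * (2 / Real.pi * (ψ x - ψ s)) := by gcongr
      _ ≤ _ := by gcongr
  have := hm ⟨le_rfl, h1⟩ ⟨h1, le_rfl⟩ h1
  simp [cr_zero] at this
  linarith

/-- The mirror image of `le_height_left` at the end s + L of the period, where the sine of the
turning angle is negative. -/
lemma le_height_right (h : IsOval γ L o ψ) (b : CurveBounds γ σ C k) (hσ : 0 < σ) (hk : 0 < k)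
    {s t : ℝ} (h1 : t ≤ s + L) (h2 : C ^ 2 / σ ^ 2 * (s + L - t) ≤ Real.pi / 2) :
    σ ^ 2 * k / (Real.pi * C ^ 2) * (s + L - t) ^ 2 ≤ o * cr (deriv γ s) (γ t - γ s) := by
  set c := σ ^ 2 * k / (Real.pi * C ^ 2) with hc
  have hC := h.bound_pos b
  have hm : AntitoneOn (fun t => o * cr (deriv γ s) (γ t - γ s) - c * (t - (s + L)) ^ 2)
      (Set.Icc t (s + L)) := by
    refine antitoneOn_of_deriv_nonpos (convex_Icc _ _)
      (fun x _ => (h.hasDerivAt_height_sub c s x _).continuousAt.continuousWithinAt)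
      (fun x _ => (h.hasDerivAt_height_sub c s x _).differentiableAt.differentiableWithinAt)
      fun x hx => ?_
    rw [interior_Icc] at hx
    rw [(h.hasDerivAt_height_sub c s x _).deriv, sub_nonpos]
    have k1 := h.angle_le b hσ hx.2.le
    have k2 := h.le_angle b hx.2.le
    have k3 := h.strictMono hx.2
    rw [h.turn] at k1 k2 k3
    have k4 : C ^ 2 / σ ^ 2 * (s + L - x) ≤ C ^ 2 / σ ^ 2 * (s + L - t) := by
      have := hx.1; gcongr
    have k5 := Real.mul_le_sin (x := ψ s + 2 * Real.pi - ψ x) (by linarith) (by linarith)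
    have n1 := b.speed s
    have n2 := b.speed x
    have hpi := Real.pi_pos
    have hx0 : 0 ≤ s + L - x := by linarith [hx.2]
    have e : Real.sin (ψ x - ψ s) = -Real.sin (ψ s + 2 * Real.pi - ψ x) := by
      rw [← Real.sin_neg, ← Real.sin_sub_two_pi (ψ x - ψ s)]; congr 1; ring
    have : 2 * c * (s + L - x) ≤ ‖deriv γ s‖ * ‖deriv γ x‖ *
        Real.sin (ψ s + 2 * Real.pi - ψ x) := by
      calc 2 * c * (s + L - x) = σ * σ * (2 / Real.pi * (k / C ^ 2 * (s + L - x))) := by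
            rw [hc]; field_simp
        _ ≤ ‖deriv γ s‖ * ‖deriv γ x‖ * (2 / Real.pi * (ψ s + 2 * Real.pi - ψ x)) := by gcongr
        _ ≤ _ := by gcongr
    rw [e]
    linarith
  have := hm ⟨le_rfl, h1⟩ ⟨h1, le_rfl⟩ h1
  simp [cr_zero, h.periodic s] at this
  have e : (t - (s + L)) ^ 2 = (s + L - t) ^ 2 := by ring
  rw [e] at this
  linarith

end IsOval

/-- A uniform lower bound for the height of an oval over its tangent lines. -/
lemma exists_height_bound {σ C k : ℝ} (hσ : 0 < σ) (hC : 0 < C) (hk : 0 < k) :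
    ∃ c > 0, ∀ (γ : ℝ → Plane) (L o : ℝ) (ψ : ℝ → ℝ), IsOval γ L o ψ → CurveBounds γ σ C k →
      ∀ s t, s ≤ t → t ≤ s + L →
        c * min (t - s) (s + L - t) ^ 2 ≤ o * cr (deriv γ s) (γ t - γ s) := by
  have hpi := Real.pi_pos
  set K := C ^ 2 / σ ^ 2 with hK
  have hK0 : 0 < K := by positivity
  -- Over a parameter length t₀ the tangent turns by at most π/2, so the quadratic estimate applies.
  set t₀ := Real.pi / (2 * K) with ht₀
  have ht0 : 0 < t₀ := by positivity
  set c₁ := σ ^ 2 * k / (Real.pi * C ^ 2) with hc₁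
  have hc1 : 0 < c₁ := by positivity
  set Λ := 2 * Real.pi * C ^ 2 / k with hΛ
  have hΛ0 : 0 < Λ := by positivity
  refine ⟨c₁ * (t₀ / Λ) ^ 2, by positivity, ?_⟩
  intro γ L o ψ h b s t h1 h2
  have hKt : K * t₀ = Real.pi / 2 := by rw [ht₀]; field_simp
  have hLΛ : L ≤ Λ := by
    have := h.period_le b
    rw [hΛ, le_div_iff₀ hk]
    rw [div_mul_eq_mul_div, div_le_iff₀ (by positivity)] at this
    linarith
  have htL : t₀ ≤ L := by
    have := h.le_period b hσ
    have h3 : K * t₀ ≤ K * L := by linarith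
    exact le_of_mul_le_mul_left h3 hK0
  set m := min (t - s) (s + L - t) with hm
  have hm0 : 0 ≤ m := le_min (by linarith) (by linarith)
  have hmL : m ≤ Λ := (min_le_left _ _).trans (by linarith)
  -- Since m ≤ L ≤ Λ, truncation at t₀ costs only a constant factor.
  have hmin : t₀ / Λ * m ≤ min m t₀ := by
    refine le_min ?_ ?_
    · have : t₀ / Λ ≤ 1 := by rw [div_le_one hΛ0]; linarith
      nlinarith
    · rw [div_mul_eq_mul_div, div_le_iff₀ hΛ0]; nlinarith
  have hmin0 : 0 ≤ min m t₀ := le_min hm0 ht0.le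
  suffices hs : c₁ * min m t₀ ^ 2 ≤ o * cr (deriv γ s) (γ t - γ s) by
    refine le_trans ?_ hs
    rw [mul_assoc, ← mul_pow]
    gcongr
  -- The height is monotone on each side of the turn by π, so away from the point of tangency it is
  -- at least its value at distance t₀.
  rcases le_or_gt (ψ t) (ψ s + Real.pi) with hψ | hψ
  · rcases le_or_gt (t - s) t₀ with h3 | h3
    · refine le_trans ?_ (h.le_height_left b hσ hk h1 (by rw [← hKt]; gcongr))
      have : min m t₀ ≤ t - s := (min_le_left _ _).trans (min_le_left _ _)
      gcongr
    · have hmono : MonotoneOn (fun t => o * cr (deriv γ s) (γ t - γ s)) (Set.Icc (s + t₀) t) := by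
        refine monotoneOn_of_deriv_nonneg (convex_Icc _ _)
          (fun x _ => (h.hasDerivAt_height s x).continuousAt.continuousWithinAt)
          (fun x _ => (h.hasDerivAt_height s x).differentiableAt.differentiableWithinAt)
          fun x hx => ?_
        rw [interior_Icc] at hx
        rw [(h.hasDerivAt_height s x).deriv]
        have k1 := h.strictMono (show s < x by linarith [hx.1])
        have k2 := h.strictMono hx.2
        exact mul_nonneg (by positivity) (Real.sin_nonneg_of_nonneg_of_le_pi (by linarith) (by linarith))
      have h4 := hmono ⟨le_rfl, by linarith⟩ ⟨by linarith, le_rfl⟩ (by linarith : s + t₀ ≤ t)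
      refine le_trans ?_ ((h.le_height_left b hσ hk (t := s + t₀) (by linarith)
        (by rw [add_sub_cancel_left, ← hK, hKt])).trans h4)
      have : min m t₀ ≤ t₀ := min_le_right _ _
      rw [add_sub_cancel_left]
      gcongr
  · rcases le_or_gt (s + L - t) t₀ with h3 | h3
    · refine le_trans ?_ (h.le_height_right b hσ hk h2 (by rw [← hKt]; gcongr))
      have : min m t₀ ≤ s + L - t := (min_le_left _ _).trans (min_le_right _ _)
      gcongr
    · have hmono : AntitoneOn (fun t => o * cr (deriv γ s) (γ t - γ s))
          (Set.Icc t (s + L - t₀)) := by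
        refine antitoneOn_of_deriv_nonpos (convex_Icc _ _)
          (fun x _ => (h.hasDerivAt_height s x).continuousAt.continuousWithinAt)
          (fun x _ => (h.hasDerivAt_height s x).differentiableAt.differentiableWithinAt)
          fun x hx => ?_
        rw [interior_Icc] at hx
        rw [(h.hasDerivAt_height s x).deriv]
        have k1 := h.strictMono hx.1
        have k2 := h.strictMono (show x < s + L by linarith [hx.2])
        rw [h.turn] at k2
        refine mul_nonpos_of_nonneg_of_nonpos (by positivity) ?_
        rw [← Real.sin_sub_two_pi]
        exact Real.sin_nonpos_of_nonpos_of_neg_pi_le (by linarith) (by linarith)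
      have h4 := hmono ⟨le_rfl, by linarith⟩ ⟨by linarith, le_rfl⟩ (by linarith : t ≤ s + L - t₀)
      refine le_trans ?_ ((h.le_height_right b hσ hk (t := s + L - t₀) (by linarith)
        (by rw [sub_sub_cancel, ← hK, hKt])).trans h4)
      have : min m t₀ ≤ t₀ := min_le_right _ _
      rw [sub_sub_cancel]
      gcongr

/-! ### Reflection angles and parameter lengths of chords. -/

section Cosine

variable {γ : ℝ → Plane} {L o σ C k : ℝ} {ψ : ℝ → ℝ}

lemma chord_le (hd : ContDiff ℝ 2 γ) (b : CurveBounds γ σ C k) {s t : ℝ} (h : s ≤ t) :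
    ‖γ t - γ s‖ ≤ C * (t - s) := by
  have := Convex.norm_image_sub_le_of_norm_deriv_le (f := γ) (s := Set.univ) (x := s) (y := t)
    (fun x _ => hd.differentiable two_ne_zero x) (fun x _ => b.deriv_le x) convex_univ trivial trivial
  rwa [Real.norm_of_nonneg (sub_nonneg.2 h)] at this

lemma deriv_sub_le (hd : ContDiff ℝ 2 γ) (b : CurveBounds γ σ C k) (s t : ℝ) :
    ‖deriv γ t - deriv γ s‖ ≤ C * |t - s| :=
  Convex.norm_image_sub_le_of_norm_deriv_le (f := deriv γ) (s := Set.univ) (x := s) (y := t)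
    (fun x _ => (hasDerivAt_deriv hd x).differentiableAt) (fun x _ => b.deriv2_le x) convex_univ
    trivial trivial

lemma chord_sub_le (hd : ContDiff ℝ 2 γ) (b : CurveBounds γ σ C k) (hC : 0 < C) {s t u : ℝ}
    (hu : u ∈ Set.Icc s t) :
    ‖(γ t - γ s) - (t - s) • deriv γ u‖ ≤ C * (t - s) * (t - s) := by
  have hst : s ≤ t := hu.1.trans hu.2
  have hder : ∀ x, HasDerivAt (fun x => γ x - x • deriv γ u) (deriv γ x - deriv γ u) x := fun x => by
    have := (hasDerivAt_of_contDiff hd x).sub ((hasDerivAt_id x).smul_const (deriv γ u))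
    rw [one_smul] at this
    exact this
  have := Convex.norm_image_sub_le_of_norm_hasDerivWithin_le (f := fun x => γ x - x • deriv γ u)
    (s := Set.Icc s t) (x := s) (y := t) (C := C * (t - s)) (fun x _ => (hder x).hasDerivWithinAt)
    (fun x hx => (deriv_sub_le hd b u x).trans (by
      have : |x - u| ≤ t - s := by
        rw [abs_le]; constructor <;> linarith [hx.1, hx.2, hu.1, hu.2]
      gcongr)) (convex_Icc _ _) ⟨le_rfl, hst⟩ ⟨hst, le_rfl⟩
  rw [Real.norm_of_nonneg (sub_nonneg.2 hst)] at this
  have e : γ t - γ s - (t - s) • deriv γ u = γ t - t • deriv γ u - (γ s - s • deriv γ u) := by module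
  rw [e]
  exact this

lemma norm_unitTangent {t : ℝ} (h : deriv γ t ≠ 0) : ‖unitTangent γ t‖ = 1 := norm_normalize h

lemma norm_chordDir {a b : ℝ} (h : γ b ≠ γ a) : ‖chordDir γ a b‖ = 1 :=
  norm_normalize (sub_ne_zero.2 h)

/-- The second derivative bound makes the chord direction O(t - s) close to the tangents at its
points, and 1 - cos is half the squared distance of unit vectors. -/
lemma one_sub_inner_tangent_le (hd : ContDiff ℝ 2 γ) (b : CurveBounds γ σ C k) (hσ : 0 < σ)
    (hC : 0 < C) {s t u : ℝ} (hst : s < t) (hu : u ∈ Set.Icc s t) (hne : γ t ≠ γ s) :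
    1 - inner ℝ (unitTangent γ u) (chordDir γ s t) ≤ 2 * C ^ 2 / σ ^ 2 * (t - s) ^ 2 := by
  have hts : 0 < t - s := sub_pos.2 hst
  have hn : 0 < ‖deriv γ u‖ := hσ.trans_le (b.speed u)
  have hu0 : deriv γ u ≠ 0 := norm_pos_iff.1 hn
  rw [one_sub_inner (norm_unitTangent hu0) (norm_chordDir hne)]
  have e : unitTangent γ u = ‖(t - s) • deriv γ u‖⁻¹ • ((t - s) • deriv γ u) := by
    rw [norm_smul, Real.norm_of_nonneg hts.le, smul_smul, unitTangent]
    congr 1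
    field_simp
  have h1 : ‖chordDir γ s t - unitTangent γ u‖ ≤ 2 * C / σ * (t - s) := by
    rw [e]
    refine (norm_normalize_sub_le (smul_ne_zero hts.ne' hu0)).trans ?_
    rw [norm_smul, Real.norm_of_nonneg hts.le, div_le_iff₀ (by positivity)]
    have h2 := chord_sub_le hd b hC hu
    have h3 := b.speed u
    calc 2 * ‖(γ t - γ s) - (t - s) • deriv γ u‖ ≤ 2 * (C * (t - s) * (t - s)) := by gcongr
      _ = 2 * C / σ * (t - s) * ((t - s) * σ) := by field_simp
      _ ≤ _ := by gcongr
  have h2 := pow_le_pow_left₀ (norm_nonneg _) h1 2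
  calc _ ≤ (2 * C / σ * (t - s)) ^ 2 / 2 := by gcongr
    _ = _ := by field_simp

/-- The chord from b to a + L is the chord from a to b run backwards; this symmetry transfers bounds
between outgoing and incoming angles. -/
lemma cosOut_add_period (hp : Function.Periodic γ L) (a b : ℝ) :
    cosOut γ b (a + L) = -cosIn γ a b := by
  simp only [cosOut, cosIn, chordDir, hp a]
  rw [← inner_neg_right, ← smul_neg, neg_sub, norm_sub_rev]

lemma cosIn_add_period (hp : Function.Periodic γ L) (a b : ℝ) :
    cosIn γ b (a + L) = -cosOut γ a b := by
  have hd := periodic_deriv hp a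
  simp only [cosOut, cosIn, chordDir, unitTangent, hp a, hd]
  rw [← inner_neg_right, ← smul_neg, neg_sub, norm_sub_rev]

lemma h1_eq_cosOut (h : ∀ t, deriv γ t ≠ 0) (z : ℝ × ℝ) :
    (billiardJet γ).h1 z = ‖deriv γ z.1‖ * cosOut γ z.1 z.2 := by
  have := norm_pos_iff.2 (h z.1)
  simp only [billiardJet, cosOut, unitTangent, real_inner_smul_left]
  field_simp

lemma h2_eq_cosIn (h : ∀ t, deriv γ t ≠ 0) (z : ℝ × ℝ) :
    (billiardJet γ).h2 z = -(‖deriv γ z.2‖ * cosIn γ z.1 z.2) := by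
  have := norm_pos_iff.2 (h z.2)
  simp only [billiardJet, cosIn, unitTangent, real_inner_smul_left]
  field_simp

lemma del_iff (h : ∀ t, deriv γ t ≠ 0) (x y z : ℝ) :
    (billiardJet γ).h2 (x, y) + (billiardJet γ).h1 (y, z) = 0 ↔ cosIn γ x y = cosOut γ y z := by
  have := norm_pos_iff.2 (h y)
  rw [h1_eq_cosOut h, h2_eq_cosIn h]
  simp only
  constructor
  · intro e
    have : ‖deriv γ y‖ * (cosOut γ y z - cosIn γ x y) = 0 := by linarith
    have := (mul_eq_zero.1 this).resolve_left (norm_ne_zero_iff.2 (h y))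
    linarith
  · intro e; rw [e]; ring

lemma IsOval.cosOut_lt (h : IsOval γ L o ψ) {a b b' : ℝ} (h1 : a < b) (h2 : b < b')
    (h3 : b' < a + L) : cosOut γ a b' < cosOut γ a b := by
  have := h.isTwist.h1_lt (x := a) (y := b) (y' := b') ⟨by linarith, by linarith⟩
    ⟨by linarith, by linarith⟩ h2
  rw [h1_eq_cosOut h.regular, h1_eq_cosOut h.regular] at this
  exact lt_of_mul_lt_mul_left this (norm_nonneg _)

lemma sq_add_cosOut_sq {a b : ℝ} (h : deriv γ a ≠ 0) (hne : γ b ≠ γ a) :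
    cr (unitTangent γ a) (chordDir γ a b) ^ 2 + cosOut γ a b ^ 2 = 1 := by
  have := cr_sq_add_inner_sq (unitTangent γ a) (chordDir γ a b)
  rw [norm_unitTangent h, norm_chordDir hne] at this
  simpa [cosOut] using this

/-- Uniform comparison of the reflection angles with the lengths of the parameter intervals. -/
lemma exists_cos_bounds {σ C k : ℝ} (hσ : 0 < σ) (hC : 0 < C) (hk : 0 < k) :
    ∃ c > 0, ∃ K > 0, ∀ (γ : ℝ → Plane) (L o : ℝ) (ψ : ℝ → ℝ), IsOval γ L o ψ →
      CurveBounds γ σ C k → ∀ a b, a < b → b < a + L →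
        (c * (b - a) ^ 2 ≤ 1 - cosOut γ a b ∧ 1 - cosOut γ a b ≤ K * (b - a) ^ 2) ∧
        (c * (b - a) ^ 2 ≤ 1 - cosIn γ a b ∧ 1 - cosIn γ a b ≤ K * (b - a) ^ 2) ∧
        (c * (a + L - b) ^ 2 ≤ 1 + cosOut γ a b ∧ 1 + cosOut γ a b ≤ K * (a + L - b) ^ 2) ∧
        (c * (a + L - b) ^ 2 ≤ 1 + cosIn γ a b ∧ 1 + cosIn γ a b ≤ K * (a + L - b) ^ 2) := by
  obtain ⟨c₀, hc₀, hheight⟩ := exists_height_bound hσ hC hk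
  set c₁ := c₀ / C ^ 2 with hc₁
  have hc1 : 0 < c₁ := by positivity
  refine ⟨c₁ ^ 2 / 8, by positivity, 2 * C ^ 2 / σ ^ 2, by positivity, ?_⟩
  intro γ L o ψ h bd
  -- The sine is the height, at least c₀ m², divided by the product of speed and chord length, at
  -- most C · C m.
  have hsin : ∀ a b, a < b → b < a + L →
      c₁ * min (b - a) (a + L - b) ≤ |cr (unitTangent γ a) (chordDir γ a b)| := by
    intro a b h1 h2
    have hne := h.ne_of_gap (a := a) (b := b) ⟨by linarith, by linarith⟩
    have k1 := hheight γ L o ψ h bd a b h1.le h2.le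
    set m := min (b - a) (a + L - b) with hm
    have hm0 : 0 < m := lt_min (by linarith) (by linarith)
    have hv0 : 0 < ‖γ b - γ a‖ := norm_pos_iff.2 (sub_ne_zero.2 hne)
    have hv : ‖γ b - γ a‖ ≤ C * m := by
      rw [hm, mul_min_of_nonneg _ _ hC.le]
      refine le_min (chord_le h.contDiff bd h1.le) ?_
      have := chord_le h.contDiff bd h2.le
      rwa [h.periodic, norm_sub_rev] at this
    have ha := bd.deriv_le a
    have ha0 := h.norm_pos a
    rw [unitTangent, chordDir, smul_cr, cr_smul, abs_mul, abs_mul, abs_inv, abs_inv, abs_norm,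
      abs_norm]
    have k2 : c₀ * m ^ 2 ≤ |cr (deriv γ a) (γ b - γ a)| := k1.trans (le_abs_of_sign h.sign _)
    rw [← mul_assoc, ← mul_inv, inv_mul_eq_div, le_div_iff₀ (by positivity)]
    calc c₁ * m * (‖deriv γ a‖ * ‖γ b - γ a‖) ≤ c₁ * m * (C * (C * m)) := by gcongr
      _ = c₀ * m ^ 2 := by rw [hc₁]; field_simp
      _ ≤ _ := k2
  have hsin2 : ∀ a b, a < b → b < a + L →
      c₁ ^ 2 * min (b - a) (a + L - b) ^ 2 ≤ 1 - cosOut γ a b ^ 2 := by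
    intro a b h1 h2
    have hne := h.ne_of_gap (a := a) (b := b) ⟨by linarith, by linarith⟩
    have k1 := sq_add_cosOut_sq (h.regular a) hne
    have hm0 : 0 ≤ c₁ * min (b - a) (a + L - b) :=
      mul_nonneg hc1.le (le_min (by linarith) (by linarith))
    have k2 := pow_le_pow_left₀ hm0 (hsin a b h1 h2) 2
    rw [sq_abs, mul_pow] at k2
    linarith
  have hle : ∀ a b, |cosOut γ a b| ≤ 1 := by
    intro a b
    refine (abs_real_inner_le_norm _ _).trans ?_
    rw [norm_unitTangent (h.regular a), one_mul]
    by_cases e : γ b = γ a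
    · simp [chordDir, e]
    · exact (norm_chordDir e).le
  -- lower bounds for the outgoing angle
  have low₁ : ∀ a b, a < b → b < a + L → c₁ ^ 2 / 8 * (b - a) ^ 2 ≤ 1 - cosOut γ a b := by
    -- On the first half of the period m = b - a, and 1 - cos² ≤ 2 (1 - cos). Beyond it 1 - cos is
    -- at least its value at the half period, as the outgoing cosine decreases.
    have half : ∀ a b, a < b → b ≤ a + L / 2 → c₁ ^ 2 / 2 * (b - a) ^ 2 ≤ 1 - cosOut γ a b := by
      intro a b h1 h2
      have hL := h.period_pos
      have k := hsin2 a b h1 (by linarith)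
      rw [min_eq_left (by linarith)] at k
      have k2 := abs_le.1 (hle a b)
      nlinarith
    intro a b h1 h2
    have hL := h.period_pos
    rcases le_or_gt b (a + L / 2) with h3 | h3
    · refine le_trans ?_ (half a b h1 h3)
      gcongr; norm_num
    · have k1 := h.cosOut_lt (a := a) (b := a + L / 2) (b' := b) (by linarith) h3 h2
      have k2 := half a (a + L / 2) (by linarith) le_rfl
      have k3 : (b - a) ^ 2 ≤ L ^ 2 := by
        have : 0 ≤ b - a := by linarith
        gcongr; linarith
      have k4 : c₁ ^ 2 / 8 * (b - a) ^ 2 ≤ c₁ ^ 2 / 8 * L ^ 2 := by gcongr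
      rw [add_sub_cancel_left] at k2
      have k5 : c₁ ^ 2 / 2 * (L / 2) ^ 2 = c₁ ^ 2 / 8 * L ^ 2 := by ring
      linarith
  have low₂ : ∀ a b, a < b → b < a + L → c₁ ^ 2 / 8 * (a + L - b) ^ 2 ≤ 1 + cosOut γ a b := by
    have half : ∀ a b, b < a + L → a + L / 2 ≤ b →
        c₁ ^ 2 / 2 * (a + L - b) ^ 2 ≤ 1 + cosOut γ a b := by
      intro a b h1 h2
      have hL := h.period_pos
      have k := hsin2 a b (by linarith) (by linarith)
      rw [min_eq_right (by linarith)] at k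
      have k2 := abs_le.1 (hle a b)
      nlinarith
    intro a b h1 h2
    have hL := h.period_pos
    rcases le_or_gt (a + L / 2) b with h3 | h3
    · refine le_trans ?_ (half a b h2 h3)
      gcongr; norm_num
    · have k1 := h.cosOut_lt (a := a) (b := b) (b' := a + L / 2) h1 h3 (by linarith)
      have k2 := half a (a + L / 2) (by linarith) le_rfl
      have k3 : (a + L - b) ^ 2 ≤ L ^ 2 := by
        have : 0 ≤ a + L - b := by linarith
        gcongr; linarith
      have k4 : c₁ ^ 2 / 8 * (a + L - b) ^ 2 ≤ c₁ ^ 2 / 8 * L ^ 2 := by gcongr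
      rw [show a + L - (a + L / 2) = L / 2 by ring] at k2
      have k5 : c₁ ^ 2 / 2 * (L / 2) ^ 2 = c₁ ^ 2 / 8 * L ^ 2 := by ring
      linarith
  have up₁ : ∀ a b, a < b → b < a + L → 1 - cosOut γ a b ≤ 2 * C ^ 2 / σ ^ 2 * (b - a) ^ 2 :=
    fun a b h1 h2 => one_sub_inner_tangent_le h.contDiff bd hσ hC h1 ⟨le_rfl, h1.le⟩
      (h.ne_of_gap ⟨by linarith, by linarith⟩)
  have up₂ : ∀ a b, a < b → b < a + L → 1 - cosIn γ a b ≤ 2 * C ^ 2 / σ ^ 2 * (b - a) ^ 2 :=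
    fun a b h1 h2 => one_sub_inner_tangent_le h.contDiff bd hσ hC h1 ⟨h1.le, le_rfl⟩
      (h.ne_of_gap ⟨by linarith, by linarith⟩)
  intro a b h1 h2
  have e1 := cosOut_add_period h.periodic a b
  have e2 := cosIn_add_period h.periodic a b
  have b1 := low₁ b (a + L) h2 (by linarith)
  have b2 := low₂ b (a + L) h2 (by linarith)
  have b3 := up₁ b (a + L) h2 (by linarith)
  have b4 := up₂ b (a + L) h2 (by linarith)
  rw [e1] at b1 b2 b3
  rw [e2] at b4
  rw [show b + L - (a + L) = b - a by ring] at b2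
  refine ⟨⟨low₁ a b h1 h2, up₁ a b h1 h2⟩, ⟨by linarith, up₂ a b h1 h2⟩,
    ⟨low₂ a b h1 h2, by linarith⟩, ⟨by linarith, by linarith⟩⟩

end Cosine

/-! ## Uniform bounds for billiard orbits -/

/-- Comparability of neighbours makes any two terms comparable with factor κ^(2q), so no term is
much smaller than the sum. -/
lemma le_of_comparable {q : ℕ} {t : ℕ → ℝ} {κ S : ℝ} (hκ : 1 ≤ κ) (hpos : ∀ k < q, 0 < t k)
    (hup : ∀ k, k + 1 < q → t (k + 1) ≤ κ * t k) (hdown : ∀ k, k + 1 < q → t k ≤ κ * t (k + 1))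
    (hS : S ≤ ∑ k ∈ Finset.range q, t k) : ∀ i < q, S ≤ q * κ ^ (2 * q) * t i := by
  have h1 : ∀ k < q, t k ≤ κ ^ k * t 0 := by
    intro k
    induction k with
    | zero => intro _; simp
    | succ k ih =>
      intro hk
      calc t (k + 1) ≤ κ * t k := hup k hk
        _ ≤ κ * (κ ^ k * t 0) := by gcongr; exact ih (by omega)
        _ = _ := by ring
  have h2 : ∀ k < q, t 0 ≤ κ ^ k * t k := by
    intro k
    induction k with
    | zero => intro _; simp
    | succ k ih =>
      intro hk
      calc t 0 ≤ κ ^ k * t k := ih (by omega)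
        _ ≤ κ ^ k * (κ * t (k + 1)) := by gcongr; exact hdown k hk
        _ = _ := by ring
  intro i hi
  have h3 : ∀ j ∈ Finset.range q, t j ≤ κ ^ (2 * q) * t i := by
    intro j hj
    rw [Finset.mem_range] at hj
    have := hpos i hi
    calc t j ≤ κ ^ j * t 0 := h1 j hj
      _ ≤ κ ^ j * (κ ^ i * t i) := by gcongr; exact h2 i hi
      _ = κ ^ (j + i) * t i := by ring
      _ ≤ κ ^ (2 * q) * t i := by gcongr; omega
  calc S ≤ ∑ k ∈ Finset.range q, t k := hS
    _ ≤ ∑ k ∈ Finset.range q, κ ^ (2 * q) * t i := Finset.sum_le_sum h3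
    _ = _ := by rw [Finset.sum_const, Finset.card_range, nsmul_eq_mul]; ring

/-- The chords of billiard orbit segments that close up are uniformly transversal to the
boundary. -/
lemma exists_gap_bound (q : ℕ) {σ C k : ℝ} (hσ : 0 < σ) (hC : 0 < C) (hk : 0 < k) :
    ∃ δ > 0, ∀ (γ : ℝ → Plane) (L o : ℝ) (ψ : ℝ → ℝ), IsOval γ L o ψ → CurveBounds γ σ C k →
      ∀ p : ℕ, 1 ≤ p → p + 1 ≤ q → ∀ x : ℕ → ℝ,
        (∀ k < q, (x k, x (k + 1)) ∈ gapSet (Set.Ioo 0 L)) →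
        (∀ k, k + 1 < q → (billiardJet γ).h2 (x k, x (k + 1)) +
          (billiardJet γ).h1 (x (k + 1), x (k + 2)) = 0) →
        x q = x 0 + p * L → ∀ k < q, x (k + 1) - x k ∈ Set.Icc δ (L - δ) := by
  obtain ⟨c, hc, K, hK, hcos⟩ := exists_cos_bounds hσ hC hk
  rcases Nat.eq_zero_or_pos q with rfl | hq
  · exact ⟨1, one_pos, fun _ _ _ _ _ _ p _ hp => by omega⟩
  -- A simple upper bound for √(K/c), the comparison factor of lengths whose squares compare with
  -- factor K/c.
  set κ := 1 + K / c with hκ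
  have hκ1 : 1 ≤ κ := by rw [hκ]; have : 0 < K / c := by positivity
                         linarith
  have hcomp : ∀ s t : ℝ, 0 ≤ s → 0 ≤ t → c * t ^ 2 ≤ K * s ^ 2 → t ≤ κ * s := by
    intro s t hs ht h
    refine abs_le_of_sq_le_sq' ?_ (by positivity) |>.2
    have h1 : t ^ 2 ≤ K / c * s ^ 2 := by rw [div_mul_eq_mul_div, le_div_iff₀ hc]; linarith
    have h2 : K / c ≤ κ ^ 2 := by
      have : 0 ≤ K / c := by positivity
      rw [hκ]; nlinarith
    nlinarith [sq_nonneg s]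
  set Lm := 2 * Real.pi * σ ^ 2 / C ^ 2 with hLm
  have hLm0 : 0 < Lm := by have := Real.pi_pos; positivity
  have hq' : (0 : ℝ) < q := by exact_mod_cast hq
  refine ⟨Lm / (q * κ ^ (2 * q)), by positivity, ?_⟩
  intro γ L o ψ h bd p hp hpq x hx hd hloop
  have hL : Lm ≤ L := by
    have := h.le_period bd hσ
    rw [div_mul_eq_mul_div, le_div_iff₀ (by positivity)] at this
    rw [hLm, div_le_iff₀ (by positivity)]; linarith
  have hL0 := h.period_pos
  have hrefl : ∀ k, k + 1 < q → cosIn γ (x k) (x (k + 1)) = cosOut γ (x (k + 1)) (x (k + 2)) :=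
    fun k hk => (del_iff h.regular _ _ _).1 (hd k hk)
  have hlt : ∀ k < q, x k < x (k + 1) := fun k hk => by have := (hx k hk).1; linarith
  have hlt' : ∀ k < q, x (k + 1) < x k + L := fun k hk => by have := (hx k hk).2; linarith
  have hb := fun k (hk : k < q) => hcos γ L o ψ h bd (x k) (x (k + 1)) (hlt k hk) (hlt' k hk)
  have hp1 : (1 : ℝ) ≤ p := by exact_mod_cast hp
  have hpq1 : (p : ℝ) + 1 ≤ q := by exact_mod_cast hpq
  have hsum : ∑ k ∈ Finset.range q, (x (k + 1) - x k) = p * L := by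
    rw [Finset.sum_range_sub, hloop]; ring
  -- The common angle at a bounce point controls both adjacent gaps. The gaps add up to p L ≥ L, so
  -- none is small.
  have c1 := le_of_comparable (t := fun k => x (k + 1) - x k) (S := L) hκ1
    (fun k hk => sub_pos.2 (hlt k hk))
    (fun k hk => hcomp _ _ (sub_nonneg.2 (hlt k (by omega)).le) (sub_nonneg.2 (hlt (k + 1) hk).le) (by
      have h1 := (hb k (by omega)).2.1.2
      have h2 := (hb (k + 1) hk).1.1
      rw [hrefl k hk] at h1
      exact h2.trans h1))
    (fun k hk => hcomp _ _ (sub_nonneg.2 (hlt (k + 1) hk).le) (sub_nonneg.2 (hlt k (by omega)).le) (by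
      have h1 := (hb k (by omega)).2.1.1
      have h2 := (hb (k + 1) hk).1.2
      rw [hrefl k hk] at h1
      exact h1.trans h2)) (by rw [hsum]; nlinarith)
  have hsum' : ∑ k ∈ Finset.range q, (x k + L - x (k + 1)) = (q - p) * L := by
    have : ∀ k, x k + L - x (k + 1) = L - (x (k + 1) - x k) := fun k => by ring
    simp only [this, Finset.sum_sub_distrib, hsum]
    rw [Finset.sum_const, Finset.card_range, nsmul_eq_mul]; ring
  -- The same for the complementary gaps, whose sum is (q - p) L ≥ L.
  have c2 := le_of_comparable (t := fun k => x k + L - x (k + 1)) (S := L) hκ1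
    (fun k hk => sub_pos.2 (hlt' k hk))
    (fun k hk => hcomp _ _ (sub_nonneg.2 (hlt' k (by omega)).le) (sub_nonneg.2 (hlt' (k + 1) hk).le) (by
      have h1 := (hb k (by omega)).2.2.2.2
      have h2 := (hb (k + 1) hk).2.2.1.1
      rw [hrefl k hk] at h1
      exact h2.trans h1))
    (fun k hk => hcomp _ _ (sub_nonneg.2 (hlt' (k + 1) hk).le) (sub_nonneg.2 (hlt' k (by omega)).le) (by
      have h1 := (hb k (by omega)).2.2.2.1
      have h2 := (hb (k + 1) hk).2.2.1.2
      rw [hrefl k hk] at h1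
      exact h1.trans h2)) (by rw [hsum']; nlinarith)
  intro k hk
  have d1 := c1 k hk
  have d2 := c2 k hk
  have hκ0 : 0 < (q : ℝ) * κ ^ (2 * q) := by positivity
  have e1 : Lm / (q * κ ^ (2 * q)) ≤ x (k + 1) - x k := by
    rw [div_le_iff₀ hκ0]; linarith
  have e2 : Lm / (q * κ ^ (2 * q)) ≤ x k + L - x (k + 1) := by
    rw [div_le_iff₀ hκ0]; linarith
  exact ⟨e1, by linarith⟩

/-- Two curves are `ε`-close in the `C²` topology. -/
structure CurveClose (γ γ₁ : ℝ → Plane) (ε : ℝ) : Prop where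
  close₀ : ∀ t, ‖γ₁ t - γ t‖ ≤ ε
  close₁ : ∀ t, ‖deriv γ₁ t - deriv γ t‖ ≤ ε
  close₂ : ∀ t, ‖deriv (deriv γ₁) t - deriv (deriv γ) t‖ ≤ ε

/-! ### Uniform control of billiard jets away from the diagonal. -/

section JetBounds

lemma abs_mul_sub_mul_le {x y x' y' X Y α β : ℝ} (hx : |x| ≤ X) (hy : |y'| ≤ Y)
    (h1 : |x - x'| ≤ α) (h2 : |y - y'| ≤ β) : |x * y - x' * y'| ≤ X * β + Y * α := by
  have e : x * y - x' * y' = x * (y - y') + y' * (x - x') := by ring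
  rw [e]
  refine (abs_add_le _ _).trans ?_
  rw [abs_mul, abs_mul]
  have := abs_nonneg x
  have := abs_nonneg y'
  have := abs_nonneg (y - y')
  have := abs_nonneg (x - x')
  gcongr
  · linarith
  · linarith

lemma abs_inner_sub_inner_le {a a' e e' : Plane} {C D : ℝ} (ha : ‖a'‖ ≤ C) (he : ‖e‖ ≤ 1)
    (h1 : ‖a - a'‖ ≤ D) (h2 : ‖e - e'‖ ≤ D) :
    |inner ℝ a e - inner ℝ a' e'| ≤ (1 + C) * D := by
  have hC := (norm_nonneg _).trans ha
  have hD := (norm_nonneg _).trans h1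
  have e1 : inner ℝ a e - inner ℝ a' e' = inner ℝ (a - a') e + inner ℝ a' (e - e') := by
    rw [inner_sub_left, inner_sub_right]; ring
  rw [e1]
  refine (abs_add_le _ _).trans ?_
  have k1 : |inner ℝ (a - a') e| ≤ D * 1 := (abs_real_inner_le_norm _ _).trans (by gcongr)
  have k2 : |inner ℝ a' (e - e')| ≤ C * D := (abs_real_inner_le_norm _ _).trans (by gcongr)
  linarith

lemma abs_cr_sub_cr_le {a a' e e' : Plane} {C D : ℝ} (ha : ‖a'‖ ≤ C) (he : ‖e‖ ≤ 1)
    (h1 : ‖a - a'‖ ≤ D) (h2 : ‖e - e'‖ ≤ D) :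
    |cr a e - cr a' e'| ≤ (1 + C) * D := by
  have hC := (norm_nonneg _).trans ha
  have hD := (norm_nonneg _).trans h1
  have e1 : cr a e - cr a' e' = cr (a - a') e + cr a' (e - e') := by
    rw [sub_cr, cr_sub]; ring
  rw [e1]
  refine (abs_add_le _ _).trans ?_
  have k1 : |cr (a - a') e| ≤ D * 1 := (abs_cr_le _ _).trans (by gcongr)
  have k2 : |cr a' (e - e')| ≤ C * D := (abs_cr_le _ _).trans (by gcongr)
  linarith

lemma abs_cr_mul_cr_mul_le {a a' b b' e e' : Plane} {w w' C D W : ℝ} (ha : ‖a‖ ≤ C)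
    (ha' : ‖a'‖ ≤ C) (hb : ‖b‖ ≤ C) (hb' : ‖b'‖ ≤ C) (he : ‖e‖ ≤ 1) (he' : ‖e'‖ ≤ 1)
    (hw' : |w'| ≤ W) (h1 : ‖a - a'‖ ≤ D) (h2 : ‖b - b'‖ ≤ D) (h3 : ‖e - e'‖ ≤ D)
    (h4 : |w - w'| ≤ D) :
    |cr a e * cr b e * w - cr a' e' * cr b' e' * w'| ≤ (C ^ 2 + W * (2 * C * (1 + C))) * D := by
  have hC := (norm_nonneg _).trans ha
  have c1 : |cr a e| ≤ C := (abs_cr_le _ _).trans (by nlinarith [norm_nonneg a, norm_nonneg e])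
  have c2 : |cr b e| ≤ C := (abs_cr_le _ _).trans (by nlinarith [norm_nonneg b, norm_nonneg e])
  have c3 : |cr b' e'| ≤ C := (abs_cr_le _ _).trans (by nlinarith [norm_nonneg b', norm_nonneg e'])
  have k1 := abs_cr_sub_cr_le ha' he h1 h3
  have k2 := abs_cr_sub_cr_le hb' he h2 h3
  have k3 := abs_mul_sub_mul_le c1 c3 k1 k2
  have c4 : |cr a e * cr b e| ≤ C ^ 2 := by
    rw [abs_mul, sq]; gcongr
  refine (abs_mul_sub_mul_le c4 hw' k3 h4).trans (le_of_eq ?_)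
  ring

lemma norm_chordDir_le (γ : ℝ → Plane) (a b : ℝ) : ‖chordDir γ a b‖ ≤ 1 := by
  by_cases e : γ b = γ a
  · simp [chordDir, e]
  · exact (norm_chordDir e).le

/-- The jet of a billiard depends in a Lipschitz continuous way on the geometric data. -/
lemma billiardJet_sub_le {γ γ₁ : ℝ → Plane} {σ C k W D : ℝ} (b : CurveBounds γ σ C k)
    (b₁ : CurveBounds γ₁ σ C k) (hW : 0 ≤ W) {z z₁ : ℝ × ℝ}
    (hne : γ z.2 ≠ γ z.1) (hne₁ : γ₁ z₁.2 ≠ γ₁ z₁.1)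
    (w : chordInv γ z.1 z.2 ≤ W) (w₁ : chordInv γ₁ z₁.1 z₁.2 ≤ W)
    (hv : ‖(γ₁ z₁.2 - γ₁ z₁.1) - (γ z.2 - γ z.1)‖ ≤ D)
    (h1 : ‖deriv γ₁ z₁.1 - deriv γ z.1‖ ≤ D) (h2 : ‖deriv γ₁ z₁.2 - deriv γ z.2‖ ≤ D)
    (h11 : ‖deriv (deriv γ₁) z₁.1 - deriv (deriv γ) z.1‖ ≤ D)
    (h22 : ‖deriv (deriv γ₁) z₁.2 - deriv (deriv γ) z.2‖ ≤ D) :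
    let N := (1 + C + C ^ 2 + W * (2 * C * (1 + C))) * (1 + 2 * W + W ^ 2) * D
    |(billiardJet γ₁).h1 z₁ - (billiardJet γ).h1 z| ≤ N ∧
    |(billiardJet γ₁).h2 z₁ - (billiardJet γ).h2 z| ≤ N ∧
    |(billiardJet γ₁).h11 z₁ - (billiardJet γ).h11 z| ≤ N ∧
    |(billiardJet γ₁).h12 z₁ - (billiardJet γ).h12 z| ≤ N ∧
    |(billiardJet γ₁).h22 z₁ - (billiardJet γ).h22 z| ≤ N := by
  intro N
  have hC : 0 ≤ C := (norm_nonneg _).trans (b.deriv_le 0)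
  have hD : 0 ≤ D := (norm_nonneg _).trans hv
  -- Normalizing the chord costs a factor 2W, inverting its length a factor W²; D' dominates all
  -- differences.
  set D' := (1 + 2 * W + W ^ 2) * D with hD'
  have hDD : D ≤ D' := by rw [hD']; nlinarith [mul_nonneg hW hD, mul_nonneg (sq_nonneg W) hD]
  have v0 := norm_pos_iff.2 (sub_ne_zero.2 hne)
  have v1 := norm_pos_iff.2 (sub_ne_zero.2 hne₁)
  have he : ‖chordDir γ₁ z₁.1 z₁.2 - chordDir γ z.1 z.2‖ ≤ D' := by
    refine (norm_normalize_sub_le (sub_ne_zero.2 hne)).trans ?_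
    rw [div_eq_mul_inv]
    have : 2 * ‖(γ₁ z₁.2 - γ₁ z₁.1) - (γ z.2 - γ z.1)‖ * ‖γ z.2 - γ z.1‖⁻¹ ≤ 2 * D * W := by
      gcongr; exact w
    rw [hD']; nlinarith [mul_nonneg (sq_nonneg W) hD]
  have hw : |chordInv γ₁ z₁.1 z₁.2 - chordInv γ z.1 z.2| ≤ D' := by
    have : |chordInv γ₁ z₁.1 z₁.2 - chordInv γ z.1 z.2| ≤ D * (W * W) := by
      have w' : ‖γ z.2 - γ z.1‖⁻¹ ≤ W := w
      have w₁' : ‖γ₁ z₁.2 - γ₁ z₁.1‖⁻¹ ≤ W := w₁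
      rw [chordInv, chordInv, inv_sub_inv v1.ne' v0.ne', div_eq_mul_inv, abs_mul, abs_inv, abs_mul,
        abs_norm, abs_norm, mul_inv]
      gcongr
      refine (abs_norm_sub_norm_le _ _).trans ?_
      rw [norm_sub_rev]; exact hv
    rw [hD']; nlinarith [mul_nonneg hW hD]
  have hN : N = (1 + C) * D' + (C ^ 2 + W * (2 * C * (1 + C))) * D' := by
    simp only [N, hD']; ring
  have hA : 0 ≤ (1 + C) * D' := mul_nonneg (by linarith) (hD.trans hDD)
  have hB : 0 ≤ (C ^ 2 + W * (2 * C * (1 + C))) * D' := mul_nonneg (by positivity) (hD.trans hDD)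
  have hwa : |chordInv γ z.1 z.2| ≤ W :=
    (abs_of_nonneg (show 0 ≤ chordInv γ z.1 z.2 from inv_nonneg.2 (norm_nonneg _))).le.trans w
  have e1 := norm_chordDir_le γ z.1 z.2
  have e2 := norm_chordDir_le γ₁ z₁.1 z₁.2
  have i1 := abs_inner_sub_inner_le (b.deriv_le z.1) e2 (h1.trans hDD) he
  have i2 := abs_inner_sub_inner_le (b.deriv_le z.2) e2 (h2.trans hDD) he
  have i11 := abs_inner_sub_inner_le (b.deriv2_le z.1) e2 (h11.trans hDD) he
  have i22 := abs_inner_sub_inner_le (b.deriv2_le z.2) e2 (h22.trans hDD) he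
  have c11 := abs_cr_mul_cr_mul_le (b₁.deriv_le z₁.1) (b.deriv_le z.1) (b₁.deriv_le z₁.1)
    (b.deriv_le z.1) e2 e1 hwa (h1.trans hDD) (h1.trans hDD) he hw
  have c12 := abs_cr_mul_cr_mul_le (b₁.deriv_le z₁.1) (b.deriv_le z.1) (b₁.deriv_le z₁.2)
    (b.deriv_le z.2) e2 e1 hwa (h1.trans hDD) (h2.trans hDD) he hw
  have c22 := abs_cr_mul_cr_mul_le (b₁.deriv_le z₁.2) (b.deriv_le z.2) (b₁.deriv_le z₁.2)
    (b.deriv_le z.2) e2 e1 hwa (h2.trans hDD) (h2.trans hDD) he hw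
  rw [abs_le] at i1 i2 i11 i22 c11 c12 c22
  simp only [billiardJet, sq (cr _ _)]
  rw [hN]
  refine ⟨?_, ?_, ?_, ?_, ?_⟩ <;> rw [abs_le] <;> constructor <;>
    linarith [i1.1, i1.2, i2.1, i2.2, i11.1, i11.2, i22.1, i22.2, c11.1, c11.2, c12.1, c12.2,
      c22.1, c22.2]

/-- Uniform bounds for the jets of billiards, on the pairs of points that are not close to
each other. -/
lemma exists_jet_bounds {σ C k δ : ℝ} (hσ : 0 < σ) (hC : 0 < C) (hk : 0 < k) (hδ : 0 < δ) :
    ∃ M > 0, ∃ ρ > 0, ∃ N > 0, ∀ (γ : ℝ → Plane) (L o : ℝ) (ψ : ℝ → ℝ), IsOval γ L o ψ →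
      CurveBounds γ σ C k →
      (billiardJet γ).Bounded (Set.Icc δ (L - δ)) M ρ ∧
      ((∀ s t, ‖deriv (deriv γ) s - deriv (deriv γ) t‖ ≤ C * |s - t|) →
        (billiardJet γ).Lip (Set.Icc δ (L - δ)) N) ∧
      ∀ (γ₁ : ℝ → Plane) (o₁ : ℝ) (ψ₁ : ℝ → ℝ), IsOval γ₁ L o₁ ψ₁ → CurveBounds γ₁ σ C k →
        ∀ ε, CurveClose γ γ₁ ε →
          (billiardJet γ).Close (billiardJet γ₁) (Set.Icc δ (L - δ)) (N * ε) := by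
  obtain ⟨c, hc, hheight⟩ := exists_height_bound hσ hC hk
  have hpi := Real.pi_pos
  set W := C / (c * δ ^ 2) with hW
  have hW0 : 0 < W := by positivity
  set Λ := 2 * Real.pi * C ^ 2 / k with hΛ
  have hΛ0 : 0 < Λ := by positivity
  set N₀ := (1 + C + C ^ 2 + W * (2 * C * (1 + C))) * (1 + 2 * W + W ^ 2) with hN₀
  have hN0 : 0 < N₀ := by positivity
  have hgap : ∀ L a b : ℝ, b - a ∈ Set.Icc δ (L - δ) → b - a ∈ Set.Ioo 0 L := fun L a b h =>
    ⟨by linarith [h.1], by linarith [h.2]⟩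
  have hmin : ∀ (L a b : ℝ), b - a ∈ Set.Icc δ (L - δ) → δ ≤ min (b - a) (a + L - b) :=
    fun L a b h => le_min h.1 (by linarith [h.2])
  have hlow : ∀ (γ : ℝ → Plane) (L o : ℝ) (ψ : ℝ → ℝ), IsOval γ L o ψ → CurveBounds γ σ C k →
      ∀ a b, b - a ∈ Set.Icc δ (L - δ) → c * δ ^ 2 ≤ o * cr (deriv γ a) (γ b - γ a) := by
    intro γ L o ψ h bd a b hab
    have h1 := hmin L a b hab
    refine le_trans ?_ (hheight γ L o ψ h bd a b (by linarith [hab.1]) (by linarith [hab.2]))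
    gcongr
  have hinv : ∀ (γ : ℝ → Plane) (L o : ℝ) (ψ : ℝ → ℝ), IsOval γ L o ψ → CurveBounds γ σ C k →
      ∀ a b, b - a ∈ Set.Icc δ (L - δ) → chordInv γ a b ≤ W := by
    intro γ L o ψ h bd a b hab
    have h1 := hlow γ L o ψ h bd a b hab
    have h2 : c * δ ^ 2 ≤ C * ‖γ b - γ a‖ := by
      refine h1.trans ((le_abs_of_sign h.sign _).trans ((abs_cr_le _ _).trans ?_))
      have := bd.deriv_le a
      gcongr
    have hv := norm_pos_iff.2 (sub_ne_zero.2 (h.ne_of_gap (hgap L a b hab)))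
    rw [chordInv, hW, inv_le_comm₀ hv (by positivity), inv_div, div_le_iff₀ hC]
    linarith
  -- W bounds the inverse chord length, CΛ the chord length, and cδ² is the lower bound of both
  -- heights in h₁₂. The factor 2 + 2C covers both uses below, with D = 2C‖z - w‖ and with D = 2ε.
  refine ⟨C + C ^ 2 * W, by positivity, (c * δ ^ 2) ^ 2 / (C * Λ) ^ 3, by positivity,
    N₀ * (2 + 2 * C), by positivity, ?_⟩
  intro γ L o ψ h bd
  refine ⟨⟨fun z hz => ?_, fun z hz => ?_, fun z hz => ?_, fun z hz => ?_⟩, fun hlip => ?_, ?_⟩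
  · have e := norm_chordDir_le γ z.1 z.2
    have w := hinv γ L o ψ h bd z.1 z.2 hz
    have w0 : 0 ≤ chordInv γ z.1 z.2 := inv_nonneg.2 (norm_nonneg _)
    have k1 : |inner ℝ (deriv (deriv γ) z.1) (chordDir γ z.1 z.2)| ≤ C := by
      refine (abs_real_inner_le_norm _ _).trans ?_
      have := bd.deriv2_le z.1
      calc _ ≤ C * 1 := by gcongr
        _ = C := mul_one C
    have k2 : |cr (deriv γ z.1) (chordDir γ z.1 z.2)| ≤ C := by
      refine (abs_cr_le _ _).trans ?_
      have := bd.deriv_le z.1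
      calc _ ≤ C * 1 := by gcongr
        _ = C := mul_one C
    refine (abs_sub _ _).trans (add_le_add k1 ?_)
    rw [abs_mul, abs_pow, abs_of_nonneg w0]
    gcongr
  · have e := norm_chordDir_le γ z.1 z.2
    have w := hinv γ L o ψ h bd z.1 z.2 hz
    have w0 : 0 ≤ chordInv γ z.1 z.2 := inv_nonneg.2 (norm_nonneg _)
    have k2 : ∀ t, |cr (deriv γ t) (chordDir γ z.1 z.2)| ≤ C := fun t => by
      refine (abs_cr_le _ _).trans ?_
      have := bd.deriv_le t
      calc _ ≤ C * 1 := by gcongr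
        _ = C := mul_one C
    simp only [billiardJet]
    rw [abs_mul, abs_mul, abs_of_nonneg w0]
    calc _ ≤ C * C * W := by gcongr <;> exact k2 _
      _ ≤ _ := by nlinarith
  · have e := norm_chordDir_le γ z.1 z.2
    have w := hinv γ L o ψ h bd z.1 z.2 hz
    have w0 : 0 ≤ chordInv γ z.1 z.2 := inv_nonneg.2 (norm_nonneg _)
    have k1 : |-inner ℝ (deriv (deriv γ) z.2) (chordDir γ z.1 z.2)| ≤ C := by
      rw [abs_neg]
      refine (abs_real_inner_le_norm _ _).trans ?_
      have := bd.deriv2_le z.2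
      calc _ ≤ C * 1 := by gcongr
        _ = C := mul_one C
    have k2 : |cr (deriv γ z.2) (chordDir γ z.1 z.2)| ≤ C := by
      refine (abs_cr_le _ _).trans ?_
      have := bd.deriv_le z.2
      calc _ ≤ C * 1 := by gcongr
        _ = C := mul_one C
    refine (abs_sub _ _).trans (add_le_add k1 ?_)
    rw [abs_mul, abs_pow, abs_of_nonneg w0]
    gcongr
  · have k1 := hlow γ L o ψ h bd z.1 z.2 hz
    -- The height of the first point over the tangent at the second is obtained after moving the
    -- first point ahead by a period.
    have k2 := hlow γ L o ψ h bd z.2 (z.1 + L) (by constructor <;> linarith [hz.1, hz.2])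
    rw [h.periodic] at k2
    have hv := norm_pos_iff.2 (sub_ne_zero.2 (h.ne_of_gap (hgap L z.1 z.2 hz)))
    have e : (billiardJet γ).h12 z = -(chordInv γ z.1 z.2 ^ 3 *
        ((o * cr (deriv γ z.1) (γ z.2 - γ z.1)) * (o * cr (deriv γ z.2) (γ z.1 - γ z.2)))) := by
      simp only [billiardJet, cr, chordDir_apply, PiLp.sub_apply]
      rcases mul_self_eq_one_iff.1 h.sign with ho | ho <;> rw [ho] <;> ring
    have hvu : ‖γ z.2 - γ z.1‖ ≤ C * Λ := by
      have h1 : z.1 ≤ z.2 := by linarith [hz.1]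
      have h2 : z.2 - z.1 ≤ L := by linarith [hz.2]
      have h3 : L ≤ Λ := by
        have := h.period_le bd
        rw [hΛ, le_div_iff₀ hk]
        rw [div_mul_eq_mul_div, div_le_iff₀ (by positivity)] at this
        linarith
      exact (chord_le h.contDiff bd h1).trans (by gcongr; linarith)
    rw [e, neg_le_neg_iff, div_eq_inv_mul, ← inv_pow]
    have hi : (C * Λ)⁻¹ ≤ chordInv γ z.1 z.2 := by
      rw [chordInv]; gcongr
    rw [sq (c * δ ^ 2)]
    have p1 : 0 < c * δ ^ 2 := by positivity
    have p2 : 0 < (C * Λ)⁻¹ := by positivity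
    gcongr
    · exact pow_nonneg (p2.le.trans hi) 3
    · exact p1.le.trans k1
  · have key : ∀ z ∈ gapSet (Set.Icc δ (L - δ)), ∀ w ∈ gapSet (Set.Icc δ (L - δ)), _ :=
      fun z hz w hw => billiardJet_sub_le (D := (2 * C) * ‖z - w‖) bd bd hW0.le
        (h.ne_of_gap (hgap L w.1 w.2 hw)) (h.ne_of_gap (hgap L z.1 z.2 hz))
        (hinv γ L o ψ h bd w.1 w.2 hw) (hinv γ L o ψ h bd z.1 z.2 hz) (by
          have e : γ z.2 - γ z.1 - (γ w.2 - γ w.1) = (γ z.2 - γ w.2) - (γ z.1 - γ w.1) := by abel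
          have h1 : ∀ s t, ‖γ s - γ t‖ ≤ C * |s - t| := fun s t =>
            Convex.norm_image_sub_le_of_norm_deriv_le (f := γ) (s := Set.univ) (x := t) (y := s)
              (fun x _ => h.contDiff.differentiable two_ne_zero x) (fun x _ => bd.deriv_le x)
              convex_univ trivial trivial
          have n1 : |z.1 - w.1| ≤ ‖z - w‖ := norm_fst_le (z - w)
          have n2 : |z.2 - w.2| ≤ ‖z - w‖ := norm_snd_le (z - w)
          rw [e]
          calc _ ≤ ‖γ z.2 - γ w.2‖ + ‖γ z.1 - γ w.1‖ := norm_sub_le _ _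
            _ ≤ C * |z.2 - w.2| + C * |z.1 - w.1| := add_le_add (h1 _ _) (h1 _ _)
            _ ≤ C * ‖z - w‖ + C * ‖z - w‖ := by gcongr
            _ = _ := by ring)
        (by
          have n1 : |z.1 - w.1| ≤ ‖z - w‖ := norm_fst_le (z - w)
          refine (deriv_sub_le h.contDiff bd _ _).trans ?_
          gcongr; linarith)
        (by
          have n1 : |z.2 - w.2| ≤ ‖z - w‖ := norm_snd_le (z - w)
          refine (deriv_sub_le h.contDiff bd _ _).trans ?_
          gcongr; linarith)
        (by
          have n1 : |z.1 - w.1| ≤ ‖z - w‖ := norm_fst_le (z - w)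
          refine (hlip _ _).trans ?_
          gcongr; linarith)
        (by
          have n1 : |z.2 - w.2| ≤ ‖z - w‖ := norm_snd_le (z - w)
          refine (hlip _ _).trans ?_
          gcongr; linarith)
    have hle : ∀ z w : ℝ × ℝ, N₀ * ((2 * C) * ‖z - w‖) ≤ N₀ * (2 + 2 * C) * ‖z - w‖ :=
      fun z w => by
        rw [← mul_assoc]; gcongr; linarith
    exact ⟨fun z hz w hw => (key z hz w hw).2.2.1.trans (hle z w),
      fun z hz w hw => (key z hz w hw).2.2.2.1.trans (hle z w),
      fun z hz w hw => (key z hz w hw).2.2.2.2.trans (hle z w)⟩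
  · intro γ₁ o₁ ψ₁ h₁ bd₁ ε hε
    have hε0 : 0 ≤ ε := (norm_nonneg _).trans (hε.close₀ 0)
    have key : ∀ z ∈ gapSet (Set.Icc δ (L - δ)), _ :=
      fun z hz => billiardJet_sub_le (D := 2 * ε) bd bd₁ hW0.le
        (h.ne_of_gap (hgap L z.1 z.2 hz)) (h₁.ne_of_gap (hgap L z.1 z.2 hz))
        (hinv γ L o ψ h bd z.1 z.2 hz) (hinv γ₁ L o₁ ψ₁ h₁ bd₁ z.1 z.2 hz) (by
          have e : γ₁ z.2 - γ₁ z.1 - (γ z.2 - γ z.1) = (γ₁ z.2 - γ z.2) - (γ₁ z.1 - γ z.1) := by abel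
          rw [e]
          refine (norm_sub_le _ _).trans ?_
          have := hε.close₀ z.1
          have := hε.close₀ z.2
          linarith)
        ((hε.close₁ _).trans (by linarith)) ((hε.close₁ _).trans (by linarith))
        ((hε.close₂ _).trans (by linarith)) ((hε.close₂ _).trans (by linarith))
    have hle : N₀ * (2 * ε) ≤ N₀ * (2 + 2 * C) * ε := by
      rw [← mul_assoc]; gcongr; linarith
    exact ⟨fun z hz => (key z hz).1.trans hle, fun z hz => (key z hz).2.1.trans hle,
      fun z hz => (key z hz).2.2.1.trans hle, fun z hz => (key z hz).2.2.2.1.trans hle,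
      fun z hz => (key z hz).2.2.2.2.trans hle⟩

end JetBounds

/-! ## Directions seen from an interior point -/

/-- The angle of the direction in which the boundary point `γ b` is seen from `P`. -/
def visAngle (γ : ℝ → Plane) (o : ℝ) (ψ : ℝ → ℝ) (P : Plane) (b : ℝ) : ℝ :=
  ψ b - Real.pi / 2 +
    Real.arctan (inner ℝ (deriv γ b) (γ b - P) / (o * cr (deriv γ b) (P - γ b)))

section VisAngle

variable {γ : ℝ → Plane} {L o : ℝ} {ψ : ℝ → ℝ} {P : Plane}

lemma inner_ang {o : ℝ} (ho : o * o = 1) (a b : ℝ) :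
    inner ℝ (ang o a) (ang o b) = Real.cos (b - a) := by
  rw [inner_eq, Real.cos_sub]; simp only [ang_zero, ang_one]
  linear_combination Real.sin a * Real.sin b * ho

lemma eq_of_inner_eq_of_cr_eq {u v w : Plane} (hu : u ≠ 0) (h1 : inner ℝ u v = inner ℝ u w)
    (h2 : cr u v = cr u w) : v = w := by
  have h3 := cr_sq_add_inner_sq u (v - w)
  rw [cr_sub, inner_sub_right, h1, h2, sub_self, sub_self] at h3
  have : ‖u‖ ≠ 0 := norm_ne_zero_iff.2 hu
  have h4 : ‖v - w‖ = 0 := by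
    have : ‖u‖ ^ 2 * ‖v - w‖ ^ 2 = 0 := by linarith
    rcases mul_eq_zero.1 this with h | h
    · exact absurd (pow_eq_zero_iff two_ne_zero |>.1 h) ‹‖u‖ ≠ 0›
    · exact pow_eq_zero_iff two_ne_zero |>.1 h
  exact sub_eq_zero.1 (norm_eq_zero.1 h4)

lemma visAngle_mem (P : Plane) (b : ℝ) : visAngle γ o ψ P b ∈ Set.Ioo (ψ b - Real.pi) (ψ b) := by
  have h1 := Real.arctan_lt_pi_div_two
    (inner ℝ (deriv γ b) (γ b - P) / (o * cr (deriv γ b) (P - γ b)))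
  have h2 := Real.neg_pi_div_two_lt_arctan
    (inner ℝ (deriv γ b) (γ b - P) / (o * cr (deriv γ b) (P - γ b)))
  constructor <;> simp only [visAngle] <;> linarith

namespace IsOval

lemma visAngle_add_period (h : IsOval γ L o ψ) (P : Plane) (b : ℝ) :
    visAngle γ o ψ P (b + L) = visAngle γ o ψ P b + 2 * Real.pi := by
  simp only [visAngle, h.turn, h.periodic b, periodic_deriv h.periodic b]; ring

/-- Confirms that the arctangent formula gives the true direction: since P is off the tangent line,
the direction is determined by a cotangent relative to that line. -/
lemma exists_eq_smul_ang (h : IsOval γ L o ψ) {b : ℝ} (hP : 0 < o * cr (deriv γ b) (P - γ b)) :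
    ∃ r : ℝ, 0 < r ∧ γ b - P = r • ang o (visAngle γ o ψ P b) := by
  set x := inner ℝ (deriv γ b) (γ b - P) with hx
  set y := o * cr (deriv γ b) (P - γ b) with hy
  have hn := h.norm_pos b
  have hs : 0 < Real.sqrt (1 + (x / y) ^ 2) := Real.sqrt_pos.2 (by positivity)
  refine ⟨‖deriv γ b‖⁻¹ * y * Real.sqrt (1 + (x / y) ^ 2), by positivity, ?_⟩
  have e := h.deriv_eq b
  have c1 : Real.cos (visAngle γ o ψ P b - ψ b) = x / y / Real.sqrt (1 + (x / y) ^ 2) := by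
    rw [← Real.sin_arctan, visAngle, ← hx, ← hy, ← Real.cos_sub_pi_div_two]; congr 1; ring
  have c2 : Real.sin (visAngle γ o ψ P b - ψ b) = -(1 / Real.sqrt (1 + (x / y) ^ 2)) := by
    rw [← Real.cos_arctan, visAngle, ← hx, ← hy, ← Real.sin_sub_pi_div_two]; congr 1; ring
  refine eq_of_inner_eq_of_cr_eq (h.regular b) ?_ ?_
  · rw [← hx, inner_smul_right]
    have i1 : ∀ w, inner ℝ (deriv γ b) w = ‖deriv γ b‖ * inner ℝ (ang o (ψ b)) w := fun w => by
      rw [← real_inner_smul_left, ← e]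
    rw [i1, inner_ang h.sign, c1]
    field_simp
  · have h1 : cr (deriv γ b) (γ b - P) = -(o * y) := by
      rw [hy, ← mul_assoc, h.sign, cr_sub, cr_sub]; ring
    rw [h1, cr_smul]
    have i1 : ∀ w, cr (deriv γ b) w = ‖deriv γ b‖ * cr (ang o (ψ b)) w := fun w => by
      rw [← smul_cr, ← e]
    rw [i1, cr_ang, c2]
    field_simp

/-- Of two boundary points on one ray from P, the farther would lie beyond the tangent at the
nearer. So the points coincide, the parameters differ by n periods, and the angle gain 2πn forces n
= 0. -/
lemma visAngle_injective (h : IsOval γ L o ψ) (hP : P ∈ ovalInterior γ o) :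
    Function.Injective (visAngle γ o ψ P) := by
  intro b₁ b₂ hb
  obtain ⟨r₁, hr₁, e₁⟩ := h.exists_eq_smul_ang (hP b₁)
  obtain ⟨r₂, hr₂, e₂⟩ := h.exists_eq_smul_ang (hP b₂)
  rw [← hb] at e₂
  have key : ∀ {a b : ℝ} {r s : ℝ}, 0 < r →
      γ a - P = r • ang o (visAngle γ o ψ P b₁) →
      γ b - P = s • ang o (visAngle γ o ψ P b₁) → s ≤ r := by
    intro a b r s hr ea eb
    have h1 := hP a
    have h2 := h.height_nonneg a b
    have h3 : γ b - γ a = ((r - s) / r) • (P - γ a) := by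
      have : γ b - γ a = (γ b - P) - (γ a - P) := by abel
      rw [this, ← neg_sub (γ a) P, eb, ea, smul_neg, smul_smul, ← sub_smul, ← neg_smul]
      congr 1; field_simp; ring
    rw [h3, cr_smul, mul_left_comm] at h2
    have h4 := nonneg_of_mul_nonneg_left h2 h1
    rw [le_div_iff₀ hr] at h4
    linarith
  have hr : r₁ = r₂ := le_antisymm (key hr₂ e₂ e₁) (key hr₁ e₁ e₂)
  rw [← hr, ← e₁, sub_left_inj] at e₂
  have hL := h.period_pos
  set n := ⌊(b₂ - b₁) / L⌋ with hn
  have f1 : (n : ℝ) * L ≤ b₂ - b₁ := (le_div_iff₀ hL).1 (Int.floor_le _)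
  have f2 : b₂ - b₁ < (n + 1) * L := (div_lt_iff₀ hL).1 (Int.lt_floor_add_one _)
  have hb₂ : b₂ = b₁ + n * L := by
    by_contra hne
    refine h.ne_of_gap (a := b₁) (b := b₂ - n * L) ⟨?_, by linarith⟩
      (by rw [h.periodic.sub_int_mul_eq, e₂])
    rcases f1.lt_or_eq with f | f
    · linarith
    · exact absurd (by linarith) hne
  have hper : Function.Periodic (fun t => visAngle γ o ψ P t - 2 * Real.pi / L * t) L :=
    fun t => by
      simp only [h.visAngle_add_period]; field_simp; ring
  have h5 := hper.int_mul n b₁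
  simp only [← hb₂] at h5
  rw [← hb, sub_right_inj] at h5
  have : 2 * Real.pi / L ≠ 0 := by have := Real.pi_pos; positivity
  exact (mul_left_cancel₀ this h5).symm

lemma continuous_visAngle (h : IsOval γ L o ψ) {X : Type*} [TopologicalSpace X] {P : X → Plane}
    {b : X → ℝ} (hP : ∀ x, P x ∈ ovalInterior γ o) (hc : Continuous P) (hb : Continuous b) :
    Continuous fun x => visAngle γ o ψ (P x) (b x) := by
  have h1 : Continuous (deriv γ) := (contDiff_deriv h.contDiff).continuous
  have h2 : Continuous fun x => γ (b x) := h.contDiff.continuous.comp hb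
  have h3 : Continuous fun x => deriv γ (b x) := h1.comp hb
  refine ((h.continuous_angle.comp hb).sub continuous_const).add
    (Real.continuous_arctan.comp ((h3.inner (h2.sub hc)).div
      (continuous_const.mul (continuous_cr h3 (hc.sub h2))) fun x => (hP x (b x)).ne'))

lemma strictMono_visAngle (h : IsOval γ L o ψ) (hP : P ∈ ovalInterior γ o) :
    StrictMono (visAngle γ o ψ P) := by
  have hc : Continuous (visAngle γ o ψ P) :=
    h.continuous_visAngle (P := fun _ => P) (fun _ => hP) continuous_const continuous_id
  refine (hc.strictMono_of_inj (h.visAngle_injective hP)).resolve_right fun ha => ?_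
  have := ha (show (0 : ℝ) < 0 + L by linarith [h.period_pos])
  rw [h.visAngle_add_period] at this
  linarith [Real.pi_pos]

lemma surjective_visAngle (h : IsOval γ L o ψ) (hP : P ∈ ovalInterior γ o) :
    Function.Surjective (visAngle γ o ψ P) := by
  have hc : Continuous (visAngle γ o ψ P) :=
    h.continuous_visAngle (P := fun _ => P) (fun _ => hP) continuous_const continuous_id
  have hL := h.period_pos
  have ht := tendsto_of_add_period (f := fun t => visAngle γ o ψ P (L * t))
    (hc.comp (continuous_const.mul continuous_id)) (m := 2 * Real.pi) (by linarith [Real.pi_pos])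
    fun t => by rw [mul_add, mul_one, h.visAngle_add_period]
  intro θ
  obtain ⟨t, ht⟩ := (hc.comp (continuous_const.mul continuous_id)).surjective ht.1 ht.2 θ
  exact ⟨L * t, ht⟩

/-- The end point of a ray that moves continuously depends continuously on the ray. -/
lemma exists_continuous_visAngle_eq (h : IsOval γ L o ψ) {P : ℝ → Plane} {θ : ℝ → ℝ}
    (hP : ∀ t, P t ∈ ovalInterior γ o) (hc : Continuous P) (hθ : Continuous θ) :
    ∃ b : ℝ → ℝ, Continuous b ∧ ∀ t, visAngle γ o ψ (P t) (b t) = θ t := by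
  choose b hb using fun t => h.surjective_visAngle (hP t) (θ t)
  refine ⟨b, continuous_iff_continuousAt.2 fun t₀ => ?_, hb⟩
  refine Metric.continuousAt_iff'.2 fun ε hε => ?_
  have c1 : ∀ y, Continuous fun t => visAngle γ o ψ (P t) y := fun y =>
    h.continuous_visAngle hP hc continuous_const
  have l1 : θ t₀ < visAngle γ o ψ (P t₀) (b t₀ + ε) :=
    hb t₀ ▸ h.strictMono_visAngle (hP t₀) (by linarith)
  have l2 : visAngle γ o ψ (P t₀) (b t₀ - ε) < θ t₀ :=
    hb t₀ ▸ h.strictMono_visAngle (hP t₀) (by linarith)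
  filter_upwards [hθ.continuousAt.eventually_lt (c1 _).continuousAt l1,
    (c1 _).continuousAt.eventually_lt hθ.continuousAt l2] with t h1 h2
  rw [← hb t] at h1 h2
  have h1' := (h.strictMono_visAngle (hP t)).lt_iff_lt.1 h1
  have h2' := (h.strictMono_visAngle (hP t)).lt_iff_lt.1 h2
  rw [Real.dist_eq, abs_lt]
  constructor <;> linarith

lemma unitVec_eq_ang (ho : o * o = 1) (α : ℝ) : unitVec α = ang o (o * α) := by
  rcases mul_self_eq_one_iff.1 ho with rfl | rfl
  · simp [unitVec, ang]
  · simp [unitVec, ang]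

lemma ang_sub_pi (o θ : ℝ) : ang o (θ - Real.pi) = -ang o θ := by
  ext i; fin_cases i <;> simp [ang]

/-- The chords that are tangent to a closed curve inside the table, as a continuous family of pairs
of lifted parameters. -/
lemma exists_tangent_family (h : IsOval γ L o ψ) {c : ℝ → Plane} {α : ℝ → ℝ}
    (hc : IsClosedCurveWithTangents c α) (hP : ∀ t, c t ∈ ovalInterior γ o) :
    ∃ a b : ℝ → ℝ, Continuous a ∧ Continuous b ∧ (∀ t, a t < b t ∧ b t < a t + L) ∧
      (∀ t, IsTangentChord γ c α (a t) (b t)) ∧ Tendsto a atTop atTop ∧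
      Tendsto a atBot atBot := by
  obtain ⟨k, hk, hα⟩ := hc.turning
  have hcc := hc.contDiff.continuous
  -- The curve is reversed if necessary, so that its tangent angle, measured in the orientation of
  -- γ, tends to +∞.
  obtain ⟨τ, hτc, hτt, hτb⟩ : ∃ τ : ℝ → ℝ, Continuous τ ∧
      Tendsto (fun t => o * α (τ t)) atTop atTop ∧ Tendsto (fun t => o * α (τ t)) atBot atBot := by
    have hne : o * k * Real.pi ≠ 0 := by
      have := ne_zero_of_sign h.sign
      have := Real.pi_ne_zero
      positivity
    rcases hne.lt_or_gt with hs | hs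
    · refine ⟨fun t => -t, continuous_neg, tendsto_of_add_period (m := -(o * k * Real.pi))
        (continuous_const.mul (hc.continuous_angle.comp continuous_neg)) (by linarith) fun t => ?_⟩
      have := hα (-(t + 1))
      rw [show -(t + 1) + 1 = -t by ring] at this
      rw [this]; ring
    · exact ⟨id, continuous_id, tendsto_of_add_period (m := o * k * Real.pi)
        (continuous_const.mul hc.continuous_angle) hs fun t => by simp only [id, hα]; ring⟩
  have hθ : Continuous fun t => o * α (τ t) :=
    continuous_const.mul (hc.continuous_angle.comp hτc)
  -- The two ends of the tangent chord are seen from the point of tangency in opposite directions, θ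
  -- - π and θ. As a + L is seen at θ + π, this gives a < b < a + L.
  obtain ⟨a, hac, ha⟩ := h.exists_continuous_visAngle_eq (P := fun t => c (τ t))
    (θ := fun t => o * α (τ t) - Real.pi) (fun t => hP _) (hcc.comp hτc) (hθ.sub continuous_const)
  obtain ⟨b, hbc, hb⟩ := h.exists_continuous_visAngle_eq (P := fun t => c (τ t))
    (θ := fun t => o * α (τ t)) (fun t => hP _) (hcc.comp hτc) hθ
  have hpi := Real.pi_pos
  -- The tangent angle at a is within π of θ, so a tends to infinity together with θ.
  have hbd : ∀ t, ψ (a t) ∈ Set.Ioo (o * α (τ t) - Real.pi) (o * α (τ t)) := fun t => by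
    have := visAngle_mem (γ := γ) (o := o) (ψ := ψ) (c (τ t)) (a t)
    rw [ha] at this
    constructor <;> linarith [this.1, this.2]
  refine ⟨a, b, hac, hbc, fun t => ⟨?_, ?_⟩, fun t => ?_, ?_, ?_⟩
  · rw [← (h.strictMono_visAngle (hP (τ t))).lt_iff_lt, ha, hb]; linarith
  · rw [← (h.strictMono_visAngle (hP (τ t))).lt_iff_lt, h.visAngle_add_period, ha, hb]; linarith
  · obtain ⟨r, hr, e⟩ := h.exists_eq_smul_ang (hP (τ t) (a t))
    obtain ⟨s, hs, e'⟩ := h.exists_eq_smul_ang (hP (τ t) (b t))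
    rw [ha, ang_sub_pi] at e
    rw [hb] at e'
    have e1 : γ (b t) - γ (a t) = (r + s) • ang o (o * α (τ t)) := by
      have : γ (b t) - γ (a t) = (γ (b t) - c (τ t)) - (γ (a t) - c (τ t)) := by abel
      rw [this, e, e']; module
    refine ⟨τ t, ⟨r / (r + s), ?_⟩, r + s, by rw [e1, unitVec_eq_ang h.sign]⟩
    rw [e1, smul_smul, div_mul_cancel₀ _ (by positivity), ← sub_eq_iff_eq_add', ← neg_sub, e]
    module
  · refine tendsto_atTop.2 fun R => ?_
    filter_upwards [hτt.eventually_ge_atTop (ψ R + Real.pi)] with t ht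
    exact h.strictMono.le_iff_le.1 (by linarith [(hbd t).1])
  · refine tendsto_atBot.2 fun R => ?_
    filter_upwards [hτb.eventually_le_atBot (ψ R)] with t ht
    exact h.strictMono.le_iff_le.1 (by linarith [(hbd t).2])

end IsOval
end VisAngle

/-! ## Existence of billiard orbits -/

section Orbits

variable {γ : ℝ → Plane} {L o σ C k : ℝ} {ψ : ℝ → ℝ}

namespace IsOval

lemma continuousOn_cosOut (h : IsOval γ L o ψ) (y : ℝ) :
    ContinuousOn (fun z => cosOut γ y z) (Set.Ioo y (y + L)) := fun z hz => by
  have : ContinuousAt (fun z : ℝ × ℝ => chordDir γ z.1 z.2) (y, z) :=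
    continuousAt_chordDir h.contDiff.continuous
      (h.ne_of_gap ⟨by linarith [hz.1], by linarith [hz.2]⟩)
  have h2 : ContinuousAt (fun z => chordDir γ y z) z :=
    ContinuousAt.comp (f := fun z => (y, z)) this (by fun_prop)
  exact (continuousAt_const.inner h2).continuousWithinAt

lemma cosOut_injOn (h : IsOval γ L o ψ) (y : ℝ) : Set.InjOn (cosOut γ y) (Set.Ioo y (y + L)) :=
  StrictAntiOn.injOn fun _ hz _ hz' hlt => h.cosOut_lt hz.1 hlt hz'.2

lemma cosOut_mem (h : IsOval γ L o ψ) (hb : CurveBounds γ σ C k) (hσ : 0 < σ) (hC : 0 < C)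
    (hk : 0 < k) {a b : ℝ} (h1 : a < b) (h2 : b < a + L) : cosOut γ a b ∈ Set.Ioo (-1 : ℝ) 1 := by
  obtain ⟨c, hc, K, hK, hcos⟩ := exists_cos_bounds hσ hC hk
  obtain ⟨⟨e1, -⟩, -, ⟨e2, -⟩, -⟩ := hcos γ L o ψ h hb a b h1 h2
  have i1 : 0 < c * (b - a) ^ 2 := mul_pos hc (pow_pos (by linarith) 2)
  have i2 : 0 < c * (a + L - b) ^ 2 := mul_pos hc (pow_pos (by linarith) 2)
  constructor <;> linarith

lemma cosIn_mem (h : IsOval γ L o ψ) (hb : CurveBounds γ σ C k) (hσ : 0 < σ) (hC : 0 < C)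
    (hk : 0 < k) {a b : ℝ} (h1 : a < b) (h2 : b < a + L) : cosIn γ a b ∈ Set.Ioo (-1 : ℝ) 1 := by
  have := h.cosOut_mem hb hσ hC hk (a := b) (b := a + L) h2 (by linarith)
  rw [cosOut_add_period h.periodic] at this
  constructor <;> linarith [this.1, this.2]

/-- As z runs from y to y + L the outgoing cosine runs continuously from near 1 to near -1. -/
lemma exists_cosOut_eq (h : IsOval γ L o ψ) (hb : CurveBounds γ σ C k) (hσ : 0 < σ) (hC : 0 < C)
    (hk : 0 < k) {v : ℝ} (hv : v ∈ Set.Ioo (-1 : ℝ) 1) (y : ℝ) :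
    ∃ z ∈ Set.Ioo y (y + L), cosOut γ y z = v := by
  obtain ⟨c, hc, K, hK, hcos⟩ := exists_cos_bounds hσ hC hk
  have hL := h.period_pos
  have small : ∀ m : ℝ, 0 < m → ∃ t, 0 < t ∧ t < L ∧ K * t ^ 2 < m := fun m hm => by
    have h1 : Tendsto (fun t : ℝ => K * t ^ 2) (𝓝[>] 0) (𝓝 0) := by
      have : Continuous fun t : ℝ => K * t ^ 2 := by fun_prop
      simpa using (this.tendsto 0).mono_left nhdsWithin_le_nhds
    obtain ⟨t, h2, h3⟩ := ((h1.eventually_lt_const hm).and (Ioo_mem_nhdsGT hL)).exists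
    exact ⟨t, h3.1, h3.2, h2⟩
  obtain ⟨t, t0, tL, ht⟩ := small (1 - v) (by linarith [hv.2])
  obtain ⟨u, u0, uL, hu⟩ := small (1 + v) (by linarith [hv.1])
  have h1 := (hcos γ L o ψ h hb y (y + t) (by linarith) (by linarith)).1.2
  have h2 := (hcos γ L o ψ h hb y (y + L - u) (by linarith) (by linarith)).2.2.1.2
  rw [show y + t - y = t by ring] at h1
  rw [show y + L - (y + L - u) = u by ring] at h2
  have m1 : y + t ∈ Set.Ioo y (y + L) := ⟨by linarith, by linarith⟩
  have m2 : y + L - u ∈ Set.Ioo y (y + L) := ⟨by linarith, by linarith⟩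
  have hle : Set.uIcc (y + t) (y + L - u) ⊆ Set.Ioo y (y + L) :=
    Set.OrdConnected.uIcc_subset Set.ordConnected_Ioo m1 m2
  obtain ⟨z, hz, e⟩ := intermediate_value_uIcc ((h.continuousOn_cosOut y).mono hle)
    (show v ∈ Set.uIcc (cosOut γ y (y + t)) (cosOut γ y (y + L - u)) from
      Set.mem_uIcc.2 (Or.inr ⟨by linarith, by linarith⟩))
  exact ⟨z, hle hz, e⟩

/-- Every chord is part of a billiard orbit. -/
lemma exists_orbit (h : IsOval γ L o ψ) (hb : CurveBounds γ σ C k) (hσ : 0 < σ) (hC : 0 < C)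
    (hk : 0 < k) {x y : ℝ} (hxy : x < y) (hyx : y < x + L) :
    ∃ s : ℤ → ℝ, IsBilliardOrbit γ L s ∧ s 0 = x ∧ s 1 = y := by
  -- The map from a directed chord to the next one is a permutation of S; its integer powers give
  -- the two-sided orbit.
  let S := {z : ℝ × ℝ // z.1 < z.2 ∧ z.2 < z.1 + L}
  have ex : ∀ z : S, ∃ w : S, w.1.1 = z.1.2 ∧ cosIn γ z.1.1 z.1.2 = cosOut γ w.1.1 w.1.2 := by
    rintro ⟨⟨x, y⟩, h1, h2⟩
    obtain ⟨z, hz, e⟩ := h.exists_cosOut_eq hb hσ hC hk (h.cosIn_mem hb hσ hC hk h1 h2) y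
    exact ⟨⟨(y, z), hz.1, hz.2⟩, rfl, e.symm⟩
  choose T hT hT' using ex
  have hbij : Function.Bijective T := by
    constructor
    · rintro ⟨⟨x, y⟩, h1, h2⟩ ⟨⟨x', y'⟩, h1', h2'⟩ e
      have e1 := hT ⟨⟨x, y⟩, h1, h2⟩
      have e2 := hT' ⟨⟨x, y⟩, h1, h2⟩
      rw [e, ← hT' ⟨⟨x', y'⟩, h1', h2'⟩] at e2
      rw [e, hT ⟨⟨x', y'⟩, h1', h2'⟩] at e1
      simp only at e1 e2 h1 h2 h1' h2'
      subst e1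
      have := h.cosOut_injOn y' (x₁ := x + L) (x₂ := x' + L) ⟨by linarith, by linarith⟩
        ⟨by linarith, by linarith⟩
        (by rw [cosOut_add_period h.periodic, cosOut_add_period h.periodic, e2])
      obtain rfl : x = x' := by linarith
      rfl
    · rintro ⟨⟨y, z⟩, h1, h2⟩
      simp only at h1 h2
      have hv := h.cosOut_mem hb hσ hC hk h1 h2
      -- The preceding chord is found by reflecting the reversed chord; its end w becomes the
      -- previous point w - L.
      obtain ⟨w, hw, e⟩ := h.exists_cosOut_eq hb hσ hC hk (v := -cosOut γ y z)
        ⟨by linarith [hv.2], by linarith [hv.1]⟩ y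
      have p : w - L < y ∧ y < w - L + L := ⟨by linarith [hw.2], by linarith [hw.1]⟩
      refine ⟨⟨(w - L, y), p⟩, ?_⟩
      have e1 := hT ⟨(w - L, y), p⟩
      have e2 := hT' ⟨(w - L, y), p⟩
      have b := (T ⟨(w - L, y), p⟩).2
      simp only at e1 e2
      have e3 := cosOut_add_period h.periodic (w - L) y
      rw [sub_add_cancel, e, neg_inj] at e3
      rw [← e3, e1] at e2
      rw [e1] at b
      exact Subtype.ext (Prod.ext e1 (h.cosOut_injOn y ⟨b.1, b.2⟩ ⟨h1, h2⟩ e2.symm))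
  let E : Equiv.Perm S := Equiv.ofBijective T hbij
  let z₀ : S := ⟨(x, y), hxy, hyx⟩
  have hs : ∀ k : ℤ, (E ^ (k + 1)) z₀ = T ((E ^ k) z₀) := fun k => by
    rw [add_comm, zpow_one_add]; rfl
  have h1 : ∀ k : ℤ, ((E ^ (k + 1)) z₀).1.1 = ((E ^ k) z₀).1.2 := fun k => by rw [hs, hT]
  refine ⟨fun k => ((E ^ k) z₀).1.1, ⟨fun k => ?_, fun k => ?_, fun k => ?_⟩, rfl, ?_⟩
  · rw [h1]; exact ((E ^ k) z₀).2.1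
  · rw [h1]; exact ((E ^ k) z₀).2.2
  · have h2 := h1 (k + 1)
    rw [show k + 1 + 1 = k + 2 by ring] at h2
    simp only [h2]
    rw [h1, hT', hs, hT]
  · exact h1 0

end IsOval

lemma cosOut_add_int_mul (hp : Function.Periodic γ L) (a b : ℝ) (n : ℤ) :
    cosOut γ (a + n * L) (b + n * L) = cosOut γ a b := by
  simp only [cosOut, unitTangent, chordDir, hp.int_mul n a, hp.int_mul n b,
    (periodic_deriv hp).int_mul n a]

lemma cosIn_add_int_mul (hp : Function.Periodic γ L) (a b : ℝ) (n : ℤ) :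
    cosIn γ (a + n * L) (b + n * L) = cosIn γ a b := by
  simp only [cosIn, unitTangent, chordDir, hp.int_mul n a, hp.int_mul n b,
    (periodic_deriv hp).int_mul n b]

namespace IsBilliardOrbit

variable {s : ℤ → ℝ}

/-- The same orbit, run through in the opposite direction. -/
lemma reverse (h : IsBilliardOrbit γ L s) (hp : Function.Periodic γ L) :
    IsBilliardOrbit γ L fun n => s (1 - n) + n * L where
  lt n := by
    have := h.lt_add (-n)
    rw [show -n + 1 = 1 - n by ring] at this
    rw [show 1 - (n + 1) = -n by ring]; push_cast; linarith
  lt_add n := by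
    have := h.lt (-n)
    rw [show -n + 1 = 1 - n by ring] at this
    rw [show 1 - (n + 1) = -n by ring]; push_cast; linarith
  reflection n := by
    have := h.reflection (-n - 1)
    rw [show -n - 1 + 1 = -n by ring, show -n - 1 + 2 = 1 - n by ring] at this
    rw [show 1 - (n + 1) = -n by ring, show 1 - (n + 2) = -n - 1 by ring]
    have e1 : s (-n) + ((n + 1 : ℤ) : ℝ) * L = (s (-n) + L) + n * L := by push_cast; ring
    have e2 : s (-n - 1) + ((n + 2 : ℤ) : ℝ) * L = (s (-n - 1) + L) + (n + 1 : ℤ) * L := by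
      push_cast; ring
    rw [e2, cosOut_add_int_mul hp, e1, cosIn_add_int_mul hp, cosIn_add_period hp,
      cosOut_add_period hp, this]

lemma isPeriodicSeq (h : IsBilliardOrbit γ L s) (hr : ∀ t, deriv γ t ≠ 0) {q : ℕ} {P : ℝ}
    (hP : ∀ k, s (k + q) = s k + P) :
    IsPeriodicSeq (billiardJet γ) (Set.Ioo 0 L) q P fun n => s n where
  gap n := by
    have h1 := h.lt n
    have h2 := h.lt_add n
    simp only [gapSet, Set.mem_ofPred_eq, Set.mem_Ioo, Nat.cast_add, Nat.cast_one]
    constructor <;> linarith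
  del n := by
    rw [del_iff hr]; exact_mod_cast h.reflection n
  periodic n := by rw [← hP]; simp

/-- Each point solves an equation in the two preceding ones and depends continuously on them. -/
lemma continuous_family (h : IsOval γ L o ψ) {s : ℝ → ℤ → ℝ}
    (hs : ∀ t, IsBilliardOrbit γ L (s t)) (h0 : Continuous fun t => s t 0)
    (h1 : Continuous fun t => s t 1) (n : ℕ) : Continuous fun t => s t n := by
  have key : ∀ n : ℕ, (Continuous fun t => s t n) ∧ Continuous fun t => s t (n + 1) := by
    intro n
    induction n with
    | zero => exact ⟨h0, by simpa using h1⟩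
    | succ n ih =>
      push_cast
      refine ⟨ih.2, continuous_iff_continuousAt.2 fun t₀ => ?_⟩
      have hg : ∀ (t : ℝ) (k : ℤ), (s t k, s t (k + 1)) ∈ gapSet (Set.Ioo 0 L) := fun t k =>
        ⟨by linarith [(hs t).lt k], by linarith [(hs t).lt_add k]⟩
      have hd := (h.isTwist.hasDeriv₂ _ (hg t₀ n)).continuousAt
      refine h.isTwist.continuousAt_of_h1 (u := fun t => s t (n + 1))
        (v := fun t => -(billiardJet γ).h2 (s t n, s t (n + 1))) ih.2.continuousAt
        (ContinuousAt.neg (ContinuousAt.comp (f := fun t => (s t n, s t (n + 1))) hd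
          (ih.1.continuousAt.prodMk ih.2.continuousAt))) (Eventually.of_forall fun t => ?_)
      refine ⟨hg t _, ?_⟩
      have := (del_iff h.regular _ _ _).2 ((hs t).reflection n)
      rw [show (n : ℤ) + 1 + 1 = n + 2 by ring]
      linarith
  exact (key n).1

lemma le_nat (h : IsBilliardOrbit γ L s) (n : ℕ) : s 0 ≤ s n := by
  induction n with
  | zero => simp
  | succ n ih => exact ih.trans (by exact_mod_cast (h.lt n).le)

lemma nat_le (h : IsBilliardOrbit γ L s) (n : ℕ) : s n ≤ s 0 + n * L := by
  induction n with
  | zero => simp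
  | succ n ih =>
    have := h.lt_add n
    push_cast
    linarith

lemma exists_graph_map (h : IsOval γ L o ψ) {s : ℝ → ℤ → ℝ} {q : ℕ} {P : ℝ} (hq : 1 ≤ q)
    (hs : ∀ t, IsBilliardOrbit γ L (s t)) (hP : ∀ t k, s t (k + q) = s t k + P)
    (hc : ∀ n : ℕ, Continuous fun t => s t n) (htop : Tendsto (fun t => s t 0) atTop atTop)
    (hbot : Tendsto (fun t => s t 0) atBot atBot) :
    ∃ φ : ℝ → ℝ, StrictMono φ ∧ Function.Surjective φ ∧ (∀ x, φ^[q] x = x + P) ∧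
      ∀ x, IsPeriodicSeq (billiardJet γ) (Set.Ioo 0 L) q P fun k => φ^[k] x := by
  refine LoopOrbits.exists_graph_map (x := fun t n => s t n) h.isTwist hq
    (fun t => (hs t).isPeriodicSeq h.regular (hP t)) hc
    (fun n => tendsto_atTop_mono (fun t => (hs t).le_nat n) htop)
    (fun n => tendsto_atBot_mono (fun t => (hs t).nat_le n)
      (tendsto_atBot_add_const_right _ _ hbot))

end IsBilliardOrbit

lemma constant_of_two_values {f : ℝ → ℝ} (hf : Continuous f) {u v : ℝ}
    (h : ∀ t, f t = u ∨ f t = v) : (∀ t, f t = u) ∨ ∀ t, f t = v := by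
  by_contra! hne
  obtain ⟨⟨t, ht⟩, ⟨t', ht'⟩⟩ := hne
  have e1 := (h t).resolve_left ht
  have e2 := (h t').resolve_right ht'
  have huv : u ≠ v := fun e => ht (e1.trans e.symm)
  obtain ⟨r, -, hr⟩ := intermediate_value_uIcc (a := t') (b := t) hf.continuousOn
    (show (u + v) / 2 ∈ Set.uIcc (f t') (f t) by
      rw [e1, e2, Set.mem_uIcc]
      rcases le_total u v with h | h
      · left; constructor <;> linarith
      · right; constructor <;> linarith)
  rcases h r with h | h
  · exact huv (by linarith)
  · exact huv (by linarith)

/-- The tangential orbits of a rationally integrable caustic form an invariant graph. -/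
lemma exists_graph_map_of_caustic (h : IsOval γ L o ψ) (hb : CurveBounds γ σ C k) (hσ : 0 < σ)
    (hC : 0 < C) (hk : 0 < k) {Ω : Set Plane} (hT : IsTable Ω γ L) {p q : ℕ} (hp : 1 ≤ p)
    (hpq : 2 * p ≤ q) (hc : AdmitsCaustic Ω γ L p q) :
    ∃ φ : ℝ → ℝ, StrictMono φ ∧ Function.Surjective φ ∧ (∀ x, φ^[q] x = x + p * L) ∧
      ∀ x, IsPeriodicSeq (billiardJet γ) (Set.Ioo 0 L) q (p * L) fun k => φ^[k] x := by
  obtain ⟨c, α, hca, hper⟩ := hc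
  obtain ⟨a, b, ha, hb', hab, htan, htop, hbot⟩ := h.exists_tangent_family hca.curve
    fun t s => hT.height_pos h.toIsConvexCurve (hca.mem t) s
  choose s hs hs0 hs1 using fun t => h.exists_orbit hb hσ hC hk (hab t).1 (hab t).2
  have hcont := IsBilliardOrbit.continuous_family h hs (by simpa only [hs0]) (by simpa only [hs1])
  have hq : 1 ≤ q := by omega
  have alt : ∀ t, IsPeriodicOrbit L p q (s t) := fun t =>
    hper _ (hs t) ⟨0, by simpa only [hs0, hs1, zero_add] using htan t⟩
  have h0 : ∀ t, s t q - s t 0 = p * L ∨ s t q - s t 0 = ((q : ℝ) - p) * L := fun t =>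
    (alt t).imp (fun e => by have := e 0; rw [zero_add] at this; linarith)
      (fun e => by have := e 0; rw [zero_add] at this; linarith)
  -- Each orbit may advance by p or by q - p periods; the displacement is continuous in t, so one
  -- value serves the whole family.
  rcases constant_of_two_values ((hcont q).sub (hcont 0)) (by simpa using h0) with h1 | h1
  · refine IsBilliardOrbit.exists_graph_map h hq hs (fun t k => ?_) hcont
      (by simpa only [hs0]) (by simpa only [hs0])
    rcases alt t with e | e
    · exact e k
    · have e0 := e 0
      have e1 := h1 t
      simp only [zero_add, Nat.cast_zero, Pi.sub_apply] at e0 e1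
      rw [e k]; linarith
  · have e : ∀ t k, s t (k + q) = s t k + ((q : ℝ) - p) * L := fun t k => by
      rcases alt t with e | e
      · have e0 := e 0
        have e1 := h1 t
        simp only [zero_add, Nat.cast_zero, Pi.sub_apply] at e0 e1
        rw [e k]; linarith
      · exact e k
    have em : ∀ t k (n : ℕ), s t (k + q * n) = s t k + n * (((q : ℝ) - p) * L) := fun t k n => by
      induction n with
      | zero => simp
      | succ n ih =>
        have := e t (k + q * n)
        rw [ih] at this
        rw [show k + (q : ℤ) * ((n + 1 : ℕ) : ℤ) = k + q * n + q by push_cast; ring, this]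
        push_cast; ring
    have hcb : Continuous fun t => s t 1 := by simpa only [hs1]
    -- Reversing orbits that advance by q - p periods gives orbits that advance by p.
    refine IsBilliardOrbit.exists_graph_map h hq (s := fun t n => s t (1 - n) + n * L)
      (fun t => (hs t).reverse h.periodic) (fun t k => ?_) (fun n => ?_) ?_ ?_
    · have := e t (1 - (k + q))
      rw [show 1 - (k + (q : ℤ)) + q = 1 - k by ring] at this
      push_cast; linarith
    · have h2 : ∀ t, s t (1 - (n : ℤ)) =
          s t ((1 + (q - 1) * n : ℕ) : ℤ) - n * (((q : ℝ) - p) * L) := fun t => by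
        have := em t (1 - n) n
        rw [show 1 - (n : ℤ) + q * n = ((1 + (q - 1) * n : ℕ) : ℤ) by
          push_cast [Nat.cast_sub hq]; ring] at this
        linarith
      simp only [h2]
      exact ((hcont _).sub continuous_const).add continuous_const
    · simp only [sub_zero, hs1, Int.cast_zero, zero_mul, add_zero]
      exact tendsto_atTop_mono (fun t => (hab t).1.le) htop
    · simp only [sub_zero, hs1, Int.cast_zero, zero_mul, add_zero]
      exact tendsto_atBot_mono (fun t => (hab t).2.le) (tendsto_atBot_add_const_right _ _ hbot)

/-- Billiards near a billiard with a rationally integrable caustic have exactly one loop orbit of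
the same rotation number through each boundary point, and it is uniformly nondegenerate. -/
theorem exists_unique_billiard_loop (q : ℕ) {σ C k : ℝ} (hσ : 0 < σ) (hC : 0 < C) (hk : 0 < k) :
    ∃ ε > 0, ∃ δ > 0, ∃ c > 0, ∀ (γ : ℝ → Plane) (L o : ℝ) (ψ : ℝ → ℝ) (Ω : Set Plane) (p : ℕ),
      IsOval γ L o ψ → CurveBounds γ σ C k →
      (∀ s t, ‖deriv (deriv γ) s - deriv (deriv γ) t‖ ≤ C * |s - t|) →
      IsTable Ω γ L → 1 ≤ p → 2 * p ≤ q → AdmitsCaustic Ω γ L p q →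
      ∀ (γ₁ : ℝ → Plane) (o₁ : ℝ) (ψ₁ : ℝ → ℝ), IsOval γ₁ L o₁ ψ₁ → CurveBounds γ₁ σ C k →
        CurveClose γ γ₁ ε → ∀ (x : ℝ) (X : ℕ → ℝ → ℝ),
          IsShooting (billiardJet γ₁) (Set.Ioo 0 L) q x X →
          ∃ y, y - x ∈ Set.Icc δ (L - δ) ∧ X q y = x + p * L ∧
            (∀ y', y' - x ∈ Set.Ioo 0 L → X q y' = x + p * L → y' = y) ∧
            ∃ d, HasDerivAt (X q) d y ∧ c ≤ d := by
  rcases Nat.eq_zero_or_pos q with rfl | hq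
  · exact ⟨1, one_pos, 1, one_pos, 1, one_pos, fun _ _ _ _ _ p _ _ _ _ _ _ => by omega⟩
  obtain ⟨δ, hδ, hgap⟩ := exists_gap_bound q hσ hC hk
  -- Closed segments have gaps in [δ, L - δ]. Working on [δ/2, L - δ/2] leaves the margin δ/2 that
  -- an invariant graph requires.
  obtain ⟨M, hM, ρ, hρ, N, hN, hjet⟩ := exists_jet_bounds hσ hC hk (half_pos hδ)
  obtain ⟨ε, hε, c, hc, hmain⟩ := exists_unique_closed_orbit q hq hM hρ hN (half_pos hδ)
  refine ⟨ε / N, by positivity, δ / 2, half_pos hδ, c, hc, ?_⟩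
  intro γ L o ψ Ω p h hb hlip hT hp hpq hca γ₁ o₁ ψ₁ h₁ hb₁ hcl x X hX
  obtain ⟨φ, hφ1, hφ2, hφ3, hφ4⟩ := exists_graph_map_of_caustic h hb hσ hC hk hT hp hpq hca
  obtain ⟨j1, j2, j3⟩ := hjet γ L o ψ h hb
  have hφ : InvariantGraph (billiardJet γ) (Set.Icc (δ / 2) (L - δ / 2)) (δ / 2) φ := by
    refine ⟨hφ1, hφ2, fun x d hd => ?_, fun x => (hφ4 x).del 0⟩
    have := hgap γ L o ψ h hb p hp (by omega) (fun n => φ^[n] x) (fun k _ => (hφ4 x).gap k)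
      (fun k _ => (hφ4 x).del k) (hφ3 x) 0 hq
    simp only [zero_add, Function.iterate_zero, id, Function.iterate_one, Set.mem_Icc] at this
    rw [abs_le] at hd
    constructor <;> linarith
  have hcl' := j3 γ₁ o₁ ψ₁ h₁ hb₁ _ hcl
  rw [mul_div_cancel₀ _ hN.ne'] at hcl'
  refine hmain ε hε le_rfl (Set.Ioo 0 L) (Set.Icc (δ / 2) (L - δ / 2)) (billiardJet γ) φ (p * L)
    h.isTwist (convex_Icc _ _) (fun t ht => ⟨by linarith [ht.1], by linarith [ht.2]⟩) j1 (j2 hlip)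
    hφ hφ3 _ h₁.isTwist hcl' x X hX fun y hy hXq k hk => ?_
  have := hgap γ₁ L o₁ ψ₁ h₁ hb₁ p hp (by omega) (fun n => X n y) (hX.gap y hy) (hX.del y hy)
    (by rw [hXq, hX.zero]) k hk
  exact ⟨by linarith [this.1], by linarith [this.2]⟩

end Orbits

/-! ## Closeness of curves -/

lemma norm_iterate_deriv_lt_of_cNorm_lt {k : ℕ} {f : ℝ → Plane} {ε : ℝ}
    (h : cNorm k f < ENNReal.ofReal ε) {j : ℕ} (hj : j ≤ k) (x : ℝ) : ‖deriv^[j] f x‖ < ε := by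
  rw [← iteratedDeriv_eq_iterate, ← norm_iteratedFDeriv_eq_norm_iteratedDeriv]
  exact norm_iteratedFDeriv_lt_of_cNorm_lt h hj x

section Close

variable {γ γ₁ : ℝ → Plane} {L o σ C k ε κ : ℝ} {ψ : ℝ → ℝ}

lemma CurveClose.of_cNorm (h : ContDiff ℝ 2 γ) (h₁ : ContDiff ℝ 2 γ₁)
    (hc : cNorm 2 (fun t => γ₁ t - γ t) < ENNReal.ofReal ε) : CurveClose γ γ₁ ε := by
  have e1 : deriv (fun t => γ₁ t - γ t) = fun t => deriv γ₁ t - deriv γ t := funext fun t =>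
    ((hasDerivAt_of_contDiff h₁ t).sub (hasDerivAt_of_contDiff h t)).deriv
  have e2 : deriv (deriv (fun t => γ₁ t - γ t)) =
      fun t => deriv (deriv γ₁) t - deriv (deriv γ) t := by
    rw [e1]; exact funext fun t => ((hasDerivAt_deriv h₁ t).sub (hasDerivAt_deriv h t)).deriv
  refine ⟨fun t => ?_, fun t => ?_, fun t => ?_⟩
  · exact (norm_iterate_deriv_lt_of_cNorm_lt hc (j := 0) (by norm_num) t).le
  · have := (norm_iterate_deriv_lt_of_cNorm_lt hc (j := 1) (by norm_num) t).le
    rwa [Function.iterate_one, e1] at this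
  · have := (norm_iterate_deriv_lt_of_cNorm_lt hc (j := 2) le_rfl t).le
    rwa [show deriv^[2] (fun t => γ₁ t - γ t) = deriv (deriv fun t => γ₁ t - γ t) from rfl,
      e2] at this

lemma CurveClose.trans {γ₂ : ℝ → Plane} {ε' : ℝ} (h : CurveClose γ γ₁ ε)
    (h' : CurveClose γ₁ γ₂ ε') : CurveClose γ γ₂ (ε + ε') where
  close₀ t := by
    linarith [norm_sub_le_norm_sub_add_norm_sub (γ₂ t) (γ₁ t) (γ t), h.close₀ t, h'.close₀ t]
  close₁ t := by
    linarith [norm_sub_le_norm_sub_add_norm_sub (deriv γ₂ t) (deriv γ₁ t) (deriv γ t),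
      h.close₁ t, h'.close₁ t]
  close₂ t := by
    linarith [norm_sub_le_norm_sub_add_norm_sub (deriv (deriv γ₂) t) (deriv (deriv γ₁) t)
      (deriv (deriv γ) t), h.close₂ t, h'.close₂ t]

lemma CurveClose.symm (h : CurveClose γ γ₁ ε) : CurveClose γ₁ γ ε where
  close₀ t := by rw [norm_sub_rev]; exact h.close₀ t
  close₁ t := by rw [norm_sub_rev]; exact h.close₁ t
  close₂ t := by rw [norm_sub_rev]; exact h.close₂ t

lemma CurveClose.mono {ε' : ℝ} (h : CurveClose γ γ₁ ε) (hε : ε ≤ ε') : CurveClose γ γ₁ ε' where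
  close₀ t := (h.close₀ t).trans hε
  close₁ t := (h.close₁ t).trans hε
  close₂ t := (h.close₂ t).trans hε

lemma CurveBounds.mono {σ' C' k' : ℝ} (h : CurveBounds γ σ C k) (hσ : σ' ≤ σ) (hC : C ≤ C')
    (hk : k' ≤ k) : CurveBounds γ σ' C' k' where
  speed t := hσ.trans (h.speed t)
  deriv_le t := (h.deriv_le t).trans hC
  deriv2_le t := (h.deriv2_le t).trans hC
  cr_ge t := hk.trans (h.cr_ge t)

/-- The cross product of velocity and acceleration is the curvature times the cube of the speed. -/
lemma CurveBounds.of_curvature (hκ : ∀ t, κ < curvature γ t) (hκ0 : 0 < κ) (hσ : 0 < σ)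
    (hs : ∀ t, σ ≤ ‖deriv γ t‖) {n : ℕ} (hn : 2 ≤ n) (hc : cNorm n γ < ENNReal.ofReal C) :
    CurveBounds γ σ C (κ * σ ^ 3) where
  speed := hs
  deriv_le t := (norm_iterate_deriv_lt_of_cNorm_lt hc (j := 1) (by omega) t).le
  deriv2_le t := (norm_iterate_deriv_lt_of_cNorm_lt hc (j := 2) hn t).le
  cr_ge t := by
    have h1 : κ < |cr (deriv γ t) (deriv (deriv γ) t)| / ‖deriv γ t‖ ^ 3 := hκ t
    rw [lt_div_iff₀ (pow_pos (hσ.trans_le (hs t)) 3)] at h1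
    refine le_trans ?_ h1.le
    gcongr
    exact hs t

lemma CurveClose.abs_cr_sub_le (h : CurveClose γ γ₁ ε) (hb : CurveBounds γ σ C k) (hC : 0 < C)
    (hε : ε ≤ C) (t : ℝ) :
    |cr (deriv γ₁ t) (deriv (deriv γ₁) t) - cr (deriv γ t) (deriv (deriv γ) t)| ≤ 3 * C * ε := by
  have e : cr (deriv γ₁ t) (deriv (deriv γ₁) t) - cr (deriv γ t) (deriv (deriv γ) t) =
      cr (deriv γ₁ t - deriv γ t) (deriv (deriv γ₁) t) +
        cr (deriv γ t) (deriv (deriv γ₁) t - deriv (deriv γ) t) := by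
    rw [sub_cr, cr_sub]; ring
  have h2 : ‖deriv (deriv γ₁) t‖ ≤ 2 * C := by
    have := norm_sub_norm_le (deriv (deriv γ₁) t) (deriv (deriv γ) t)
    linarith [h.close₂ t, hb.deriv2_le t]
  have hε0 : 0 ≤ ε := (norm_nonneg _).trans (h.close₀ t)
  rw [e]
  calc _ ≤ |cr (deriv γ₁ t - deriv γ t) (deriv (deriv γ₁) t)| +
        |cr (deriv γ t) (deriv (deriv γ₁) t - deriv (deriv γ) t)| := abs_add_le _ _
    _ ≤ ‖deriv γ₁ t - deriv γ t‖ * ‖deriv (deriv γ₁) t‖ +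
        ‖deriv γ t‖ * ‖deriv (deriv γ₁) t - deriv (deriv γ) t‖ :=
      add_le_add (abs_cr_le _ _) (abs_cr_le _ _)
    _ ≤ ε * (2 * C) + C * ε := by
      gcongr
      · exact h.close₁ t
      · exact hb.deriv_le t
      · exact h.close₂ t
    _ = 3 * C * ε := by ring

lemma CurveClose.curveBounds (h : CurveClose γ γ₁ ε) (hb : CurveBounds γ σ C k) (hC : 0 < C)
    (h1 : ε ≤ σ / 2) (h2 : ε ≤ C) (h3 : 3 * C * ε ≤ k / 2) :
    CurveBounds γ₁ (σ / 2) (2 * C) (k / 2) where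
  speed t := by
    have := norm_sub_norm_le (deriv γ t) (deriv γ₁ t)
    rw [norm_sub_rev] at this
    linarith [h.close₁ t, hb.speed t]
  deriv_le t := by
    have := norm_sub_norm_le (deriv γ₁ t) (deriv γ t)
    linarith [h.close₁ t, hb.deriv_le t]
  deriv2_le t := by
    have := norm_sub_norm_le (deriv (deriv γ₁) t) (deriv (deriv γ) t)
    linarith [h.close₂ t, hb.deriv2_le t]
  cr_ge t := by
    have := abs_sub_abs_le_abs_sub (cr (deriv γ t) (deriv (deriv γ) t))
      (cr (deriv γ₁ t) (deriv (deriv γ₁) t))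
    rw [abs_sub_comm] at this
    linarith [h.abs_cr_sub_le hb hC h2 t, hb.cr_ge t]

lemma CurveBounds.exists_isConvexCurve (hb : CurveBounds γ σ C k) (hσ : 0 < σ) (hk : 0 < k)
    (h : ContDiff ℝ 2 γ) : ∃ o ψ, IsConvexCurve γ o ψ :=
  LoopOrbits.exists_isConvexCurve h (fun t => norm_pos_iff.1 (hσ.trans_le (hb.speed t)))
    fun t => abs_pos.1 (hk.trans_le (hb.cr_ge t))

lemma CurveBounds.exists_isOval (hb : CurveBounds γ σ C k) (hσ : 0 < σ) (hk : 0 < k)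
    {Ω : Set Plane} (hT : IsTable Ω γ L) : ∃ o ψ, IsOval γ L o ψ :=
  let ⟨o, ψ, h⟩ := hb.exists_isConvexCurve hσ hk hT.contDiff
  ⟨o, ψ, hT.isOval h⟩

lemma lipschitz_deriv_deriv (h : ContDiff ℝ 3 γ) {n : ℕ} (hn : 3 ≤ n)
    (hc : cNorm n γ < ENNReal.ofReal C) (s t : ℝ) :
    ‖deriv (deriv γ) s - deriv (deriv γ) t‖ ≤ C * |s - t| := by
  have h1 : ContDiff ℝ 2 (deriv γ) :=
    ((contDiff_succ_iff_deriv (n := 2)).1 (by simpa [two_add_one_eq_three] using h)).2.2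
  have h2 := contDiff_deriv h1
  exact Convex.norm_image_sub_le_of_norm_deriv_le (f := deriv (deriv γ)) (s := Set.univ) (x := t)
    (y := s) (fun x _ => h2.differentiable one_ne_zero x)
    (fun x _ => (norm_iterate_deriv_lt_of_cNorm_lt hc (j := 3) hn x).le) convex_univ trivial trivial

end Close

/-! ## The billiard map -/

section Map

variable {γ : ℝ → Plane} {L o σ C k : ℝ} {ψ : ℝ → ℝ} {F : ℝ × ℝ → ℝ × ℝ}

lemma IsOval.map_eq (h : IsOval γ L o ψ) (hb : CurveBounds γ σ C k) (hσ : 0 < σ) (hC : 0 < C)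
    (hk : 0 < k) (hF : IsLiftedBilliardMap γ L F) {a b : ℝ} (h1 : a < b) (h2 : b < a + L) :
    F (a, -cosOut γ a b) = (b, -cosIn γ a b) := by
  have := h.cosOut_mem hb hσ hC hk h1 h2
  exact (hF _ _ _ _ ⟨by linarith [this.2], by linarith [this.1]⟩).2 ⟨h1, h2, rfl, rfl⟩

/-- Two consecutive iterates are described by the same chord, once by its outgoing and once by its
incoming angle; this form passes through the induction. -/
lemma IsOval.iterate_map_eq (h : IsOval γ L o ψ) (hb : CurveBounds γ σ C k) (hσ : 0 < σ)
    (hC : 0 < C) (hk : 0 < k) (hF : IsLiftedBilliardMap γ L F) {a b : ℝ} (h1 : a < b)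
    (h2 : b < a + L) (n : ℕ) : ∃ u v, u < v ∧ v < u + L ∧
      F^[n] (a, -cosOut γ a b) = (u, -cosOut γ u v) ∧
      F^[n + 1] (a, -cosOut γ a b) = (v, -cosIn γ u v) := by
  induction n with
  | zero => exact ⟨a, b, h1, h2, rfl, h.map_eq hb hσ hC hk hF h1 h2⟩
  | succ n ih =>
    obtain ⟨u, v, k1, k2, -, k3⟩ := ih
    obtain ⟨w, hw, e⟩ := h.exists_cosOut_eq hb hσ hC hk (h.cosIn_mem hb hσ hC hk k1 k2) v
    rw [← e] at k3
    refine ⟨v, w, hw.1, hw.2, k3, ?_⟩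
    rw [Function.iterate_succ_apply', k3, h.map_eq hb hσ hC hk hF hw.1 hw.2]

/-- The successive bounce points as functions of the first one. -/
def mapShooting (F : ℝ × ℝ → ℝ × ℝ) (γ : ℝ → Plane) (s : ℝ) (n : ℕ) (y : ℝ) : ℝ :=
  -- F is arbitrary outside |r| < 1, so the second point is prescribed directly: `IsShooting.one`
  -- has to hold for every y.
  if n = 1 then y else (F^[n] (s, -cosOut γ s y)).1

lemma IsOval.mapShooting_eq (h : IsOval γ L o ψ) (hb : CurveBounds γ σ C k) (hσ : 0 < σ)
    (hC : 0 < C) (hk : 0 < k) (hF : IsLiftedBilliardMap γ L F) {s y : ℝ} (h1 : s < y)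
    (h2 : y < s + L) (n : ℕ) : mapShooting F γ s n y = (F^[n] (s, -cosOut γ s y)).1 := by
  unfold mapShooting
  split_ifs with hn
  · rw [hn, Function.iterate_one, h.map_eq hb hσ hC hk hF h1 h2]
  · rfl

lemma IsOval.isShooting_map (h : IsOval γ L o ψ) (hb : CurveBounds γ σ C k) (hσ : 0 < σ)
    (hC : 0 < C) (hk : 0 < k) (hF : IsLiftedBilliardMap γ L F) (q : ℕ) (s : ℝ) :
    IsShooting (billiardJet γ) (Set.Ioo 0 L) q s (mapShooting F γ s) where
  zero y := rfl
  one y := rfl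
  gap y hy n _ := by
    have h1 : s < y := by linarith [hy.1]
    have h2 : y < s + L := by linarith [hy.2]
    obtain ⟨u, v, k1, k2, k3, k4⟩ := h.iterate_map_eq hb hσ hC hk hF h1 h2 n
    rw [h.mapShooting_eq hb hσ hC hk hF h1 h2, h.mapShooting_eq hb hσ hC hk hF h1 h2, k3, k4]
    exact ⟨by linarith, by linarith⟩
  del y hy n _ := by
    have h1 : s < y := by linarith [hy.1]
    have h2 : y < s + L := by linarith [hy.2]
    obtain ⟨u, v, k1, k2, k3, k4⟩ := h.iterate_map_eq hb hσ hC hk hF h1 h2 n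
    obtain ⟨u', v', -, -, k3', k4'⟩ := h.iterate_map_eq hb hσ hC hk hF h1 h2 (n + 1)
    rw [k4, Prod.mk.injEq, neg_inj] at k3'
    obtain ⟨rfl, e⟩ := k3'
    simp only [h.mapShooting_eq hb hσ hC hk hF h1 h2, k3, k4, k4']
    exact (del_iff h.regular _ _ _).2 e

end Map

/-- Billiards near one with a rationally integrable caustic have nondegenerate unique loops, in the
phase space of the billiard map. -/
theorem billiard_loops : ∀ (q : ℕ) (C κ₀ : ℝ), 0 < C → 0 < κ₀ →
    ∃ ε c : ℝ, 0 < ε ∧ 0 < c ∧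
      ∀ (p : ℕ) (L : ℝ) (Ω : Set Plane) (γ : ℝ → Plane),
        1 ≤ p → 2 * p ≤ q →
        IsTable Ω γ L → ContDiff ℝ 3 γ → (∀ s, ‖deriv γ s‖ = 1) →
        (∀ s, κ₀ < curvature γ s) → L < C →
        cNorm 3 γ < ENNReal.ofReal C →
        AdmitsCaustic Ω γ L p q →
        ∀ (Ω₁ : Set Plane) (γ₁ : ℝ → Plane) (F₁ : ℝ × ℝ → ℝ × ℝ),
          IsTable Ω₁ γ₁ L →
          cNorm 2 (fun s => γ₁ s - γ s) < ENNReal.ofReal ε →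
          IsLiftedBilliardMap γ₁ L F₁ →
          ∀ s : ℝ, ∃ r ∈ Set.Ioo (-1 : ℝ) 1,
            (F₁^[q] (s, r)).1 = s + p * L ∧
            (∀ r' ∈ Set.Ioo (-1 : ℝ) 1, (F₁^[q] (s, r')).1 = s + p * L → r' = r) ∧
            (∃ d : ℝ, HasDerivAt (fun r' : ℝ => (F₁^[q] (s, r')).1) d r ∧ c < |d|) ∧
            c < |r - 1| ∧ c < |r + 1| := by
  intro q C κ hC hκ
  set k := κ * 1 ^ 3 with hkdef
  have hk : 0 < k := by positivity
  have hσ2 : (0 : ℝ) < 1 / 2 := by norm_num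
  have hC2 : 0 < 2 * C := by positivity
  have hk2 : 0 < k / 2 := by positivity
  obtain ⟨ε₀, hε₀, δ, hδ, c₀, hc₀, hmain⟩ := exists_unique_billiard_loop q hσ2 hC2 hk2
  obtain ⟨M, hM, ρ, hρ, N, hN, hjet⟩ := exists_jet_bounds hσ2 hC2 hk2 hδ
  obtain ⟨c₁, hc₁, K, hK, hcos⟩ := exists_cos_bounds hσ2 hC2 hk2
  -- Here (1/2)/M bounds the derivative of the first bounce point in r from below, and c₁δ² bounds
  -- the distance of r from ±1; halving gives strict inequalities.
  refine ⟨min (min ε₀ (1 / 2)) (min C (k / (6 * C))), min (c₀ * (1 / 2 / M)) (c₁ * δ ^ 2) / 2,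
    by positivity, by positivity, ?_⟩
  intro p L Ω γ hp hpq hT hd3 hunit hcurv hLC hcn hca Ω₁ γ₁ F hT₁ hcl hF s
  set ε := min (min ε₀ (1 / 2)) (min C (k / (6 * C))) with hε
  have hε1 : ε ≤ ε₀ := (min_le_left _ _).trans (min_le_left _ _)
  have hε2 : ε ≤ 1 / 2 := (min_le_left _ _).trans (min_le_right _ _)
  have hε3 : ε ≤ C := (min_le_right _ _).trans (min_le_left _ _)
  have hε4 : ε ≤ k / (6 * C) := (min_le_right _ _).trans (min_le_right _ _)
  have hclose := CurveClose.of_cNorm hT.contDiff hT₁.contDiff hcl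
  have hb : CurveBounds γ 1 C k :=
    CurveBounds.of_curvature hcurv hκ one_pos (fun t => (hunit t).ge) (by norm_num) hcn
  have hb' : CurveBounds γ (1 / 2) (2 * C) (k / 2) :=
    hb.mono (by norm_num) (by linarith) (by linarith)
  have hb₁ : CurveBounds γ₁ (1 / 2) (2 * C) (k / 2) := hclose.curveBounds hb hC hε2 hε3 (by
    rw [le_div_iff₀ (by positivity)] at hε4; linarith)
  obtain ⟨o, ψ, h⟩ := hb.exists_isOval one_pos hk hT
  obtain ⟨o₁, ψ₁, h₁⟩ := hb₁.exists_isOval hσ2 hk2 hT₁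
  have hlip : ∀ s t, ‖deriv (deriv γ) s - deriv (deriv γ) t‖ ≤ 2 * C * |s - t| := fun s t =>
    (lipschitz_deriv_deriv hd3 le_rfl hcn s t).trans (by gcongr; linarith)
  have hX := h₁.isShooting_map hb₁ hσ2 hC2 hk2 hF q s
  obtain ⟨y, hy, hXy, huniq, d, hd, hcd⟩ := hmain γ L o ψ Ω p h hb' hlip hT hp hpq hca γ₁ o₁ ψ₁ h₁
    hb₁ (hclose.mono hε1) s _ hX
  have y1 : s < y := by linarith [hy.1]
  have y2 : y < s + L := by linarith [hy.2]
  have hmem := h₁.cosOut_mem hb₁ hσ2 hC2 hk2 y1 y2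
  have hr : -cosOut γ₁ s y ∈ Set.Ioo (-1 : ℝ) 1 := ⟨by linarith [hmem.2], by linarith [hmem.1]⟩
  have hXF := fun {y : ℝ} (y1 : s < y) (y2 : y < s + L) =>
    h₁.mapShooting_eq hb₁ hσ2 hC2 hk2 hF y1 y2 q
  have hpre : ∀ r' ∈ Set.Ioo (-1 : ℝ) 1, s < (F (s, r')).1 ∧ (F (s, r')).1 < s + L ∧
      r' = -cosOut γ₁ s (F (s, r')).1 := fun r' hr' => by
    have := (hF s r' (F (s, r')).1 (F (s, r')).2 hr').1 rfl
    exact ⟨this.1, this.2.1, this.2.2.1⟩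
  have hlow : min (c₀ * (1 / 2 / M)) (c₁ * δ ^ 2) / 2 < min (c₀ * (1 / 2 / M)) (c₁ * δ ^ 2) :=
    half_lt_self (by positivity)
  have hco := hcos γ₁ L o₁ ψ₁ h₁ hb₁ s y y1 y2
  refine ⟨-cosOut γ₁ s y, hr, ?_, fun r' hr' hr'q => ?_, ?_, ?_, ?_⟩
  · rw [← hXF y1 y2, hXy]
  · obtain ⟨z1, z2, e⟩ := hpre r' hr'
    rw [e, ← hXF z1 z2] at hr'q
    rw [e, huniq _ ⟨by linarith, by linarith⟩ hr'q]
  · have hY : HasDerivAt (fun r' => (F (s, r')).1)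
        ((-‖deriv γ₁ s‖ - (billiardJet γ₁).h11 (s, (F (s, -cosOut γ₁ s y)).1) * 0) /
          (billiardJet γ₁).h12 (s, (F (s, -cosOut γ₁ s y)).1)) (-cosOut γ₁ s y) := by
      refine h₁.isTwist.hasDerivAt_of_h1 (u := fun _ => s) (v := fun r' => -‖deriv γ₁ s‖ * r')
        (hasDerivAt_const _ _) (by simpa using (hasDerivAt_id _).const_mul (-‖deriv γ₁ s‖)) ?_
      filter_upwards [isOpen_Ioo.mem_nhds hr] with r' hr'
      obtain ⟨z1, z2, e⟩ := hpre r' hr'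
      refine ⟨⟨by linarith, by linarith⟩, ?_⟩
      rw [h1_eq_cosOut h₁.regular]
      conv_rhs => rw [e]
      ring
    have hFy : (F (s, -cosOut γ₁ s y)).1 = y := by rw [h₁.map_eq hb₁ hσ2 hC2 hk2 hF y1 y2]
    rw [hFy, mul_zero, sub_zero] at hY
    have hcomp := HasDerivAt.comp (h₂ := mapShooting F γ₁ s q) (-cosOut γ₁ s y) (by rwa [hFy]) hY
    refine ⟨_, hcomp.congr_of_eventuallyEq ?_, ?_⟩
    · filter_upwards [isOpen_Ioo.mem_nhds hr] with r' hr'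
      obtain ⟨z1, z2, e⟩ := hpre r' hr'
      simp only [Function.comp]
      rw [hXF z1 z2, ← e]
    · have hz : (s, y) ∈ gapSet (Set.Icc δ (L - δ)) := hy
      have b1 := (hjet γ₁ L o₁ ψ₁ h₁ hb₁).1.abs₁₂ _ hz
      have b2 := h₁.isTwist.neg (s, y) ⟨by linarith, by linarith⟩
      have b3 := hb₁.speed s
      rw [abs_of_neg b2] at b1
      have b4 : 1 / 2 / M ≤ -‖deriv γ₁ s‖ / (billiardJet γ₁).h12 (s, y) := by
        rw [show -‖deriv γ₁ s‖ / (billiardJet γ₁).h12 (s, y) =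
          ‖deriv γ₁ s‖ / -(billiardJet γ₁).h12 (s, y) by rw [div_neg, neg_div]]
        gcongr
        linarith
      refine lt_of_lt_of_le (hlow.trans_le (min_le_left _ _)) (le_trans ?_ (le_abs_self _))
      gcongr
      exact hc₀.le.trans hcd
  · rw [abs_sub_comm, abs_of_pos (by linarith [hr.2])]
    refine lt_of_lt_of_le (hlow.trans_le (min_le_right _ _)) ?_
    have : c₁ * δ ^ 2 ≤ c₁ * (s + L - y) ^ 2 := by gcongr; linarith [hy.2]
    linarith [hco.2.2.1.1]
  · rw [abs_of_pos (by linarith [hr.1])]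
    refine lt_of_lt_of_le (hlow.trans_le (min_le_right _ _)) ?_
    have : c₁ * δ ^ 2 ≤ c₁ * (y - s) ^ 2 := by gcongr; linarith [hy.1]
    linarith [hco.1.1]

/-! ## Loops of nearby billiards -/

section Near

variable {γ γ₁ : ℝ → Plane} {L o o₁ σ C k ε : ℝ} {ψ ψ₁ : ℝ → ℝ}

lemma IsConvexCurve.deriv_angle (h : IsConvexCurve γ o ψ) (t : ℝ) :
    HasDerivAt ψ (|cr (deriv γ t) (deriv (deriv γ) t)| / ‖deriv γ t‖ ^ 2) t := by
  have := h.angle t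
  rwa [← abs_of_pos (h.pos t), abs_mul, sign_abs h.sign, one_mul] at this

/-- A curve that is `C²`-close to an oval is an oval. -/
lemma IsOval.of_curveClose (h : IsOval γ L o ψ) (hb : CurveBounds γ σ C k) (hσ : 0 < σ)
    (hC : 0 < C) (h₁ : IsConvexCurve γ₁ o₁ ψ₁) (hp : Function.Periodic γ₁ L)
    (hc : CurveClose γ γ₁ ε) (h1 : ε ≤ σ / 2) (h2 : ε ≤ C)
    (h3 : 24 * C ^ 5 * ε < k * σ ^ 4) : IsOval γ₁ L o₁ ψ₁ := by
  have hL := h.period_pos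
  have hε0 : 0 ≤ ε := (norm_nonneg _).trans (hc.close₀ 0)
  obtain ⟨n, hn⟩ := h₁.exists_turning hp
  -- The rates of turning of the two curves are compared pointwise, without signs, since the
  -- orientations are not known to agree.
  have hd : ∀ t, |(|cr (deriv γ₁ t) (deriv (deriv γ₁) t)| / ‖deriv γ₁ t‖ ^ 2 -
      |cr (deriv γ t) (deriv (deriv γ) t)| / ‖deriv γ t‖ ^ 2)| ≤ 24 * C ^ 3 * ε / σ ^ 4 := by
    intro t
    have a1 := (abs_abs_sub_abs_le _ _).trans (hc.abs_cr_sub_le hb hC h2 t)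
    have a2 := (abs_norm_sub_norm_le _ _).trans (hc.close₁ t)
    have a3 : |cr (deriv γ t) (deriv (deriv γ) t)| ≤ C * C := (abs_cr_le _ _).trans
      (mul_le_mul (hb.deriv_le t) (hb.deriv2_le t) (norm_nonneg _) hC.le)
    have a4 := hb.deriv_le t
    have a5 := hb.speed t
    set u₁ := |cr (deriv γ₁ t) (deriv (deriv γ₁) t)|
    set u := |cr (deriv γ t) (deriv (deriv γ) t)| with hu
    have hu0 : 0 ≤ u := abs_nonneg _
    set v₁ := ‖deriv γ₁ t‖
    set v := ‖deriv γ t‖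
    rw [abs_le] at a2
    have b1 : σ / 2 ≤ v₁ := by linarith [a2.1]
    have b2 : v₁ ≤ 2 * C := by linarith [a2.2]
    have hv : 0 < v := hσ.trans_le a5
    have hv₁ : 0 < v₁ := (half_pos hσ).trans_le b1
    have a6 : |v₁ ^ 2 - v ^ 2| ≤ ε * (3 * C) := by
      rw [sq_sub_sq, mul_comm, abs_mul]
      gcongr
      · exact abs_le.2 a2
      · rw [abs_of_pos (by linarith)]; linarith
    have e : u₁ / v₁ ^ 2 - u / v ^ 2 =
        ((u₁ - u) * v ^ 2 - u * (v₁ ^ 2 - v ^ 2)) / (v₁ ^ 2 * v ^ 2) := by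
      field_simp; ring
    rw [e, abs_div, abs_of_pos (show 0 < v₁ ^ 2 * v ^ 2 by positivity)]
    calc _ ≤ (3 * C * ε * C ^ 2 + C * C * (ε * (3 * C))) / ((σ / 2) ^ 2 * σ ^ 2) := by
          gcongr
          refine (abs_sub _ _).trans ?_
          rw [abs_mul, abs_mul, abs_of_nonneg hu0, abs_of_nonneg (sq_nonneg v)]
          gcongr
      _ = _ := by field_simp; ring
  have hmv := Convex.norm_image_sub_le_of_norm_hasDerivWithin_le (f := fun t => ψ₁ t - ψ t)
    (s := Set.univ) (x := 0) (y := L)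
    (fun t _ => ((h₁.deriv_angle t).sub (h.deriv_angle t)).hasDerivWithinAt)
    (fun t _ => hd t) convex_univ trivial trivial
  have t1 := hn 0
  have t2 := h.turn 0
  rw [zero_add] at t1 t2
  rw [t1, t2, sub_zero, Real.norm_of_nonneg hL.le, Real.norm_eq_abs,
    show ψ₁ 0 + n * (2 * Real.pi) - (ψ 0 + 2 * Real.pi) - (ψ₁ 0 - ψ 0) =
      ((n - 1 : ℤ) : ℝ) * (2 * Real.pi) by push_cast; ring, abs_mul,
    abs_of_pos Real.two_pi_pos] at hmv
  have hper := h.period_le hb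
  -- The total turnings differ by less than 2π and are multiples of 2π, so γ₁ also turns once.
  have hlt : 24 * C ^ 3 * ε / σ ^ 4 * L < 2 * Real.pi := by
    refine lt_of_lt_of_le ?_ hper
    refine mul_lt_mul_of_pos_right ?_ hL
    rw [div_lt_div_iff₀ (by positivity) (by positivity)]
    linarith
  have hn1 : |((n - 1 : ℤ) : ℝ)| < 1 := by
    have := hmv.trans_lt hlt
    nlinarith [Real.two_pi_pos]
  rw [← Int.cast_abs] at hn1
  have hn2 : n - 1 = 0 := Int.abs_lt_one_iff.1 (by exact_mod_cast hn1)
  obtain rfl : n = 1 := by omega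
  exact { h₁ with period_pos := hL, periodic := hp, turn := fun t => by rw [hn]; simp }

/-- Supplies a billiard map, hence a shooting family, where only a curve is given. -/
lemma IsOval.exists_map (h : IsOval γ L o ψ) (hb : CurveBounds γ σ C k) (hσ : 0 < σ) (hC : 0 < C)
    (hk : 0 < k) : ∃ F, IsLiftedBilliardMap γ L F := by
  have ex : ∀ z : ℝ × ℝ, ∃ y, z.2 ∈ Set.Ioo (-1 : ℝ) 1 →
      y ∈ Set.Ioo z.1 (z.1 + L) ∧ cosOut γ z.1 y = -z.2 := fun z => by
    by_cases hz : z.2 ∈ Set.Ioo (-1 : ℝ) 1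
    · obtain ⟨y, h1, h2⟩ := h.exists_cosOut_eq hb hσ hC hk (v := -z.2)
        ⟨by linarith [hz.2], by linarith [hz.1]⟩ z.1
      exact ⟨y, fun _ => ⟨h1, h2⟩⟩
    · exact ⟨0, fun h => absurd h hz⟩
  choose Y hY using ex
  refine ⟨fun z => (Y z, -cosIn γ z.1 (Y z)), fun s r s' r' hr => ?_⟩
  obtain ⟨h1, h2⟩ := hY (s, r) hr
  rw [Prod.mk.injEq]
  constructor
  · rintro ⟨rfl, rfl⟩
    exact ⟨h1.1, h1.2, by rw [h2, neg_neg], rfl⟩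
  · rintro ⟨k1, k2, k3, rfl⟩
    obtain rfl : Y (s, r) = s' := h.cosOut_injOn s h1 ⟨k1, k2⟩ (by rw [h2, k3, neg_neg])
    exact ⟨rfl, rfl⟩

/-- By the twist condition the reflection law determines each point from the two before it, so a
loop is the shooting segment with its first two points. -/
lemma IsLoopOrbit.eq_shooting (h : IsOval γ L o ψ) {q : ℕ} (hq : 1 ≤ q) {τ : Fin (q + 1) → ℝ}
    (hτ : IsLoopOrbit γ L q τ) {X : ℕ → ℝ → ℝ}
    (hX : IsShooting (billiardJet γ) (Set.Ioo 0 L) q (τ 0) X) (n : ℕ) (hn : n < q) :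
    τ ⟨n, by omega⟩ = X n (τ ⟨1, by omega⟩) ∧
      τ ⟨n + 1, by omega⟩ = X (n + 1) (τ ⟨1, by omega⟩) := by
  have hgap : ∀ (n : ℕ) (hn : n < q),
      (τ ⟨n, by omega⟩, τ ⟨n + 1, by omega⟩) ∈ gapSet (Set.Ioo 0 L) := fun n hn => by
    have h1 := hτ.lt ⟨n, hn⟩
    have h2 := hτ.lt_add ⟨n, hn⟩
    exact ⟨sub_pos.2 h1, sub_lt_iff_lt_add'.2 h2⟩
  induction n with
  | zero => exact ⟨(hX.zero _).symm, (hX.one _).symm⟩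
  | succ n ih =>
    obtain ⟨e1, e2⟩ := ih (by omega) hgap
    have g0 : τ ⟨1, by omega⟩ - τ 0 ∈ Set.Ioo 0 L := hgap 0 hq
    have g1 := hX.gap _ g0 (n + 1) hn
    have d1 := hX.del _ g0 n hn
    have d2 := (del_iff h.regular _ _ _).2 (hτ.reflection n (by omega))
    have g2 := hgap (n + 1) hn
    rw [← e2] at g1
    rw [← e1, ← e2] at d1
    exact ⟨e2, h.isTwist.h1_inj g2 g1 (by linarith)⟩

lemma isLoopOrbit_of_isShooting (h : IsOval γ L o ψ) {q : ℕ} {x y : ℝ} {X : ℕ → ℝ → ℝ}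
    (hX : IsShooting (billiardJet γ) (Set.Ioo 0 L) q x X) (hy : y - x ∈ Set.Ioo 0 L)
    (hq : X q y = x + L) : IsLoopOrbit γ L q fun i => X i y where
  lt i := sub_pos.1 (hX.gap y hy i i.2).1
  lt_add i := sub_lt_iff_lt_add'.1 (hX.gap y hy i i.2).2
  reflection i hi := (del_iff h.regular _ _ _).1 (hX.del y hy i (by omega))
  closed := by
    simp only [Fin.val_last, Fin.val_zero, hq, hX.zero]

end Near

/-- Billiards in a neighbourhood that contains a billiard with a `4`-caustic have unique `4`-loops. -/
theorem four_loops : ∀ κ₀ σ C : ℝ, 0 < κ₀ → 0 < σ → 0 < C →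
    ∃ ε : ℝ, 0 < ε ∧
      ∀ (L : ℝ) (Ω₀ : Set Plane) (γ₀ : ℝ → Plane),
        IsTable Ω₀ γ₀ L → ContDiff ℝ 4 γ₀ →
        (∀ t, κ₀ < curvature γ₀ t) → (∀ t, σ ≤ ‖deriv γ₀ t‖) →
        cNorm 4 γ₀ < ENNReal.ofReal C →
        (∀ γ ∈ curveNhd L γ₀ ε C, ∃ Ω, IsTable Ω γ L) ∧
        ((∃ γ ∈ curveNhd L γ₀ ε C, ∃ Ω, IsTable Ω γ L ∧ AdmitsCaustic Ω γ L 1 4) →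
          ∀ γ ∈ curveNhd L γ₀ ε C, ∀ t : ℝ,
            ∃! τ : Fin 5 → ℝ, τ 0 = t ∧ IsLoopOrbit γ L 4 τ) := by
  intro κ σ C hκ hσ hC
  set k := κ * σ ^ 3 with hkdef
  have hk : 0 < k := by positivity
  have hσ2 := half_pos hσ
  have hC2 : 0 < 2 * C := by positivity
  have hk2 := half_pos hk
  obtain ⟨ε₀, hε₀, δ, hδ, c₀, hc₀, hmain⟩ := exists_unique_billiard_loop 4 hσ2 hC2 hk2
  refine ⟨min (min (ε₀ / 2) (σ / 2)) (min C (min (k / (6 * C)) (k * σ ^ 4 / (48 * C ^ 5)))),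
    by positivity, ?_⟩
  set ε := min (min (ε₀ / 2) (σ / 2)) (min C (min (k / (6 * C)) (k * σ ^ 4 / (48 * C ^ 5))))
    with hε
  have hε1 : ε ≤ ε₀ / 2 := (min_le_left _ _).trans (min_le_left _ _)
  have hε2 : ε ≤ σ / 2 := (min_le_left _ _).trans (min_le_right _ _)
  have hε3 : ε ≤ C := (min_le_right _ _).trans (min_le_left _ _)
  have hε4 : ε ≤ k / (6 * C) :=
    (min_le_right _ _).trans ((min_le_right _ _).trans (min_le_left _ _))
  have hε5 : ε ≤ k * σ ^ 4 / (48 * C ^ 5) :=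
    (min_le_right _ _).trans ((min_le_right _ _).trans (min_le_right _ _))
  intro L Ω₀ γ₀ hT₀ hd₀ hcurv hspeed hcn
  have hb₀ : CurveBounds γ₀ σ C k :=
    CurveBounds.of_curvature hcurv hκ hσ hspeed (by norm_num) hcn
  obtain ⟨o₀, ψ₀, h₀⟩ := hb₀.exists_isOval hσ hk hT₀
  have hnhd : ∀ γ ∈ curveNhd L γ₀ ε C, CurveClose γ₀ γ ε ∧ CurveBounds γ (σ / 2) (2 * C) (k / 2) ∧
      ∃ o ψ, IsOval γ L o ψ := by
    rintro γ ⟨hd, hper, hcl, -⟩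
    have hd2 : ContDiff ℝ 2 γ := hd.of_le (by norm_num)
    have hclose := CurveClose.of_cNorm hT₀.contDiff hd2 hcl
    have hb := hclose.curveBounds hb₀ hC hε2 hε3 (by
      rw [le_div_iff₀ (by positivity)] at hε4; linarith)
    obtain ⟨o, ψ, h⟩ := hb.exists_isConvexCurve hσ2 hk2 hd2
    refine ⟨hclose, hb, o, ψ, h₀.of_curveClose hb₀ hσ hC h hper hclose hε2 hε3 ?_⟩
    rw [le_div_iff₀ (by positivity)] at hε5
    have : 0 < k * σ ^ 4 := by positivity
    linarith
  refine ⟨fun γ hγ => ?_, ?_⟩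
  · obtain ⟨-, -, o, ψ, h⟩ := hnhd γ hγ
    exact ⟨_, h.isTable⟩
  · rintro ⟨γ, hγ, Ω, hT, hca⟩ γ₁ hγ₁ t
    obtain ⟨hcl, hb, o, ψ, h⟩ := hnhd γ hγ
    obtain ⟨hcl₁, hb₁, o₁, ψ₁, h₁⟩ := hnhd γ₁ hγ₁
    have hlip : ∀ s t, ‖deriv (deriv γ) s - deriv (deriv γ) t‖ ≤ 2 * C * |s - t| := fun s t =>
      (lipschitz_deriv_deriv (hγ.1.of_le (by norm_num)) (by norm_num) hγ.2.2.2 s t).trans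
        (by gcongr; linarith)
    obtain ⟨F, hF⟩ := h₁.exists_map hb₁ hσ2 hC2 hk2
    have hX := h₁.isShooting_map hb₁ hσ2 hC2 hk2 hF 4 t
    -- The curve with the caustic and γ₁ are both within ε of γ₀, hence within 2ε ≤ ε₀ of each
    -- other.
    obtain ⟨y, hy, hXy, huniq, -⟩ := hmain γ L o ψ Ω 1 h hb hlip hT le_rfl (by norm_num) hca γ₁ o₁
      ψ₁ h₁ hb₁ ((hcl.symm.trans hcl₁).mono (by linarith)) t _ hX
    rw [Nat.cast_one, one_mul] at hXy huniq
    have hy' : y - t ∈ Set.Ioo 0 L := ⟨by linarith [hy.1], by linarith [hy.2]⟩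
    refine ⟨fun i => mapShooting F γ₁ t i y,
      ⟨hX.zero y, isLoopOrbit_of_isShooting h₁ hX hy' hXy⟩, ?_⟩
    rintro τ ⟨rfl, hτ⟩
    have key := hτ.eq_shooting h₁ (by norm_num) hX
    have e4 : τ 4 = mapShooting F γ₁ (τ 0) 4 (τ 1) := (key 3 (by norm_num)).2
    have e1 : τ 1 = y := huniq _
      ⟨sub_pos.2 (hτ.lt 0), sub_lt_iff_lt_add'.2 (hτ.lt_add 0)⟩ (e4.symm.trans hτ.closed)
    rw [← e1]
    funext i
    rcases (show (i : ℕ) = 4 ∨ (i : ℕ) < 4 by omega) with hi | hi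
    · obtain rfl : i = 4 := Fin.ext hi
      exact e4
    · exact (key i hi).1

end LoopOrbits
end

theorem mainTheorem5 :
    -- 4-loop orbits of billiards near a strictly convex one
    (∀ κ₀ σ C : ℝ, 0 < κ₀ → 0 < σ → 0 < C →
      ∃ ε : ℝ, 0 < ε ∧
        ∀ (L : ℝ) (Ω₀ : Set LoopOrbits.Plane) (γ₀ : ℝ → LoopOrbits.Plane),
          LoopOrbits.IsTable Ω₀ γ₀ L → ContDiff ℝ 4 γ₀ →
          (∀ t, κ₀ < LoopOrbits.curvature γ₀ t) → (∀ t, σ ≤ ‖deriv γ₀ t‖) →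
          LoopOrbits.cNorm 4 γ₀ < ENNReal.ofReal C →
          (∀ γ ∈ LoopOrbits.curveNhd L γ₀ ε C, ∃ Ω, LoopOrbits.IsTable Ω γ L) ∧
          ((∃ γ ∈ LoopOrbits.curveNhd L γ₀ ε C, ∃ Ω,
              LoopOrbits.IsTable Ω γ L ∧ LoopOrbits.AdmitsCaustic Ω γ L 1 4) →
            ∀ γ ∈ LoopOrbits.curveNhd L γ₀ ε C, ∀ t : ℝ,
              ∃! τ : Fin 5 → ℝ, τ 0 = t ∧ LoopOrbits.IsLoopOrbit γ L 4 τ)) ∧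
    -- (p, q)-loop orbits of twist maps
    (∀ (q : ℕ) (M B ρ : ℝ), 1 ≤ q → 0 < M → 0 < B → 0 < ρ →
      ∃ ε c : ℝ, 0 < ε ∧ 0 < c ∧
        ∀ (p : ℤ) (H : ℝ × ℝ → ℝ) (F : ℝ × ℝ → ℝ × ℝ),
          LoopOrbits.IsTwistGenerating H M ρ → ContDiff ℝ 3 H →
          (∀ z, ‖iteratedFDeriv ℝ 3 H z‖ ≤ B) →
          LoopOrbits.IsGeneratedBy F H → LoopOrbits.HasIntegrableCurve F p q →
          ∀ (H₁ : ℝ × ℝ → ℝ) (F₁ : ℝ × ℝ → ℝ × ℝ),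
            (∃ M₁ ρ₁ : ℝ, LoopOrbits.IsTwistGenerating H₁ M₁ ρ₁) →
            LoopOrbits.IsGeneratedBy F₁ H₁ →
            LoopOrbits.cNorm 2 (fun z => H₁ z - H z) < ENNReal.ofReal ε →
            ∀ x : ℝ, ∃ r : ℝ,
              (F₁^[q] (x, r)).1 = x + p ∧
              (∀ r' : ℝ, (F₁^[q] (x, r')).1 = x + p → r' = r) ∧
              ∃ d : ℝ, HasDerivAt (fun r' : ℝ => (F₁^[q] (x, r')).1) d r ∧ c < |d|) ∧
    -- (p, q)-loop orbits of billiards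
    (∀ (q : ℕ) (C κ₀ : ℝ), 0 < C → 0 < κ₀ →
      ∃ ε c : ℝ, 0 < ε ∧ 0 < c ∧
        ∀ (p : ℕ) (L : ℝ) (Ω : Set LoopOrbits.Plane) (γ : ℝ → LoopOrbits.Plane),
          1 ≤ p → 2 * p ≤ q →
          LoopOrbits.IsTable Ω γ L → ContDiff ℝ 3 γ → (∀ s, ‖deriv γ s‖ = 1) →
          (∀ s, κ₀ < LoopOrbits.curvature γ s) → L < C →
          LoopOrbits.cNorm 3 γ < ENNReal.ofReal C →
          LoopOrbits.AdmitsCaustic Ω γ L p q →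
          ∀ (Ω₁ : Set LoopOrbits.Plane) (γ₁ : ℝ → LoopOrbits.Plane) (F₁ : ℝ × ℝ → ℝ × ℝ),
            LoopOrbits.IsTable Ω₁ γ₁ L →
            LoopOrbits.cNorm 2 (fun s => γ₁ s - γ s) < ENNReal.ofReal ε →
            LoopOrbits.IsLiftedBilliardMap γ₁ L F₁ →
            ∀ s : ℝ, ∃ r ∈ Set.Ioo (-1 : ℝ) 1,
              (F₁^[q] (s, r)).1 = s + p * L ∧
              (∀ r' ∈ Set.Ioo (-1 : ℝ) 1, (F₁^[q] (s, r')).1 = s + p * L → r' = r) ∧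
              (∃ d : ℝ, HasDerivAt (fun r' : ℝ => (F₁^[q] (s, r')).1) d r ∧ c < |d|) ∧
              c < |r - 1| ∧ c < |r + 1|) := by
  exact ⟨LoopOrbits.four_loops, LoopOrbits.twist_loops, LoopOrbits.billiard_loops⟩
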